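/- Let $\Bbbk$ be a field of characteristic $p>0$. **Conventions.** $\mathbb N=\{0,1,2,\dots\}$. By a *symmetric monoidal $\Bbbk$-category* we mean a $\Bbbk$-linear abelian symmetric monoidal category $(\mathbf C,\otimes,\mathbb 1,\gamma)$ with $\mathbb 1\neq 0$ for which $-\otimes-$ is right exact and $\Bbbk$-linear in both variables. A *tensor category over $\Bbbk$* is an essentially small such category in which moreover $\Bbbk\to\mathrm{End}(\mathbb 1)$ is an isomorphism and every object has a dual. A *tensor functor* between symmetric monoidal $\Bbbk$-categories is a right exact $\Bbbk$-linear symmetric (strong) monoidal functor. For an object $X$ of a symmetric monoidal $\Bbbk$-category, the symmetric group $\mathsf S_n$ acts on $\otimes^nX$ through the braiding $\gamma$. Let $\Lambda^nX$ be the image of $\sum_{\sigma\in\mathsf S_n}\mathrm{sgn}(\sigma)\,\sigma:\otimes^nX\to\otimes^nX$, let $\Gamma^nX=\mathrm H^0(\mathsf S_n,\otimes^nX)\subset\otimes^nX$ be the invariants and $\mathrm{Sym}^nX=\mathrm H_0(\mathsf S_n,\otimes^nX)$ the coinvariants. For $j\in\mathbb N$ let $\mathtt{Fr}_+^{(j)}X$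 be the image of the composite $\Gamma^{p^j}X\hookrightarrow\otimes^{p^j}X\twoheadrightarrow\mathrm{Sym}^{p^j}X$, and put $$[X]_{\mathbb 1}=\sup\{n\in\mathbb N\mid \Lambda^n(\mathtt{Fr}_+^{(j)}X)\neq 0\text{ for all }j\in\mathbb N\}\in\mathbb N\cup\{\infty\}.$$ Let $\mathbf T$ be a tensor category over $\Bbbk$, and equip $\mathrm{Ind}\,\mathbf T$ with the symmetric monoidal structure extending the one of $\mathbf T$ and commuting with filtered colimits. An object $X$ of $\mathbf T$ is *locally free* if there are a non-zero commutative algebra $\mathscr A$ in $\mathrm{Ind}\,\mathbf T$ and $m\in\mathbb N$ with $\mathscr A\otimes X\simeq\mathscr A\otimes\mathbb 1^{\oplus m}$ as $\mathscr A$-modules in $\mathrm{Ind}\,\mathbf T$. **Theorem.** For an object $X$ of $\mathbf T$, the following conditions are equivalent. 1. $[X]_{\mathbb 1}\in\mathbb N$ and $\Lambda^rX=0$ for all $r>[X]_{\mathbb 1}$. 2. (a) There exists $n\in\mathbb N$ such that $\Lambda^nX=0$; and (b) for all $j,n\in\mathbb N$, if $\Lambda^n(\mathtt{Fr}_+^{(j)}X)=0$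 then $\Lambda^nX=0$. 3. $X$ is locally free. 4. There exist a symmetric monoidal $\Bbbk$-category $\mathbf C$, a tensor functor $F:\mathbf T\to\mathbf C$ and $m\in\mathbb N$ such that $F(X)\simeq\mathbb 1^{\oplus m}$ in $\mathbf C$. -/

import Mathlib

universe w v u v₂ u₂

namespace TensorCat

open CategoryTheory MonoidalCategory Limits Opposite

noncomputable section

set_option linter.unusedSectionVars false

section SymmetricGroup

/- The action of the symmetric group on tensor powers requires its presentation by adjacent
transpositions, which is proved first. -/
theorem exists_removal {n : ℕ} (σ : Equiv.Perm (Fin (n + 1))) :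
    ∃ e : Equiv.Perm (Fin n), ∀ k, σ k.succ = (σ 0).succAbove (e k) := by
  have h : ∀ k : Fin n, ∃ l, (σ 0).succAbove l = σ k.succ := fun k =>
    Fin.exists_succAbove_eq (fun h => Fin.succ_ne_zero k (σ.injective h))
  choose f hf using h
  have hinj : Function.Injective f := fun a b hab => by
    have : σ a.succ = σ b.succ := by rw [← hf a, ← hf b, hab]
    exact Fin.succ_injective _ (σ.injective this)
  exact ⟨Equiv.ofBijective f (Finite.injective_iff_bijective.1 hinj), fun k => (hf k).symm⟩

/-- The product `s (n - 1) * ⋯ * s 1 * s 0`. -/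
def descProd {M : Type*} [Monoid M] (s : ℕ → M) : ℕ → M
  | 0 => 1
  | n + 1 => s n * descProd s n

/- Elements of a monoid that satisfy the Coxeter relations of type `A` define a homomorphism from
the symmetric group. -/
set_option maxHeartbeats 1000000 in
theorem exists_permHom {M : Type*} [Monoid M] (n : ℕ) : ∀ (s : ℕ → M)
    (_ : ∀ i, i + 1 < n → s i * s i = 1)
    (_ : ∀ i, i + 2 < n → s i * s (i + 1) * s i = s (i + 1) * s i * s (i + 1))
    (_ : ∀ i j, i + 2 ≤ j → j + 1 < n → s i * s j = s j * s i),
    ∃ ρ : Equiv.Perm (Fin n) →* M, ∀ (i : ℕ) (h : i + 1 < n),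
      ρ (Equiv.swap ⟨i, Nat.lt_of_succ_lt h⟩ ⟨i + 1, h⟩) = s i := by
  induction n with
  | zero => intro s _ _ _; exact ⟨1, fun i h => absurd h (by omega)⟩
  | succ n ih =>
    intro s hsq hbr hcomm
    obtain ⟨ρ', hρ'⟩ := ih (fun i => s (i + 1)) (fun i hi => hsq _ (by omega))
      (fun i hi => hbr _ (by omega)) (fun i j hij hj => hcomm _ _ (by omega) (by omega))
    choose e he using exists_removal (n := n)
    -- relations between the cycles and the generators
    have hlow : ∀ i p, i < p → p < n → s i * descProd s (p + 1) = descProd s (p + 1) * s (i + 1) := by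
      intro i p hip hp
      induction p with
      | zero => omega
      | succ p ihp =>
        rcases Nat.lt_succ_iff_lt_or_eq.1 hip with h | h
        · have := ihp h (by omega)
          rw [descProd, ← mul_assoc, hcomm i (p + 1) (by omega) (by omega), mul_assoc, this,
            ← mul_assoc]
        · subst h
          have hd : ∀ q, q ≤ i → descProd s q * s (i + 1) = s (i + 1) * descProd s q := by
            intro q hq
            induction q with
            | zero => simp [descProd]
            | succ q ihq =>
              rw [descProd, mul_assoc, ihq (by omega), ← mul_assoc,
                hcomm q (i + 1) (by omega) (by omega), mul_assoc]
          rw [descProd, descProd, ← mul_assoc, ← mul_assoc, hbr i (by omega), mul_assoc,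
            mul_assoc, ← hd i le_rfl]
          simp only [mul_assoc]
    have hhigh : ∀ i p, p < i → i < n → s i * descProd s p = descProd s p * s i := by
      intro i p hpi hi
      induction p with
      | zero => simp [descProd]
      | succ p ihp =>
        rw [descProd, ← mul_assoc, ← hcomm p i (by omega) (by omega), mul_assoc,
          ihp (by omega), mul_assoc]
    have heq : ∀ (σ τ : Equiv.Perm (Fin (n + 1))) (t : Equiv.Perm (Fin n)),
        (∀ x, (τ 0).succAbove (t x) = (τ * σ⁻¹) ((σ 0).succAbove x)) → e τ = t * e σ := by
      intro σ τ t h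
      ext1 k
      apply Fin.succAbove_right_injective (p := τ 0)
      rw [← he τ, Equiv.Perm.mul_apply, h, ← he σ]
      simp
    let F : Equiv.Perm (Fin (n + 1)) → M := fun σ => descProd s (σ 0).val * ρ' (e σ)
    have hstep : ∀ (i : ℕ) (h : i + 1 < n + 1) (σ : Equiv.Perm (Fin (n + 1))),
        F (Equiv.swap ⟨i, Nat.lt_of_succ_lt h⟩ ⟨i + 1, h⟩ * σ) = s i * F σ := by
      intro i h σ
      set w : Equiv.Perm (Fin (n + 1)) := Equiv.swap ⟨i, Nat.lt_of_succ_lt h⟩ ⟨i + 1, h⟩ with hw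
      have hwv : ∀ x : Fin (n + 1), (w x).val =
          if x.val = i then i + 1 else if x.val = i + 1 then i else x.val := by
        intro x
        rw [hw, Equiv.swap_apply_def]
        simp only [Fin.ext_iff]
        split_ifs <;> simp_all
      have hz : ((w * σ) 0).val = if (σ 0).val = i then i + 1 else
          if (σ 0).val = i + 1 then i else (σ 0).val := by rw [Equiv.Perm.mul_apply, hwv]
      have hlt := (σ 0).isLt
      have key : ∀ t : Equiv.Perm (Fin n), (∀ x, (w (σ 0)).succAbove (t x) =
          w ((σ 0).succAbove x)) → e (w * σ) = t * e σ := by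
        intro t ht
        apply heq
        intro x
        rw [Equiv.Perm.mul_apply, ht]
        simp
      have hsw : ∀ (a : ℕ) (ha : a + 1 < n) (x : Fin n),
          ((Equiv.swap (⟨a, Nat.lt_of_succ_lt ha⟩ : Fin n) ⟨a + 1, ha⟩) x).val =
          if x.val = a then a + 1 else if x.val = a + 1 then a else x.val := by
        intro a ha x
        rw [Equiv.swap_apply_def]
        simp only [Fin.ext_iff]
        split_ifs <;> simp_all
      have hsa : ∀ (p : Fin (n + 1)) (x : Fin n),
          (p.succAbove x).val = if x.val < p.val then x.val else x.val + 1 := by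
        intro p x
        simp only [Fin.succAbove, Fin.lt_def, Fin.val_castSucc]
        split_ifs <;> simp
      show descProd s ((w * σ) 0).val * ρ' (e (w * σ)) = s i * (descProd s (σ 0).val * ρ' (e σ))
      rw [hz]
      rcases lt_trichotomy (σ 0).val i with hlt' | heq' | hgt
      · obtain ⟨a, rfl⟩ : ∃ a, i = a + 1 := ⟨i - 1, by omega⟩
        rw [if_neg (by omega), if_neg (by omega), key (Equiv.swap ⟨a, by omega⟩ ⟨a + 1, by omega⟩),
          map_mul, hρ' a (by omega), ← mul_assoc, ← mul_assoc, hhigh _ _ hlt' (by omega)]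
        intro x
        ext1
        simp only [hsa, hwv, hsw]
        split_ifs <;> omega
      · rw [if_pos heq', key 1, one_mul, heq', descProd, mul_assoc]
        intro x
        ext1
        simp only [hsa, hwv, Equiv.Perm.one_apply]
        split_ifs <;> omega
      · by_cases h1 : (σ 0).val = i + 1
        · rw [if_neg (by omega), if_pos h1, key 1, one_mul, h1, descProd, ← mul_assoc,
            ← mul_assoc, hsq i h, one_mul]
          intro x
          ext1
          simp only [hsa, hwv, Equiv.Perm.one_apply]
          split_ifs <;> omega
        · obtain ⟨p, hp⟩ : ∃ p, (σ 0).val = p + 1 := ⟨(σ 0).val - 1, by omega⟩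
          rw [if_neg (by omega), if_neg h1, key (Equiv.swap ⟨i, by omega⟩ ⟨i + 1, by omega⟩),
            map_mul, hρ' i (by omega), hp, ← mul_assoc, ← mul_assoc, hlow i p (by omega) (by omega)]
          intro x
          ext1
          simp only [hsa, hwv, hsw]
          split_ifs <;> omega
    have hone : F 1 = 1 := by
      have : e 1 = 1 := by
        ext1 k
        apply Fin.succAbove_right_injective (p := (1 : Equiv.Perm (Fin (n + 1))) 0)
        rw [← he 1]; simp
      show descProd s _ * ρ' (e 1) = 1
      rw [this]; simp [descProd]
    clear_value F
    clear heq hlow hhigh he e hρ' ρ' hsq hbr hcomm ih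
    have hmul : ∀ σ τ, F (σ * τ) = F σ * F τ := by
      intro σ
      have hσ : σ ∈ Submonoid.closure (Set.range fun i : Fin n => Equiv.swap i.castSucc i.succ) := by
        rw [Equiv.Perm.mclosure_swap_castSucc_succ]; trivial
      refine Submonoid.closure_induction_left
        (motive := fun σ _ => ∀ τ, F (σ * τ) = F σ * F τ) ?_ ?_ hσ
      · intro τ; rw [one_mul, hone, one_mul]
      · rintro _ ⟨i, rfl⟩ y _ ihy τ
        have h : ∀ y, F (Equiv.swap i.castSucc i.succ * y) = s i.val * F y := 
          hstep i.val (Nat.succ_lt_succ i.isLt)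
        show F (Equiv.swap i.castSucc i.succ * y * τ) = F (Equiv.swap i.castSucc i.succ * y) * F τ
        rw [mul_assoc, h, h, ihy, mul_assoc]
    refine ⟨⟨⟨F, hone⟩, hmul⟩, fun i h => ?_⟩
    have := hstep i h 1
    rw [mul_one, hone, mul_one] at this
    exact this

end SymmetricGroup

section TensorPower

variable {C : Type u} [Category.{v} C] [MonoidalCategory C]

/-- The tensor power `⊗ⁿ X = X ⊗ (X ⊗ (⋯ ⊗ 𝟙))`. -/
def tensorPow (X : C) : ℕ → C
  | 0 => 𝟙_ C
  | n + 1 => X ⊗ tensorPow X n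

/-- The braiding of the first two factors of `⊗ⁿ X`. -/
def headSwap [BraidedCategory C] (X : C) : (n : ℕ) → (tensorPow X n ⟶ tensorPow X n)
  | n + 2 => (α_ X X (tensorPow X n)).inv ≫ (β_ X X).hom ▷ tensorPow X n ≫
      (α_ X X (tensorPow X n)).hom
  | 1 => 𝟙 _
  | 0 => 𝟙 _

/-- The braiding of the factors of `⊗ⁿ X` in positions `i` and `i + 1` (counted from `0`); the
identity when `n ≤ i + 1`. -/
def adjSwap [BraidedCategory C] (X : C) : (i n : ℕ) → (tensorPow X n ⟶ tensorPow X n)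
  | 0, n => headSwap X n
  | i + 1, n + 1 => X ◁ adjSwap X i n
  | _ + 1, 0 => 𝟙 _

theorem adjSwap_sq [SymmetricCategory C] (X : C) : ∀ i n, adjSwap X i n ≫ adjSwap X i n = 𝟙 _
  | 0, n + 2 => by
    change ((α_ X X (tensorPow X n)).inv ≫ (β_ X X).hom ▷ tensorPow X n ≫
      (α_ X X (tensorPow X n)).hom) ≫ ((α_ X X (tensorPow X n)).inv ≫ (β_ X X).hom ▷ tensorPow X n ≫
      (α_ X X (tensorPow X n)).hom) = 𝟙 (X ⊗ X ⊗ tensorPow X n)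
    simp [← comp_whiskerRight_assoc]
  | i + 1, n + 1 => by
    change X ◁ adjSwap X i n ≫ X ◁ adjSwap X i n = 𝟙 (X ⊗ tensorPow X n)
    rw [← whiskerLeft_comp, adjSwap_sq X i n, whiskerLeft_id]
  | 0, 1 => Category.comp_id _
  | 0, 0 => Category.comp_id _
  | _ + 1, 0 => Category.comp_id _

theorem adjSwap_braid [SymmetricCategory C] (X : C) : ∀ i n, i + 2 < n →
    adjSwap X i n ≫ adjSwap X (i + 1) n ≫ adjSwap X i n =
      adjSwap X (i + 1) n ≫ adjSwap X i n ≫ adjSwap X (i + 1) n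
  | 0, n + 3, _ => by
    change ((α_ X X (X ⊗ tensorPow X n)).inv ≫ (β_ X X).hom ▷ (X ⊗ tensorPow X n) ≫
        (α_ X X (X ⊗ tensorPow X n)).hom) ≫
      (X ◁ ((α_ X X (tensorPow X n)).inv ≫ (β_ X X).hom ▷ tensorPow X n ≫
        (α_ X X (tensorPow X n)).hom)) ≫
      ((α_ X X (X ⊗ tensorPow X n)).inv ≫ (β_ X X).hom ▷ (X ⊗ tensorPow X n) ≫
        (α_ X X (X ⊗ tensorPow X n)).hom) =
      (X ◁ ((α_ X X (tensorPow X n)).inv ≫ (β_ X X).hom ▷ tensorPow X n ≫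
        (α_ X X (tensorPow X n)).hom)) ≫
      ((α_ X X (X ⊗ tensorPow X n)).inv ≫ (β_ X X).hom ▷ (X ⊗ tensorPow X n) ≫
        (α_ X X (X ⊗ tensorPow X n)).hom) ≫
      (X ◁ ((α_ X X (tensorPow X n)).inv ≫ (β_ X X).hom ▷ tensorPow X n ≫
        (α_ X X (tensorPow X n)).hom))
    generalize tensorPow X n = Z
    have h : (α_ X X (X ⊗ Z)).inv ≫ (α_ (X ⊗ X) X Z).inv ≫
        ((β_ X X).hom ▷ X ⊗≫ X ◁ (β_ X X).hom ⊗≫ (β_ X X).hom ▷ X) ▷ Z ≫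
        (α_ (X ⊗ X) X Z).hom ≫ (α_ X X (X ⊗ Z)).hom =
        (α_ X X (X ⊗ Z)).inv ≫ (α_ (X ⊗ X) X Z).inv ≫
        (𝟙 _ ⊗≫ (X ◁ (β_ X X).hom ⊗≫ (β_ X X).hom ▷ X ⊗≫ X ◁ (β_ X X).hom) ⊗≫ 𝟙 _) ▷ Z ≫
        (α_ (X ⊗ X) X Z).hom ≫ (α_ X X (X ⊗ Z)).hom := by
      rw [BraidedCategory.yang_baxter' X X X]
    refine Eq.trans ?_ (h.trans ?_)
    · monoidal
    · monoidal
  | i + 1, n + 1, h => by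
    change X ◁ adjSwap X i n ≫ X ◁ adjSwap X (i + 1) n ≫ X ◁ adjSwap X i n =
      X ◁ adjSwap X (i + 1) n ≫ X ◁ adjSwap X i n ≫ X ◁ adjSwap X (i + 1) n
    simp only [← whiskerLeft_comp]
    rw [adjSwap_braid X i n (by omega)]

theorem braid_comm_aux [BraidedCategory C] (X : C) {Z : C} (f : Z ⟶ Z) :
    ((α_ X X Z).inv ≫ (β_ X X).hom ▷ Z ≫ (α_ X X Z).hom) ≫ (X ◁ X ◁ f) =
      (X ◁ X ◁ f) ≫ ((α_ X X Z).inv ≫ (β_ X X).hom ▷ Z ≫ (α_ X X Z).hom) := by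
  have := whisker_exchange (β_ X X).hom f
  rw [tensor_whiskerLeft] at this
  rw [Category.assoc, Iso.inv_comp_eq, ← cancel_mono (α_ X X Z).inv]
  simpa using this.symm

theorem adjSwap_comm [BraidedCategory C] (X : C) : ∀ i j n, i + 2 ≤ j → j + 1 < n →
    adjSwap X i n ≫ adjSwap X j n = adjSwap X j n ≫ adjSwap X i n
  | 0, j + 2, n + 2, _, _ => braid_comm_aux X (adjSwap X j n)
  | i + 1, j + 1, n + 1, h, h' => by
    change X ◁ adjSwap X i n ≫ X ◁ adjSwap X j n = X ◁ adjSwap X j n ≫ X ◁ adjSwap X i n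
    rw [← whiskerLeft_comp, ← whiskerLeft_comp, adjSwap_comm X i j n (by omega) (by omega)]

/- There is exactly one action of the symmetric group `Sₙ` on `⊗ⁿ X` for which adjacent transpositions
act by the braiding. -/
theorem existsUnique_permAction [SymmetricCategory C] (X : C) (n : ℕ) :
    ∃! ρ : Equiv.Perm (Fin n) →* End (tensorPow X n), ∀ (i : ℕ) (h : i + 1 < n),
      ρ (Equiv.swap ⟨i, Nat.lt_of_succ_lt h⟩ ⟨i + 1, h⟩) = adjSwap X i n := by
  obtain ⟨ρ, hρ⟩ := exists_permHom (M := End (tensorPow X n)) n (fun i => adjSwap X i n)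
    (fun i _ => adjSwap_sq X i n)
    (fun i h => by
      simp only [End.mul_def]
      exact adjSwap_braid X i n h)
    (fun i j h h' => (adjSwap_comm X i j n h h').symm)
  refine ⟨ρ, hρ, fun ρ' hρ' => ?_⟩
  cases n with
  | zero => ext1 σ; rw [Subsingleton.elim σ 1, map_one, map_one]
  | succ n =>
    refine MonoidHom.eq_of_eqOn_denseM (Equiv.Perm.mclosure_swap_castSucc_succ n) ?_
    rintro _ ⟨i, rfl⟩
    exact (hρ' i.val (Nat.succ_lt_succ i.isLt)).trans (hρ i.val (Nat.succ_lt_succ i.isLt)).symm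

/-- The action of the symmetric group `Sₙ` on `⊗ⁿ X` by the braiding. -/
def permAction [SymmetricCategory C] (X : C) (n : ℕ) :
    Equiv.Perm (Fin n) →* End (tensorPow X n) :=
  (existsUnique_permAction X n).choose

theorem permAction_swap [SymmetricCategory C] (X : C) (n i : ℕ) (h : i + 1 < n) :
    permAction X n (Equiv.swap ⟨i, Nat.lt_of_succ_lt h⟩ ⟨i + 1, h⟩) = adjSwap X i n :=
  (existsUnique_permAction X n).choose_spec.1 i h

section Powers

attribute [local instance] Abelian.hasFiniteBiproducts

variable [Abelian C] [SymmetricCategory C]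

/-- The antisymmetriser `∑ sgn(σ) σ` on `⊗ⁿ X`. -/
def antisymmetrizer (X : C) (n : ℕ) : tensorPow X n ⟶ tensorPow X n :=
  ∑ σ : Equiv.Perm (Fin n), ((Equiv.Perm.sign σ : ℤˣ) : ℤ) • End.asHom (permAction X n σ)

/-- The exterior power `Λⁿ X`: the image of the antisymmetriser. -/
def extPow (X : C) (n : ℕ) : C :=
  image (antisymmetrizer X n)

/-- The divided power `Γⁿ X = H⁰(Sₙ, ⊗ⁿ X)`: the largest subobject of `⊗ⁿ X` on which `Sₙ` acts
trivially. -/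
def divPow (X : C) (n : ℕ) : C :=
  kernel (biproduct.lift fun σ : Equiv.Perm (Fin n) => 𝟙 (tensorPow X n) - End.asHom (permAction X n σ))

/-- The inclusion of `Γⁿ X` in `⊗ⁿ X`. -/
def divPowι (X : C) (n : ℕ) : divPow X n ⟶ tensorPow X n :=
  kernel.ι _

/-- The symmetric power `Symⁿ X = H₀(Sₙ, ⊗ⁿ X)`: the largest quotient of `⊗ⁿ X` on which `Sₙ` acts
trivially. -/
def symPow (X : C) (n : ℕ) : C :=
  cokernel (biproduct.desc fun σ : Equiv.Perm (Fin n) => 𝟙 (tensorPow X n) - End.asHom (permAction X n σ))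

/-- The projection of `⊗ⁿ X` onto `Symⁿ X`. -/
def symPowπ (X : C) (n : ℕ) : tensorPow X n ⟶ symPow X n :=
  cokernel.π _

/-- The Frobenius twist `Fr₊⁽ʲ⁾ X`: the image of `Γ^{pʲ} X → ⊗^{pʲ} X → Sym^{pʲ} X`. -/
def frob (p j : ℕ) (X : C) : C :=
  image (divPowι X (p ^ j) ≫ symPowπ X (p ^ j))

/-- The number `[X]₁`, the supremum in `ℕ ∪ {∞}` of all `n` such that `Λⁿ (Fr₊⁽ʲ⁾ X) ≠ 0` for
all `j`. -/
def unitMult (p : ℕ) (X : C) : ℕ∞ :=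
  sSup {a : ℕ∞ | ∃ n : ℕ, a = n ∧ ∀ j : ℕ, ¬ IsZero (extPow (frob p j X) n)}

end Powers

end TensorPower

section IndTensor

open scoped MonoidalCategory.ExternalProduct MonoidalCategory.DayConvolution

variable {T : Type u} [Category.{v} T] [MonoidalCategory T]

theorem essSmall_prod (A B : Type*) [Category A] [Category B] [EssentiallySmall.{v} A]
    [EssentiallySmall.{v} B] : EssentiallySmall.{v} (A × B) :=
  EssentiallySmall.mk' ((equivSmallModel A).prod (equivSmallModel B))

theorem hasKan [EssentiallySmall.{v} T] (F : Tᵒᵖ × Tᵒᵖ ⥤ Type v) :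
    (tensor Tᵒᵖ).HasPointwiseLeftKanExtension F := fun Y => by
  have := essSmall_prod.{v} Tᵒᵖ Tᵒᵖ
  have : HasColimitsOfShape (CostructuredArrow (tensor Tᵒᵖ) Y) (Type v) := 
     hasColimitsOfShape_of_essentiallySmall.{v} _ _
  infer_instance

/- An ind-object is a small filtered colimit of representable presheaves; the following facts describe
its elements. -/
theorem pres_rep {A : Tᵒᵖ ⥤ Type v} (P : IndObjectPresentation A) {a : Tᵒᵖ} (f : A.obj a) :
    ∃ (i : P.I) (u : a.unop ⟶ P.F.obj i), (P.ι.app i).app a u = f := by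
  have h := isColimitOfPreserves ((evaluation _ _).obj a) P.coconeIsColimit
  obtain ⟨i, u, hu⟩ := Types.jointly_surjective _ h f
  exact ⟨i, u, hu⟩

theorem pres_eq {A : Tᵒᵖ ⥤ Type v} (P : IndObjectPresentation A) {a : Tᵒᵖ} {i i' : P.I}
    (u : a.unop ⟶ P.F.obj i) (u' : a.unop ⟶ P.F.obj i')
    (h : (P.ι.app i).app a u = (P.ι.app i').app a u') :
    ∃ (j : P.I) (f : i ⟶ j) (f' : i' ⟶ j), u ≫ P.F.map f = u' ≫ P.F.map f' := by
  have hc := isColimitOfPreserves ((evaluation _ _).obj a) P.coconeIsColimit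
  exact (Types.FilteredColimit.isColimit_eq_iff _ hc).1 h

theorem pres_naturality {A : Tᵒᵖ ⥤ Type v} (P : IndObjectPresentation A) {a a' : Tᵒᵖ} (g : a ⟶ a')
    {i : P.I} (u : a.unop ⟶ P.F.obj i) :
    (P.ι.app i).app a' (g.unop ≫ u) = A.map g ((P.ι.app i).app a u) :=
  ((P.ι.app i).naturality_apply g u)

section
variable (F G : Tᵒᵖ ⥤ Type v) [DayConvolution F G] (P : IndObjectPresentation F)
  (Q : IndObjectPresentation G)

/-- The element of `A` given by the `i`-th structure map of a presentation. -/
def gen {A : Tᵒᵖ ⥤ Type v} (P : IndObjectPresentation A) (i : P.I) : A.obj (op (P.F.obj i)) :=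
  yonedaEquiv (P.ι.app i)

theorem map_gen {A : Tᵒᵖ ⥤ Type v} (P : IndObjectPresentation A) (i : P.I) {a : Tᵒᵖ} 
    (u : a.unop ⟶ P.F.obj i) : A.map u.op (gen P i) = (P.ι.app i).app a u :=
  map_yonedaEquiv _ _

theorem map_gen' {A : Tᵒᵖ ⥤ Type v} (P : IndObjectPresentation A) {i j : P.I} 
    (f : i ⟶ j) : A.map (P.F.map f).op (gen P j) = gen P i := by
  rw [gen, yonedaEquiv_naturality, gen]
  congr 1
  exact P.cocone.w f

/-- The diagram of the objects `Pᵢ ⊗ Qⱼ`. -/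
abbrev dayDiagram : P.I × Q.I ⥤ T := P.F.prod Q.F ⋙ tensor T

variable {F G} in
abbrev pr {a b : Tᵒᵖ} (x : F.obj a) (y : G.obj b) : (F ⊠ G).obj (a, b) :=
  ((x, y) : F.obj a × G.obj b)

variable {F G} in
theorem unit_nat {a a' b b' : Tᵒᵖ} (f : a ⟶ a') (g : b ⟶ b') (x : F.obj a) (y : G.obj b) :
    (F ⊛ G).map (f ⊗ₘ g) ((DayConvolution.unit F G).app (a, b) (pr x y)) =
      (DayConvolution.unit F G).app (a', b') (pr (F.map f x) (G.map g y)) :=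
  ((DayConvolution.unit F G).naturality_apply (X := (a, b)) (Y := (a', b')) (Prod.mkHom f g) (pr x y)).symm

/-- The Day convolution of the ind-objects `colim Pᵢ` and `colim Qⱼ` is a cocone on the objects
`Pᵢ ⊗ Qⱼ`. -/
def dayCocone : Cocone (dayDiagram F G P Q ⋙ yoneda) where
  pt := F ⊛ G
  ι :=
    { app := fun k => yonedaEquiv.symm ((DayConvolution.unit F G).app
        (op (P.F.obj k.1), op (Q.F.obj k.2)) (pr (gen P k.1) (gen Q k.2)))
      naturality := by
        intro k l f
        have h := unit_nat (F := F) (G := G) (P.F.map f.1).op (Q.F.map f.2).op (gen P l.1) (gen Q l.2)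
        rw [map_gen', map_gen'] at h
        refine (yonedaEquiv_symm_naturality_left _ _ _).trans ?_
        refine Eq.trans (congrArg yonedaEquiv.symm h) ?_
        exact (Category.comp_id _).symm }

section
variable (s : Cocone (dayDiagram F G P Q ⋙ yoneda))

theorem val_indep {a b : Tᵒᵖ} {i i' : P.I} {j j' : Q.I} (u : a.unop ⟶ P.F.obj i)
    (u' : a.unop ⟶ P.F.obj i') (w : b.unop ⟶ Q.F.obj j) (w' : b.unop ⟶ Q.F.obj j')
    (hu : (P.ι.app i).app a u = (P.ι.app i').app a u')
    (hw : (Q.ι.app j).app b w = (Q.ι.app j').app b w') :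
    (s.ι.app (i, j)).app (op (a.unop ⊗ b.unop)) (u ⊗ₘ w) =
      (s.ι.app (i', j')).app (op (a.unop ⊗ b.unop)) (u' ⊗ₘ w') := by
  obtain ⟨k, f, f', hf⟩ := pres_eq P u u' hu
  obtain ⟨l, g, g', hg⟩ := pres_eq Q w w' hw
  have h1 : ∀ {i : P.I} {j : Q.I} (f : i ⟶ k) (g : j ⟶ l) (u : a.unop ⟶ P.F.obj i)
      (w : b.unop ⟶ Q.F.obj j), (s.ι.app (i, j)).app (op (a.unop ⊗ b.unop)) (u ⊗ₘ w) =
      (s.ι.app (k, l)).app (op (a.unop ⊗ b.unop)) ((u ≫ P.F.map f) ⊗ₘ (w ≫ Q.F.map g)) := by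
    intro i j f g u w
    rw [← s.w (Prod.mkHom f g : (i, j) ⟶ (k, l)), ← tensorHom_comp_tensorHom]
    rfl
  rw [h1 f g, h1 f' g', hf, hg]

/-- The map out of `F × G` induced by a cocone. -/
def dayDescFun {a b : Tᵒᵖ} (p : F.obj a × G.obj b) : s.pt.obj (op (a.unop ⊗ b.unop)) :=
  (s.ι.app ((pres_rep P p.1).choose, (pres_rep Q p.2).choose)).app
      (op (a.unop ⊗ b.unop))
      ((pres_rep P p.1).choose_spec.choose ⊗ₘ (pres_rep Q p.2).choose_spec.choose)

theorem dayDescFun_apply {a b : Tᵒᵖ} {i : P.I} {j : Q.I} (u : a.unop ⟶ P.F.obj i)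
    (w : b.unop ⟶ Q.F.obj j) :
    dayDescFun F G P Q s ((P.ι.app i).app a u, (Q.ι.app j).app b w) =
      (s.ι.app (i, j)).app (op (a.unop ⊗ b.unop)) (u ⊗ₘ w) :=
  val_indep F G P Q s _ _ _ _ (pres_rep P ((P.ι.app i).app a u)).choose_spec.choose_spec
    (pres_rep Q ((Q.ι.app j).app b w)).choose_spec.choose_spec

/-- `dayDescFun` as a natural transformation. -/
def dayDescAux : F ⊠ G ⟶ tensor Tᵒᵖ ⋙ s.pt where
  app := fun ab => ↾(dayDescFun F G P Q s : F.obj ab.1 × G.obj ab.2 → _)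
  naturality := by
    rintro ⟨a, b⟩ ⟨a', b'⟩ ⟨f, g⟩
    ext ⟨x, y⟩
    obtain ⟨i, u, rfl⟩ := pres_rep P x
    obtain ⟨j, w, rfl⟩ := pres_rep Q y
    change dayDescFun F G P Q s (F.map f ((P.ι.app i).app a u), G.map g ((Q.ι.app j).app b w)) =
      s.pt.map (f ⊗ₘ g) (dayDescFun F G P Q s ((P.ι.app i).app a u, (Q.ι.app j).app b w))
    rw [← pres_naturality, ← pres_naturality, dayDescFun_apply, dayDescFun_apply,
      ← tensorHom_comp_tensorHom]
    exact (s.ι.app (i, j)).naturality_apply (f ⊗ₘ g) (u ⊗ₘ w)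

end

theorem dayCocone_ι_comp (K : Tᵒᵖ ⥤ Type v) (m : F ⊛ G ⟶ K) (i : P.I) (j : Q.I) :
    (dayCocone F G P Q).ι.app (i, j) ≫ m = yonedaEquiv.symm
      ((DayConvolution.unit F G ≫ Functor.whiskerLeft _ m).app 
        (op (P.F.obj i), op (Q.F.obj j)) (pr (gen P i) (gen Q j))) :=
  yonedaEquiv_symm_naturality_right _ _ _

/-- `(colim Pᵢ) ⊛ (colim Qⱼ) = colim (Pᵢ ⊗ Qⱼ)`. -/
def dayCoconeIsColimit : IsColimit (dayCocone F G P Q) where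
  desc s := (DayConvolution.corepresentableBy F G).homEquiv.symm (dayDescAux F G P Q s)
  fac s := by
    rintro ⟨i, j⟩
    rw [dayCocone_ι_comp]
    have h : DayConvolution.unit F G ≫ Functor.whiskerLeft _ 
      ((DayConvolution.corepresentableBy F G).homEquiv.symm (dayDescAux F G P Q s)) = 
        dayDescAux F G P Q s := 
      (DayConvolution.corepresentableBy F G).homEquiv.apply_symm_apply (dayDescAux F G P Q s)
    rw [h, Equiv.symm_apply_eq]
    change dayDescFun F G P Q s (gen P i, gen Q j) = _
    have h1 : gen P i = (P.ι.app i).app _ (𝟙 _) := rfl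
    have h2 : gen Q j = (Q.ι.app j).app _ (𝟙 _) := rfl
    rw [h1, h2, dayDescFun_apply, yonedaEquiv_apply, id_tensorHom_id]
  uniq s m hm := by
    apply (DayConvolution.corepresentableBy F G).homEquiv.injective
    rw [Equiv.apply_symm_apply]
    change DayConvolution.unit F G ≫ Functor.whiskerLeft _ m = _
    ext ⟨a, b⟩ ⟨x, y⟩
    obtain ⟨i, u, rfl⟩ := pres_rep P x
    obtain ⟨j, w, rfl⟩ := pres_rep Q y
    have h := (dayCocone_ι_comp F G P Q s.pt m i j).symm.trans (hm (i, j))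
    rw [Equiv.symm_apply_eq] at h
    change _ = dayDescFun F G P Q s ((P.ι.app i).app a u, (Q.ι.app j).app b w)
    rw [dayDescFun_apply, ← map_gen, ← map_gen]
    have h3 := (DayConvolution.unit F G ≫ Functor.whiskerLeft _ m).naturality_apply 
      (X := (op (P.F.obj i), op (Q.F.obj j))) (Y := (a, b)) (Prod.mkHom u.op w.op) (pr (gen P i) (gen Q j))
    refine h3.trans ?_
    rw [h]
    exact map_yonedaEquiv (s.ι.app (i, j)) (u ⊗ₘ w)

theorem isIndObject_convolution (hF : IsIndObject F) (hG : IsIndObject G) :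
    IsIndObject (F ⊛ G) :=
  IsIndObject.mk (.ofCocone _ (dayCoconeIsColimit F G hF.presentation hG.presentation))
end

theorem unit_key {U : Tᵒᵖ ⥤ Type v} (e : yoneda.obj (𝟙_ T) ≅ U) {c : Tᵒᵖ} (f : op (𝟙_ T) ⟶ c) :
    e.inv.app c (U.map f (yonedaEquiv e.hom)) = f.unop := by
  have h : U.map f (yonedaEquiv e.hom) = e.hom.app c f.unop := map_yonedaEquiv e.hom f.unop
  rw [h]
  exact e.hom_inv_id_app_apply c f.unop

theorem unit_key' {U : Tᵒᵖ ⥤ Type v} (e : yoneda.obj (𝟙_ T) ≅ U) {c : Tᵒᵖ} (x : U.obj c) :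
    U.map (e.inv.app c x).op (yonedaEquiv e.hom) = x := by
  have h : U.map (e.inv.app c x).op (yonedaEquiv e.hom) = e.hom.app c (e.inv.app c x) :=
    map_yonedaEquiv e.hom (e.inv.app c x)
  rw [h]
  exact e.inv_hom_id_app_apply c x

/-- The presheaf represented by the tensor unit is a unit for Day convolution. -/
abbrev dayUnit {U : Tᵒᵖ ⥤ Type v} (e : yoneda.obj (𝟙_ T) ≅ U) : DayConvolutionUnit U where
  can := ↾fun _ => yonedaEquiv e.hom
  isPointwiseLeftKanExtensionCan c :=
    { desc := fun s => ↾fun x => s.ι.app (CostructuredArrow.mk (Y := ⟨PUnit.unit⟩)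
        (Quiver.Hom.op (e.inv.app c x) : op (𝟙_ T) ⟶ c)) PUnit.unit
      fac := fun s j => by
        obtain ⟨⟨⟨⟩⟩, ⟨⟨⟩⟩, f⟩ := j
        ext ⟨⟩
        change s.ι.app (CostructuredArrow.mk (Y := ⟨PUnit.unit⟩)
          (Quiver.Hom.op (e.inv.app c (U.map f (yonedaEquiv e.hom))) : op (𝟙_ T) ⟶ c))
            PUnit.unit = _
        rw [unit_key e (show op (𝟙_ T) ⟶ c from f)]
        rfl
      uniq := fun s m hm => by
        ext x
        change _ = s.ι.app (CostructuredArrow.mk (Y := ⟨PUnit.unit⟩)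
          (Quiver.Hom.op (e.inv.app c x) : op (𝟙_ T) ⟶ c)) PUnit.unit
        rw [← hm]
        exact congrArg (fun y : U.obj c => m y) (unit_key' e x).symm }

variable [EssentiallySmall.{v} T]
open LawfulDayConvolutionMonoidalCategoryStruct InducedLawfulDayConvolutionMonoidalCategoryStructCore

/-- Day convolutions of presheaves on an essentially small category exist. -/
abbrev dayConv (F G : Tᵒᵖ ⥤ Type v) : DayConvolution F G :=
  haveI := hasKan (F ⊠ G)
  { convolution := (tensor Tᵒᵖ).pointwiseLeftKanExtension (F ⊠ G)
    unit := (tensor Tᵒᵖ).pointwiseLeftKanExtensionUnit (F ⊠ G)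
    isPointwiseLeftKanExtensionUnit :=
      (tensor Tᵒᵖ).pointwiseLeftKanExtensionIsPointwiseLeftKanExtension (F ⊠ G) }

/-- The tensor product of ind-objects, `(colim Pᵢ) ⊗ (colim Qⱼ) = colim (Pᵢ ⊗ Qⱼ)`, realised as the
Day convolution of presheaves. -/
def indTensorObj (A B : Ind T) : Ind T :=
  letI := dayConv ((Ind.inclusion T).obj A) ((Ind.inclusion T).obj B)
  (Ind.equivalence T).inverse.obj
    ⟨(Ind.inclusion T).obj A ⊛ (Ind.inclusion T).obj B,
      isIndObject_convolution _ _ A.isIndObject_inclusion_obj B.isIndObject_inclusion_obj⟩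

/-- The data from which the monoidal structure on `Ind T` is induced. -/
abbrev indCore : InducedLawfulDayConvolutionMonoidalCategoryStructCore Tᵒᵖ (Type v) (Ind T) where
  ι := Ind.inclusion T
  fullyFaithulι := Ind.inclusion.fullyFaithful
  tensorObj := indTensorObj
  convolutions' A B := dayConv _ _
  tensorObjIsoConvolution A B :=
    (ObjectProperty.ι _).mapIso ((Ind.equivalence T).counitIso.app _)
  tensorUnit := Ind.yoneda.obj (𝟙_ T)
  tensorUnitConvolutionUnit := dayUnit (Ind.yonedaCompInclusion.symm.app (𝟙_ T))

instance indMonoidalStruct : MonoidalCategoryStruct (Ind T) :=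
  letI := indCore (T := T)
  mkMonoidalCategoryStruct Tᵒᵖ (Type v) (Ind T)

instance indLawful : LawfulDayConvolutionMonoidalCategoryStruct Tᵒᵖ (Type v) (Ind T) :=
  letI := indCore (T := T)
  mkLawfulDayConvolutionMonoidalCategoryStruct Tᵒᵖ (Type v) (Ind T)

/-- The monoidal structure on `Ind T` extending the one on `T`. -/
instance indMonoidal : MonoidalCategory (Ind T) :=
  monoidalOfLawfulDayConvolutionMonoidalCategoryStruct Tᵒᵖ (Type v) (Ind T)


section
variable [SymmetricCategory T]

instance opSymmetric : SymmetricCategory Tᵒᵖ where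
  symmetry X Y := Quiver.Hom.unop_inj (SymmetricCategory.symmetry (unop X) (unop Y))

attribute [local instance] LawfulDayConvolutionMonoidalCategoryStruct.convolution
  LawfulDayConvolutionMonoidalCategoryStruct.convolution₂
  LawfulDayConvolutionMonoidalCategoryStruct.convolution₂'

/-- The braiding on `Ind T`. -/
def indBraiding (A B : Ind T) : A ⊗ B ≅ B ⊗ A :=
  Ind.inclusion.fullyFaithful.preimageIso (DayConvolution.braiding
    ((ι Tᵒᵖ (Type v) (Ind T)).obj A) ((ι Tᵒᵖ (Type v) (Ind T)).obj B))

theorem ι_indBraiding (A B : Ind T) : (ι Tᵒᵖ (Type v) (Ind T)).map (indBraiding A B).hom =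
    (DayConvolution.braiding
    ((ι Tᵒᵖ (Type v) (Ind T)).obj A) ((ι Tᵒᵖ (Type v) (Ind T)).obj B)).hom :=
  Ind.inclusion.fullyFaithful.map_preimage _

theorem ι_map_associator_inv (A B D : Ind T) : (ι Tᵒᵖ (Type v) (Ind T)).map (α_ A B D).inv =
    (DayConvolution.associator ((ι Tᵒᵖ (Type v) (Ind T)).obj A) ((ι Tᵒᵖ (Type v) (Ind T)).obj B)
      ((ι Tᵒᵖ (Type v) (Ind T)).obj D)).inv := by
  have h : (ι Tᵒᵖ (Type v) (Ind T)).mapIso (α_ A B D) = DayConvolution.associator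
      ((ι Tᵒᵖ (Type v) (Ind T)).obj A) ((ι Tᵒᵖ (Type v) (Ind T)).obj B)
      ((ι Tᵒᵖ (Type v) (Ind T)).obj D) :=
    Iso.ext (ι_map_associator_hom_eq_associator_hom Tᵒᵖ (Type v) (Ind T) A B D)
  exact congrArg Iso.inv h

instance indSymmetric : SymmetricCategory (Ind T) where
  braiding := indBraiding
  braiding_naturality_right X Y Z f := by
    apply (ι Tᵒᵖ (Type v) (Ind T)).map_injective
    rw [Functor.map_comp, Functor.map_comp, ← MonoidalCategory.id_tensorHom, ← MonoidalCategory.tensorHom_id,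
      ι_map_tensorHom_hom_eq_tensorHom, ι_map_tensorHom_hom_eq_tensorHom, ι_indBraiding,
      ι_indBraiding, CategoryTheory.Functor.map_id]
    exact DayConvolution.braiding_naturality_right _ _
  braiding_naturality_left f Z := by
    apply (ι Tᵒᵖ (Type v) (Ind T)).map_injective
    rw [Functor.map_comp, Functor.map_comp, ← MonoidalCategory.id_tensorHom, ← MonoidalCategory.tensorHom_id,
      ι_map_tensorHom_hom_eq_tensorHom, ι_map_tensorHom_hom_eq_tensorHom, ι_indBraiding,
      ι_indBraiding, CategoryTheory.Functor.map_id]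
    exact DayConvolution.braiding_naturality_left _ _
  hexagon_forward X Y Z := by
    apply (ι Tᵒᵖ (Type v) (Ind T)).map_injective
    simp only [Functor.map_comp]
    rw [← MonoidalCategory.id_tensorHom, ← MonoidalCategory.tensorHom_id,
      ι_map_tensorHom_hom_eq_tensorHom, ι_map_tensorHom_hom_eq_tensorHom, ι_indBraiding,
      ι_indBraiding, ι_indBraiding, CategoryTheory.Functor.map_id, CategoryTheory.Functor.map_id,
      ι_map_associator_hom_eq_associator_hom, ι_map_associator_hom_eq_associator_hom,
      ι_map_associator_hom_eq_associator_hom]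
    exact DayConvolution.hexagon_forward ((ι Tᵒᵖ (Type v) (Ind T)).obj X)
      ((ι Tᵒᵖ (Type v) (Ind T)).obj Y) ((ι Tᵒᵖ (Type v) (Ind T)).obj Z)
  hexagon_reverse X Y Z := by
    apply (ι Tᵒᵖ (Type v) (Ind T)).map_injective
    simp only [Functor.map_comp]
    rw [← MonoidalCategory.id_tensorHom, ← MonoidalCategory.tensorHom_id,
      ι_map_tensorHom_hom_eq_tensorHom, ι_map_tensorHom_hom_eq_tensorHom, ι_indBraiding,
      ι_indBraiding, ι_indBraiding, CategoryTheory.Functor.map_id, CategoryTheory.Functor.map_id,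
      ι_map_associator_inv, ι_map_associator_inv, ι_map_associator_inv]
    exact DayConvolution.hexagon_reverse ((ι Tᵒᵖ (Type v) (Ind T)).obj X)
      ((ι Tᵒᵖ (Type v) (Ind T)).obj Y) ((ι Tᵒᵖ (Type v) (Ind T)).obj Z)
  symmetry X Y := by
    apply (ι Tᵒᵖ (Type v) (Ind T)).map_injective
    rw [Functor.map_comp, ι_indBraiding, ι_indBraiding, CategoryTheory.Functor.map_id]
    exact DayConvolution.symmetry _ _
end

end IndTensor

section FreeModule

variable {D : Type u} [Category.{v} D] [MonoidalCategory D]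

/-- The free module `A ⊗ Y` over an algebra `A`. -/
def freeMod (A : D) [MonObj A] (Y : D) : Mod D A where
  X := A ⊗ Y
  mod :=
    { smul := (α_ A A Y).inv ≫ MonObj.mul (X := A) ▷ Y
      one_smul := by
        change MonObj.one ▷ (A ⊗ Y) ≫ (α_ A A Y).inv ≫ MonObj.mul ▷ Y = (λ_ (A ⊗ Y)).hom
        rw [associator_inv_naturality_left_assoc, ← comp_whiskerRight, MonObj.one_mul]
        monoidal
      mul_smul := by
        change MonObj.mul ▷ (A ⊗ Y) ≫ (α_ A A Y).inv ≫ MonObj.mul ▷ Y =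
          (α_ A A (A ⊗ Y)).hom ≫ A ◁ ((α_ A A Y).inv ≫ MonObj.mul ▷ Y) ≫
            (α_ A A Y).inv ≫ MonObj.mul ▷ Y
        rw [associator_inv_naturality_left_assoc, ← comp_whiskerRight, MonObj.mul_assoc]
        monoidal }

end FreeModule

/-- A `k`-linear abelian symmetric monoidal category with `𝟙 ≠ 0`, whose tensor product is `k`-linear
and right exact in both variables. -/
class RightExactSymMonoidal (k : Type w) [Field k] (C : Type u) [Category.{v} C] [Abelian C]
    [Linear k C] [MonoidalCategory C] [SymmetricCategory C] : Prop
    extends MonoidalPreadditive C, MonoidalLinear k C where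
  unit_ne_zero : ¬ IsZero (𝟙_ C)
  rightExact_left : ∀ X : C, PreservesFiniteColimits (tensorLeft X)
  rightExact_right : ∀ X : C, PreservesFiniteColimits (tensorRight X)

/-- A tensor category over `k`: moreover essentially small (with respect to the universe of its
morphisms), with `k → End 𝟙` bijective, and with all objects dualisable. -/
class IsTensorCategory (k : Type w) [Field k] (T : Type u) [Category.{v} T] [Abelian T]
    [Linear k T] [MonoidalCategory T] [SymmetricCategory T] : Prop
    extends RightExactSymMonoidal k T, EssentiallySmall.{v} T where
  bijective_smul_id : Function.Bijective fun a : k => a • 𝟙 (𝟙_ T)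
  exists_dual : ∀ X : T, ∃ X' : T, Nonempty (ExactPairing X X')

section Conditions

attribute [local instance] Abelian.hasFiniteBiproducts

variable {T : Type u} [Category.{v} T] [Abelian T] [MonoidalCategory T] [SymmetricCategory T]

/-- The object `X` is locally free: `A ⊗ X ≅ A ⊗ 𝟙^m` as modules over `A`, for some nonzero
commutative algebra `A` in `Ind T` and some `m`. -/
def LocallyFree [EssentiallySmall.{v} T] (X : T) : Prop :=
  ∃ (A : Ind T) (_ : MonObj A) (_ : IsCommMonObj A) (m : ℕ), ¬ IsZero A ∧
    Nonempty (freeMod A (Ind.yoneda.obj X) ≅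
      freeMod A (Ind.yoneda.obj (⨁ fun _ : Fin m => 𝟙_ T)))

/-- Some tensor functor from `T` to a `k`-linear abelian symmetric monoidal category with right exact
tensor product (and objects and morphisms in the universes `u₂` and `v₂`) sends `X` to `𝟙^m`. A
tensor functor is a right exact `k`-linear symmetric monoidal functor. -/
def TrivializedByTensorFunctor (k : Type w) [Field k] [Linear k T] (X : T) : Prop :=
  ∃ (C : Type u₂) (_ : Category.{v₂} C) (_ : Abelian C) (_ : Linear k C)
    (_ : MonoidalCategory C) (_ : SymmetricCategory C) (_ : RightExactSymMonoidal k C)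
    (F : T ⥤ C) (_ : F.Braided) (_ : F.Additive) (_ : F.Linear k) (_ : PreservesFiniteColimits F)
    (m : ℕ), Nonempty (F.obj X ≅ ⨁ fun _ : Fin m => 𝟙_ C)

end Conditions

end

end TensorCat

open CategoryTheory MonoidalCategory Limits TensorCat

/-! A morphism `F.obj X ⟶ S` to a commutative algebra is treated as an `S`-valued functional on `X`.
Functionals multiply (`star`, `starProd`), and a coevaluation `c : 𝟙 ⟶ X' ⊗ X` pairs a functional on
`X'` with one on `X` to an element `contract c a b` of the commutative ring of sections of `S`. By
the Leibniz formula, pairing a product of the `a k` with the antisymmetrised product of the `b i`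
gives the Gram determinant of the two families (`contract_antisymmetrizer`). Since the divided power
of `X` is dual to the symmetric power of `X'`, the vanishing of an exterior power of a Frobenius
twist amounts to the vanishing of one canonical morphism out of `𝟙` (`isZero_extPow_frob_iff`);
evaluated on functionals, this morphism becomes the determinant of the `p ^ j`-th powers of the Gram
entries.

From the numerical condition 2 to local freeness: let `m` be maximal with nonzero `m`-th exterior
power of `X`. By (b) the `m`-th exterior powers of all Frobenius twists are nonzero. Take `m`
independent generic functionals on each of `X'` and `X`, with values in tensor powers of symmetric
algebras in `Ind T`. In characteristic `p` the `p ^ j`-th power of their Gram determinant is the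
determinant of the `p ^ j`-th powers, and its vanishing would kill an exterior power of a twist
(`isZero_extPow_frob_of_det`). So the determinant is not nilpotent, and inverting it gives a nonzero
algebra `B` (`exists_localization`). Over `B` the Gram matrix is invertible, which yields `m`
vectors and `m` functionals dual to each other; the vanishing of the next exterior power forces
these to be bases (`sum_dualFamilies`).

From local freeness to a trivialising functor: tensor with the algebra `A` and take values in
`A`-modules in `Ind T`. Most of the formal work shows that `Ind T` is abelian with right exact
tensor product, and that modules over `A` form a symmetric monoidal category of the required kind.

From a trivialising functor back to condition 2: the unit of `T` is simple (`epi_of_ne_zero`), so a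
tensor functor kills no nonzero morphism (`eq_zero_of_map_eq_zero`). Antisymmetrisers of degree
above `m` vanish on `𝟙 ^ m`. If the `n`-th exterior power of a twist vanishes with `n ≤ m`, the
determinant of an `n × n` identity matrix vanishes, which is absurd.

The equivalence of conditions 1 and 2 is formal, given that vanishing of exterior powers propagates
upwards (`isZero_extPow_mono`) and passes from `X` to its zeroth twist (`isZero_extPow_frob_zero`).
-/

namespace TensorCat

open CategoryTheory MonoidalCategory Limits Opposite

noncomputable section

set_option linter.unusedSectionVars false

/-! ### Ind-objects and their tensor product through generalised elements -/

section IndElements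

open scoped MonoidalCategory.ExternalProduct MonoidalCategory.DayConvolution
open LawfulDayConvolutionMonoidalCategoryStruct

variable {T : Type u} [Category.{v} T] [MonoidalCategory T] [EssentiallySmall.{v} T]

/-- The elements of an ind-object `A` over `P`, i.e. the morphisms from `P` to `A`. -/
abbrev El (A : Ind T) (P : T) : Type v := ((Ind.inclusion T).obj A).obj (op P)

/-- Restriction of elements. -/
abbrev El.res {A : Ind T} {P Q : T} (a : El A P) (f : Q ⟶ P) : El A Q :=
  ((Ind.inclusion T).obj A).map f.op a

/-- The image of an element under a morphism of ind-objects. -/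
abbrev El.push {A B : Ind T} {P : T} (a : El A P) (f : A ⟶ B) : El B P :=
  ((Ind.inclusion T).map f).app (op P) a

theorem El.push_id {A : Ind T} {P : T} (a : El A P) : a.push (𝟙 A) = a := by
  simp [El.push]

theorem El.push_comp {A B D : Ind T} {P : T} (a : El A P) (f : A ⟶ B) (g : B ⟶ D) :
    a.push (f ≫ g) = (a.push f).push g := by
  simp [El.push]

theorem El.res_id {A : Ind T} {P : T} (a : El A P) : a.res (𝟙 P) = a := by
  simp [El.res]

theorem El.res_comp {A : Ind T} {P Q R : T} (a : El A P) (f : Q ⟶ P) (g : R ⟶ Q) :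
    a.res (g ≫ f) = (a.res f).res g := by
  simp [El.res]

theorem El.push_res {A B : Ind T} {P Q : T} (a : El A P) (f : A ⟶ B) (g : Q ⟶ P) :
    (a.push f).res g = (a.res g).push f :=
  (((Ind.inclusion T).map f).naturality_apply g.op a).symm

theorem Ind.hom_ext_el {A B : Ind T} {f g : A ⟶ B} (h : ∀ (P : T) (a : El A P), a.push f = a.push g) :
    f = g := by
  apply (Ind.inclusion T).map_injective
  ext P a
  exact h P.unop a

/-- A natural family of maps on elements defines a morphism of ind-objects. -/
def Ind.homMk {A B : Ind T} (φ : ∀ P, El A P → El B P)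
    (h : ∀ (P Q : T) (f : Q ⟶ P) (a : El A P), φ Q (a.res f) = (φ P a).res f) : A ⟶ B :=
  Ind.inclusion.fullyFaithful.preimage
    { app := fun P => ↾(φ P.unop)
      naturality := fun P Q f => by ext a; exact h _ _ f.unop a }

theorem Ind.push_homMk {A B : Ind T} (φ : ∀ P, El A P → El B P)
    (h : ∀ (P Q : T) (f : Q ⟶ P) (a : El A P), φ Q (a.res f) = (φ P a).res f) {P : T} (a : El A P) :
    a.push (Ind.homMk φ h) = φ P a := by
  simp only [El.push, Ind.homMk, Functor.FullyFaithful.map_preimage]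
  rfl

/-- A pair, as an element of the tensor product of types. -/
abbrev tpair {X Y : Type v} (x : X) (y : Y) : (X ⊗ Y : Type v) := ((x, y) : X × Y)

theorem types_congr {X Y : Type v} {f g : X ⟶ Y} (h : f = g) (x : X) : f x = g x := by rw [h]

/-- The tensor product of elements. -/
def El.tensor {A B : Ind T} {P Q : T} (a : El A P) (b : El B Q) : El (A ⊗ B) (P ⊗ Q) :=
  (convolutionExtensionUnit Tᵒᵖ (Type v) A B).app (op P, op Q) (pr a b)

theorem El.tensor_res {A B : Ind T} {P P' Q Q' : T} (a : El A P) (b : El B Q) (f : P' ⟶ P)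
    (g : Q' ⟶ Q) : (a.tensor b).res (f ⊗ₘ g) = (a.res f).tensor (b.res g) :=
  ((convolutionExtensionUnit Tᵒᵖ (Type v) A B).naturality_apply (X := (op P, op Q))
    (Y := (op P', op Q')) (Prod.mkHom f.op g.op) (pr a b)).symm

theorem El.tensor_push {A A' B B' : Ind T} {P Q : T} (a : El A P) (b : El B Q) (f : A ⟶ A')
    (g : B ⟶ B') : (a.tensor b).push (f ⊗ₘ g) = (a.push f).tensor (b.push g) :=
  ConcreteCategory.congr_hom
    (convolutionExtensionUnit_comp_ι_map_tensorHom_app Tᵒᵖ (Type v) f g (op P) (op Q)) (pr a b)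

theorem El.tensor_push_left {A A' B : Ind T} {P Q : T} (a : El A P) (b : El B Q) (f : A ⟶ A') :
    (a.tensor b).push (f ▷ B) = (a.push f).tensor b := by
  rw [← tensorHom_id, El.tensor_push, El.push_id]

theorem El.tensor_push_right {A B B' : Ind T} {P Q : T} (a : El A P) (b : El B Q) (f : B ⟶ B') :
    (a.tensor b).push (A ◁ f) = a.tensor (b.push f) := by
  rw [← id_tensorHom, El.tensor_push, El.push_id]

/-- The associator of `Ind T` is induced from that of Day convolution, so its effect on pure tensors
is prescribed. Together with the analogues for the unitors and the braiding, this reduces identities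
between coherence isomorphisms to computations with elements. -/
theorem El.tensor_assoc {A B D : Ind T} {P Q R : T} (a : El A P) (b : El B Q) (d : El D R) :
    ((a.tensor b).tensor d).push (α_ A B D).hom = (a.tensor (b.tensor d)).res (α_ P Q R).hom :=
  types_congr
    (associator_hom_unit_unit (Type v) A B D (op P) (op Q) (op R))
    ((((a, b) : El A P × El B Q), d) : (El A P × El B Q) × El D R)

/-- The canonical element of the unit. -/
def unitEl : El (𝟙_ (Ind T)) (𝟙_ T) := unitUnit Tᵒᵖ (Type v) (Ind T) PUnit.unit

theorem El.unit_tensor {A : Ind T} {P : T} (a : El A P) :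
    (unitEl.tensor a).push (λ_ A).hom = a.res (λ_ P).hom :=
  types_congr (leftUnitor_hom_unit_app (Type v) A (op P)) ((PUnit.unit, a) : PUnit × El A P)

theorem El.tensor_unit {A : Ind T} {P : T} (a : El A P) :
    (a.tensor unitEl).push (ρ_ A).hom = a.res (ρ_ P).hom :=
  types_congr (rightUnitor_hom_unit_app (Type v) A (op P)) ((a, PUnit.unit) : El A P × PUnit)

attribute [local instance] LawfulDayConvolutionMonoidalCategoryStruct.convolution

theorem El.tensor_braiding [SymmetricCategory T] {A B : Ind T} {P Q : T} (a : El A P) (b : El B Q) :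
    (a.tensor b).push (β_ A B).hom = (b.tensor a).res (β_ P Q).hom := by
  have h := ι_indBraiding A B
  have h2 := DayConvolution.unit_app_braiding_hom_app ((ι Tᵒᵖ (Type v) (Ind T)).obj A) ((ι Tᵒᵖ (Type v) (Ind T)).obj B) (op P) (op Q)
  rw [← h] at h2
  exact ConcreteCategory.congr_hom h2 (pr a b)

/-- Day convolution is a left Kan extension along the tensor product, so a map out of it is the same
as a natural family of maps on pairs of elements. -/
theorem Ind.tensor_hom_ext {A B W : Ind T} {f g : A ⊗ B ⟶ W}
    (h : ∀ (P Q : T) (a : El A P) (b : El B Q), (a.tensor b).push f = (a.tensor b).push g) :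
    f = g := by
  apply (Ind.inclusion T).map_injective
  apply (DayConvolution.corepresentableBy ((ι Tᵒᵖ (Type v) (Ind T)).obj A)
    ((ι Tᵒᵖ (Type v) (Ind T)).obj B)).homEquiv.injective
  refine NatTrans.ext (funext fun PQ => ?_)
  ext ⟨a, b⟩
  exact h PQ.1.unop PQ.2.unop a b

/-- A natural family of maps on pairs of elements defines a morphism out of the tensor product. -/
def Ind.tensorDesc {A B W : Ind T} (φ : ∀ P Q, El A P → El B Q → El W (P ⊗ Q))
    (h : ∀ (P P' Q Q' : T) (f : P' ⟶ P) (g : Q' ⟶ Q) (a : El A P) (b : El B Q),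
      φ P' Q' (a.res f) (b.res g) = (φ P Q a b).res (f ⊗ₘ g)) : A ⊗ B ⟶ W :=
  Ind.inclusion.fullyFaithful.preimage
    ((DayConvolution.corepresentableBy ((ι Tᵒᵖ (Type v) (Ind T)).obj A)
    ((ι Tᵒᵖ (Type v) (Ind T)).obj B)).homEquiv.symm
    { app := fun P => ↾(fun x => φ P.1.unop P.2.unop x.1 x.2)
      naturality := by
        rintro ⟨P, Q⟩ ⟨P', Q'⟩ ⟨f, g⟩
        ext ⟨a, b⟩
        exact h _ _ _ _ f.unop g.unop a b })

theorem Ind.push_tensorDesc {A B W : Ind T} (φ : ∀ P Q, El A P → El B Q → El W (P ⊗ Q))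
    (h : ∀ (P P' Q Q' : T) (f : P' ⟶ P) (g : Q' ⟶ Q) (a : El A P) (b : El B Q),
      φ P' Q' (a.res f) (b.res g) = (φ P Q a b).res (f ⊗ₘ g)) {P Q : T} (a : El A P) (b : El B Q) :
    (a.tensor b).push (Ind.tensorDesc φ h) = φ P Q a b := by
  simp only [El.push, Ind.tensorDesc, Functor.FullyFaithful.map_preimage]
  let t : (ι Tᵒᵖ (Type v) (Ind T)).obj A ⊠ (ι Tᵒᵖ (Type v) (Ind T)).obj B ⟶
      tensor Tᵒᵖ ⋙ (Ind.inclusion T).obj W :=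
    { app := fun P => ↾(fun x => φ P.1.unop P.2.unop x.1 x.2)
      naturality := by
        rintro ⟨P, Q⟩ ⟨P', Q'⟩ ⟨f, g⟩
        ext ⟨a, b⟩
        exact h _ _ _ _ f.unop g.unop a b }
  have := Equiv.apply_symm_apply ((DayConvolution.corepresentableBy
    ((ι Tᵒᵖ (Type v) (Ind T)).obj A) ((ι Tᵒᵖ (Type v) (Ind T)).obj B)).homEquiv) t
  have h2 : ∀ t' : (ι Tᵒᵖ (Type v) (Ind T)).obj A ⊠ (ι Tᵒᵖ (Type v) (Ind T)).obj B ⟶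
      tensor Tᵒᵖ ⋙ (Ind.inclusion T).obj W, t' = t → t'.app (op P, op Q) (tpair a b) = φ P Q a b := by
    rintro _ rfl
    rfl
  exact h2 _ this

end IndElements

/-! ### The symmetric monoidal embedding of `T` in `Ind T` -/

section IndYoneda

variable {T : Type u} [Category.{v} T]

/-- The element of a representable ind-object given by a morphism. -/
def yel {P Q : T} (f : Q ⟶ P) : ((Ind.inclusion T).obj (Ind.yoneda.obj P)).obj (op Q) :=
  (Ind.yonedaCompInclusion.inv.app P).app (op Q) f

/-- The morphism given by an element of a representable ind-object. -/
def unyel {P Q : T} (a : ((Ind.inclusion T).obj (Ind.yoneda.obj P)).obj (op Q)) : Q ⟶ P :=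
  (Ind.yonedaCompInclusion.hom.app P).app (op Q) a

theorem unyel_yel {P Q : T} (f : Q ⟶ P) : unyel (yel f) = f := by
  have h := congrArg (fun t => t.app (op Q)) (Ind.yonedaCompInclusion.inv_hom_id_app P)
  exact types_congr h f

theorem yel_unyel {P Q : T} (a : ((Ind.inclusion T).obj (Ind.yoneda.obj P)).obj (op Q)) :
    yel (unyel a) = a := by
  have h := congrArg (fun t => t.app (op Q)) (Ind.yonedaCompInclusion.hom_inv_id_app P)
  exact types_congr h a

theorem yel_push {P P' Q : T} (f : Q ⟶ P) (h : P ⟶ P') :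
    ((Ind.inclusion T).map (Ind.yoneda.map h)).app (op Q) (yel f) = yel (f ≫ h) := by
  have := congrArg (fun t => t.app (op Q)) (Ind.yonedaCompInclusion.inv.naturality h)
  exact (types_congr this f).symm

variable [MonoidalCategory T] [EssentiallySmall.{v} T]

theorem yel_res {P Q R : T} (f : Q ⟶ P) (g : R ⟶ Q) :
    El.res (A := Ind.yoneda.obj P) (yel f) g = yel (g ≫ f) := by
  have := (Ind.yonedaCompInclusion.inv.app P).naturality_apply g.op f
  exact this.symm

/-- The morphism from a representable ind-object given by an element. -/
def El.toHom {A : Ind T} {P : T} (a : El A P) : Ind.yoneda.obj P ⟶ A :=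
  Ind.homMk (fun _ b => a.res (unyel b)) (by
    intro P Q f b
    obtain ⟨b, rfl⟩ : ∃ c, yel c = b := ⟨_, yel_unyel b⟩
    rw [yel_res, unyel_yel, unyel_yel, El.res_comp])

theorem El.push_toHom {A : Ind T} {P Q : T} (a : El A P) (f : Q ⟶ P) :
    El.push (A := Ind.yoneda.obj P) (yel f) a.toHom = a.res f := by
  rw [El.toHom, Ind.push_homMk, unyel_yel]

theorem El.push_toHom_id {A : Ind T} {P : T} (a : El A P) :
    El.push (A := Ind.yoneda.obj P) (yel (𝟙 P)) a.toHom = a := by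
  rw [El.push_toHom, El.res_id]

theorem Ind.hom_ext_yel {A B : Ind T} {P : T} (e : A = Ind.yoneda.obj P) {f g : A ⟶ B}
    (h : El.push (B := B) (yel (𝟙 P)) (eqToHom e.symm ≫ f) =
      El.push (B := B) (yel (𝟙 P)) (eqToHom e.symm ≫ g)) : f = g := by
  subst e
  refine Ind.hom_ext_el fun Q a => ?_
  obtain ⟨b, rfl⟩ : ∃ c, yel c = a := ⟨_, yel_unyel a⟩
  have := congrArg (fun t : El B P => t.res b) h
  simp only [eqToHom_refl, Category.id_comp, El.push_res, yel_res, Category.comp_id] at this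
  exact this

theorem Ind.yoneda_hom_ext {B : Ind T} {P : T} {f g : Ind.yoneda.obj P ⟶ B}
    (h : El.push (B := B) (yel (𝟙 P)) f = El.push (B := B) (yel (𝟙 P)) g) : f = g :=
  Ind.hom_ext_yel rfl (by simpa using h)

/-- Definitional, because the unit of `Ind T` was chosen to be the image of the unit of `T`. This is
also why the unit comparison in `yonedaCoreMonoidal` can be the identity. -/
theorem unitEl_eq : (unitEl : El (𝟙_ (Ind T)) (𝟙_ T)) = yel (𝟙 (𝟙_ T)) := rfl

/-- The comparison of tensor products for the functor `T ⥤ Ind T`. -/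
def yμ (P Q : T) : Ind.yoneda.obj P ⊗ Ind.yoneda.obj Q ≅ Ind.yoneda.obj (P ⊗ Q) where
  hom := Ind.tensorDesc (fun _ _ a b => yel (unyel a ⊗ₘ unyel b)) (by
    intro R R' S S' f g a b
    obtain ⟨a, rfl⟩ : ∃ c, yel c = a := ⟨_, yel_unyel a⟩
    obtain ⟨b, rfl⟩ : ∃ c, yel c = b := ⟨_, yel_unyel b⟩
    simp [yel_res, unyel_yel])
  inv := El.toHom (El.tensor (yel (𝟙 P)) (yel (𝟙 Q)))
  hom_inv_id := by
    apply Ind.tensor_hom_ext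
    intro R S a b
    obtain ⟨a, rfl⟩ : ∃ c, yel c = a := ⟨_, yel_unyel a⟩
    obtain ⟨b, rfl⟩ : ∃ c, yel c = b := ⟨_, yel_unyel b⟩
    rw [El.push_comp, Ind.push_tensorDesc, unyel_yel, unyel_yel, El.push_toHom, El.tensor_res,
      yel_res, yel_res, El.push_id, Category.comp_id, Category.comp_id]
  inv_hom_id := by
    apply Ind.yoneda_hom_ext
    rw [El.push_comp, El.push_toHom_id, Ind.push_tensorDesc, unyel_yel, unyel_yel, El.push_id,
      id_tensorHom_id]

theorem push_yμ {P Q R S : T} (f : R ⟶ P) (g : S ⟶ Q) :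
    (El.tensor (A := Ind.yoneda.obj P) (B := Ind.yoneda.obj Q) (yel f) (yel g)).push (yμ P Q).hom =
      yel (f ⊗ₘ g) := by
  rw [yμ, Ind.push_tensorDesc, unyel_yel, unyel_yel]

theorem push_yμ_inv {P Q R : T} (f : R ⟶ P ⊗ Q) :
    El.push (A := Ind.yoneda.obj (P ⊗ Q)) (yel f) (yμ P Q).inv =
      (El.tensor (A := Ind.yoneda.obj P) (B := Ind.yoneda.obj Q) (yel (𝟙 P)) (yel (𝟙 Q))).res f :=
  El.push_toHom _ _

theorem yel_push' {P P' Q : T} (f : Q ⟶ P) (h : P ⟶ P') :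
    El.push (A := Ind.yoneda.obj P) (yel f) (Ind.yoneda.map h) = yel (f ≫ h) := yel_push f h

theorem Ind.yoneda_tensor_hom_ext {P Q : T} {W : Ind T} {f g : Ind.yoneda.obj P ⊗ Ind.yoneda.obj Q ⟶ W}
    (h : (El.tensor (A := Ind.yoneda.obj P) (B := Ind.yoneda.obj Q) (yel (𝟙 P)) (yel (𝟙 Q))).push f =
      (El.tensor (A := Ind.yoneda.obj P) (B := Ind.yoneda.obj Q) (yel (𝟙 P)) (yel (𝟙 Q))).push g) :
    f = g := by
  apply Ind.tensor_hom_ext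
  intro R S a b
  obtain ⟨a, rfl⟩ : ∃ c, yel c = a := ⟨_, yel_unyel a⟩
  obtain ⟨b, rfl⟩ : ∃ c, yel c = b := ⟨_, yel_unyel b⟩
  have := congrArg (fun t : El W (P ⊗ Q) => t.res (a ⊗ₘ b)) h
  simpa only [El.push_res, El.tensor_res, yel_res, Category.comp_id] using this

/-- The functor `T ⥤ Ind T` is monoidal. -/
def yonedaCoreMonoidal : (Ind.yoneda (C := T)).CoreMonoidal where
  εIso := Iso.refl _
  μIso := yμ
  μIso_hom_natural_left f Q := by
    apply Ind.yoneda_tensor_hom_ext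
    rw [El.push_comp, El.push_comp, El.tensor_push_left, yel_push', push_yμ, push_yμ, yel_push']
    simp
  μIso_hom_natural_right P f := by
    apply Ind.yoneda_tensor_hom_ext
    rw [El.push_comp, El.push_comp, El.tensor_push_right, yel_push', push_yμ, push_yμ, yel_push']
    simp
  associativity P Q R := by
    -- This replaces the first two factors by a single representable, so that the test on a tensor
    -- product of two representables applies.
    rw [← cancel_epi ((yμ P Q).inv ▷ _)]
    apply Ind.yoneda_tensor_hom_ext
    simp only [El.push_comp, El.tensor_push_left, push_yμ_inv, El.res_id]
    rw [El.tensor_assoc, push_yμ, push_yμ]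
    simp only [← El.push_res, El.tensor_push_right]
    rw [push_yμ, push_yμ, yel_push', yel_res]
    simp
  left_unitality P := by
    apply Ind.tensor_hom_ext
    intro R S a b
    obtain ⟨a, rfl⟩ : ∃ c : R ⟶ 𝟙_ T, (yel c : El (𝟙_ (Ind T)) R) = a := ⟨_, yel_unyel a⟩
    obtain ⟨b, rfl⟩ : ∃ c, yel c = b := ⟨_, yel_unyel b⟩
    have h := El.unit_tensor (A := Ind.yoneda.obj P) (yel b)
    -- Every element of the unit is the restriction of the canonical one along some `a : R ⟶ 𝟙_ T`,
    -- so the formula for `unitEl` is restricted along `a`.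
    have h2 := congrArg (fun t : El (Ind.yoneda.obj P) (𝟙_ T ⊗ S) => t.res (a ▷ S)) h
    simp only [El.push_res, unitEl_eq, ← tensorHom_id, El.tensor_res] at h2
    have h0 : El.res (A := 𝟙_ (Ind T)) (yel (𝟙 (𝟙_ T))) a = yel a := by
      refine (yel_res _ _).trans ?_
      rw [Category.comp_id]
    rw [h0, yel_res, Category.id_comp, yel_res] at h2
    rw [h2]
    simp only [Iso.refl_hom, id_whiskerRight, El.push_comp, El.push_id]
    refine Eq.trans ?_ (congrArg (fun t => El.push t (Ind.yoneda.map (λ_ P).hom)) (push_yμ a b)).symm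
    rw [yel_push']
    rw [yel_res]
    simp [MonoidalCategory.tensorHom_def]
  right_unitality P := by
    apply Ind.tensor_hom_ext
    intro S R b a
    obtain ⟨a, rfl⟩ : ∃ c : R ⟶ 𝟙_ T, (yel c : El (𝟙_ (Ind T)) R) = a := ⟨_, yel_unyel a⟩
    obtain ⟨b, rfl⟩ : ∃ c, yel c = b := ⟨_, yel_unyel b⟩
    have h := El.tensor_unit (A := Ind.yoneda.obj P) (yel b)
    have h2 := congrArg (fun t : El (Ind.yoneda.obj P) (S ⊗ 𝟙_ T) => t.res (S ◁ a)) h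
    simp only [El.push_res, unitEl_eq, ← id_tensorHom, El.tensor_res] at h2
    have h0 : El.res (A := 𝟙_ (Ind T)) (yel (𝟙 (𝟙_ T))) a = yel a := by
      refine (yel_res _ _).trans ?_
      rw [Category.comp_id]
    rw [h0, yel_res, Category.id_comp, yel_res] at h2
    rw [h2]
    simp only [Iso.refl_hom, MonoidalCategory.whiskerLeft_id, El.push_comp, El.push_id]
    refine Eq.trans ?_ (congrArg (fun t => El.push t (Ind.yoneda.map (ρ_ P).hom)) (push_yμ b a)).symm
    rw [yel_push']
    rw [yel_res]
    simp [MonoidalCategory.tensorHom_def']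

instance yonedaMonoidal : (Ind.yoneda (C := T)).Monoidal := yonedaCoreMonoidal.toMonoidal

theorem yoneda_μ (P Q : T) : Functor.LaxMonoidal.μ (Ind.yoneda (C := T)) P Q = (yμ P Q).hom := rfl

instance yonedaBraided [SymmetricCategory T] : (Ind.yoneda (C := T)).Braided where
  braided P Q := by
    rw [yoneda_μ, yoneda_μ]
    apply Ind.yoneda_tensor_hom_ext
    rw [El.push_comp, El.push_comp, El.tensor_braiding, push_yμ, yel_push', ← El.push_res, push_yμ,
      yel_res]
    simp

end IndYoneda

/-! ### Ind-objects as left exact presheaves -/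

section IndLimits

variable {T : Type u} [Category.{v} T] [EssentiallySmall.{v} T]

instance locallySmall_presheaf : LocallySmall.{v} (Tᵒᵖ ⥤ Type v) :=
  (locallySmall_congr (equivSmallModel.{v} T).op.congrLeft).2 inferInstance

/-- The category of elements of a left exact presheaf is filtered, and the size condition is
automatic because `T` is essentially small. -/
theorem isIndObject_of_preservesFiniteLimits [HasFiniteColimits T] (A : Tᵒᵖ ⥤ Type v)
    [PreservesFiniteLimits A] : IsIndObject A :=
  (isIndObject_iff A).2 ⟨isFiltered_costructuredArrow_yoneda_of_preservesFiniteLimits A,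
    finallySmall_of_essentiallySmall _⟩

/-- Representables are left exact, and filtered colimits of sets commute with finite limits. -/
theorem preservesFiniteLimits_of_isIndObject {T : Type u} [Category.{v} T] {A : Tᵒᵖ ⥤ Type v}
    (hA : IsIndObject A) : PreservesFiniteLimits A := by
  let P := hA.presentation
  let e : (P.F ⋙ yoneda).flip ⋙ colim ≅ A := (colimitIsoFlipCompColim (P.F ⋙ yoneda)).symm ≪≫
    (colimit.isColimit _).coconePointUniqueUpToIso P.coconeIsColimit
  have : PreservesFiniteLimits (P.F ⋙ yoneda).flip := ⟨fun J _ _ =>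
    preservesLimitsOfShape_of_evaluation _ _ fun i => by
      have : PreservesLimitsOfShape J (yoneda.obj (P.F.obj i)) := inferInstance
      exact this⟩
  have : PreservesFiniteLimits ((P.F ⋙ yoneda).flip ⋙ colim) := comp_preservesFiniteLimits _ _
  exact preservesFiniteLimits_of_natIso e

instance (A : Ind T) : PreservesFiniteLimits ((Ind.inclusion T).obj A) :=
  preservesFiniteLimits_of_isIndObject A.isIndObject_inclusion_obj

end IndLimits

/-! ### Internal homs of ind-objects -/

section IndClosed

variable {T : Type u} [Category.{v} T] [MonoidalCategory T] [EssentiallySmall.{v} T]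

/-- The presheaf of morphisms from `A ⊗ -` to `W`. -/
abbrev ihomPresheaf (A W : Ind T) : Tᵒᵖ ⥤ Type v :=
  (Ind.yoneda ⋙ tensorLeft A).op ⋙ yoneda.obj W

/-- The presheaf `P ↦ W (P ⊗ Q)`, as a functor of `Q`. -/
abbrev shiftPresheaf (W : Ind T) : Tᵒᵖ ⥤ Tᵒᵖ ⥤ Type v where
  obj Q := (tensorRight Q.unop).op ⋙ (Ind.inclusion T).obj W
  map g :=
    { app := fun P => ((Ind.inclusion T).obj W).map (P.unop ◁ g.unop).op
      naturality := fun P P' f => by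
        simp only [Functor.comp_map, Functor.op_map, ← Functor.map_comp, ← op_comp]
        simp [whisker_exchange] }
  map_id Q := by
    ext P : 2
    change ((Ind.inclusion T).obj W).map (P.unop ◁ 𝟙 _).op = 𝟙 _
    simp
  map_comp f g := by
    ext P : 2
    change ((Ind.inclusion T).obj W).map (P.unop ◁ (g.unop ≫ f.unop)).op =
      ((Ind.inclusion T).obj W).map (P.unop ◁ f.unop).op ≫
        ((Ind.inclusion T).obj W).map (P.unop ◁ g.unop).op
    simp [← Functor.map_comp]

/-- By Yoneda in the second variable, a map out of `A ⊗ Q` is determined by its values on pairs of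
an element of `A` and the identity of `Q`; all other values are restrictions of these. -/
def ihomEquiv (A W : Ind T) (Q : T) : (A ⊗ Ind.yoneda.obj Q ⟶ W) ≃
    ((Ind.inclusion T).obj A ⟶ (shiftPresheaf W).obj (op Q)) where
  toFun f :=
    { app := fun P => ↾(fun a : El A P.unop => (a.tensor (B := Ind.yoneda.obj Q) (yel (𝟙 Q))).push f)
      naturality := by
        intro P P' g
        ext a
        change El.push (El.tensor (El.res (A := A) a g.unop) (yel (𝟙 Q))) f =
          El.res (El.push (El.tensor (A := A) a (yel (𝟙 Q))) f) (g.unop ▷ Q)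
        rw [El.push_res, ← tensorHom_id, El.tensor_res, yel_res, Category.comp_id] }
  invFun φ := Ind.tensorDesc (fun R S a b => El.res (A := W) (P := R ⊗ Q) (φ.app (op R) a) (R ◁ unyel b)) (by
    intro R R' S S' f g a b
    obtain ⟨b, rfl⟩ : ∃ c, yel c = b := ⟨_, yel_unyel b⟩
    have h : φ.app (op R') (a.res f) = El.res (A := W) (P := R ⊗ Q) (φ.app (op R) a) (f ▷ Q) :=
      φ.naturality_apply f.op a
    rw [h, yel_res, unyel_yel, unyel_yel, ← El.res_comp, ← El.res_comp]
    congr 1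
    simp [MonoidalCategory.tensorHom_def, whisker_exchange_assoc, whisker_exchange])
  left_inv f := by
    apply Ind.tensor_hom_ext
    intro R S a b
    obtain ⟨b, rfl⟩ : ∃ c, yel c = b := ⟨_, yel_unyel b⟩
    rw [Ind.push_tensorDesc, unyel_yel]
    change El.res (El.push (El.tensor (A := A) a (yel (𝟙 Q))) f) _ = _
    rw [El.push_res, ← id_tensorHom, El.tensor_res, yel_res, Category.comp_id, El.res_id]
  right_inv φ := by
    ext P a
    refine (Ind.push_tensorDesc _ _ _ _).trans ?_
    rw [unyel_yel, MonoidalCategory.whiskerLeft_id, El.res_id]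
    rfl

/-- The lift is needed because natural transformations between presheaves on `T` form a type in the
universe `max u v`, whereas morphisms of `Ind T` lie in `v`. -/
def ihomIso (A W : Ind T) : ihomPresheaf A W ⋙ uliftFunctor.{u} ≅
    shiftPresheaf W ⋙ coyoneda.obj (op ((Ind.inclusion T).obj A)) :=
  NatIso.ofComponents (fun Q => (Equiv.ulift.trans (ihomEquiv A W Q.unop)).toIso) (by
    intro Q Q' g
    ext ⟨f⟩
    refine NatTrans.ext (funext fun P => ?_)
    ext a
    change (El.tensor (A := A) a (yel (𝟙 Q'.unop))).push (A ◁ Ind.yoneda.map g.unop ≫ f) =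
      El.res ((El.tensor (A := A) a (yel (𝟙 Q.unop))).push f) (P.unop ◁ g.unop)
    rw [El.push_comp, El.tensor_push_right, yel_push', El.push_res, ← id_tensorHom, El.tensor_res,
      yel_res, El.res_id, Category.comp_id, Category.id_comp])

variable [HasFiniteColimits T] [∀ X : T, PreservesFiniteColimits (tensorLeft X)]

/-- Limits are computed pointwise: tensoring with `P` is right exact on `T`, and `W` turns finite
colimits into limits. -/
instance (W : Ind T) : PreservesFiniteLimits (shiftPresheaf W) := ⟨fun J _ _ =>
    preservesLimitsOfShape_of_evaluation _ _ fun P => by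
      have : PreservesFiniteLimits (tensorLeft P.unop).op := preservesFiniteLimits_op _
      have : PreservesFiniteLimits ((tensorLeft P.unop).op ⋙ (Ind.inclusion T).obj W) :=
        comp_preservesFiniteLimits _ _
      have : PreservesLimitsOfShape J ((tensorLeft P.unop).op ⋙ (Ind.inclusion T).obj W) := inferInstance
      exact this⟩

instance (A W : Ind T) : PreservesFiniteLimits (ihomPresheaf A W) := by
  have : PreservesFiniteLimits (shiftPresheaf W ⋙ coyoneda.obj (op ((Ind.inclusion T).obj A))) :=
    comp_preservesFiniteLimits _ _
  have : PreservesFiniteLimits (ihomPresheaf A W ⋙ uliftFunctor.{u}) :=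
    preservesFiniteLimits_of_natIso (ihomIso A W).symm
  exact ⟨fun J _ _ => preservesLimitsOfShape_of_reflects_of_preserves _ uliftFunctor.{u}⟩

/-- The internal hom of ind-objects. -/
def indIhom (A W : Ind T) : Ind T :=
  (Ind.equivalence T).inverse.obj ⟨ihomPresheaf A W, isIndObject_of_preservesFiniteLimits _⟩

def indIhomIso (A W : Ind T) : (Ind.inclusion T).obj (indIhom A W) ≅ ihomPresheaf A W :=
  (ObjectProperty.ι _).mapIso ((Ind.equivalence T).counitIso.app _)

/-- The elements of the internal hom. -/
def indIhomEl (A W : Ind T) (Q : T) : El (indIhom A W) Q ≃ (A ⊗ Ind.yoneda.obj Q ⟶ W) :=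
  ((indIhomIso A W).app (op Q)).toEquiv

theorem indIhomEl_res (A W : Ind T) {Q Q' : T} (x : El (indIhom A W) Q) (f : Q' ⟶ Q) :
    indIhomEl A W Q' (x.res f) = A ◁ Ind.yoneda.map f ≫ indIhomEl A W Q x :=
  (indIhomIso A W).hom.naturality_apply f.op x

theorem El.toHom_res {A : Ind T} {P Q : T} (a : El A P) (f : Q ⟶ P) :
    (a.res f).toHom = Ind.yoneda.map f ≫ a.toHom := by
  apply Ind.yoneda_hom_ext
  rw [El.push_comp, El.push_toHom, yel_push', El.push_toHom, Category.id_comp, El.res_id]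

/-- Morphisms to the internal hom. -/
def indIhomHomEquiv (A B W : Ind T) : (B ⟶ indIhom A W) ≃ (A ⊗ B ⟶ W) where
  toFun h := Ind.tensorDesc (fun P Q a b => (a.tensor (yel (𝟙 Q))).push (indIhomEl A W Q (b.push h))) (by
    intro P P' Q Q' f g a b
    rw [← El.push_res, indIhomEl_res, El.push_comp, El.tensor_push_right, yel_push', El.push_res,
      El.tensor_res, yel_res, Category.comp_id, Category.id_comp])
  invFun g := Ind.homMk (fun Q b => (indIhomEl A W Q).symm (A ◁ b.toHom ≫ g)) (by
    intro Q Q' f b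
    rw [Equiv.symm_apply_eq, indIhomEl_res, Equiv.apply_symm_apply, El.toHom_res,
      MonoidalCategory.whiskerLeft_comp, Category.assoc])
  left_inv h := by
    apply Ind.hom_ext_el
    intro Q b
    rw [Ind.push_homMk, Equiv.symm_apply_eq]
    apply Ind.tensor_hom_ext
    intro R S a c
    obtain ⟨c, rfl⟩ : ∃ d, yel d = c := ⟨_, yel_unyel c⟩
    rw [El.push_comp, El.tensor_push_right, Ind.push_tensorDesc, El.push_toHom, ← El.push_res,
      indIhomEl_res, El.push_comp, El.tensor_push_right, yel_push', Category.id_comp]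
  right_inv g := by
    apply Ind.tensor_hom_ext
    intro P Q a b
    rw [Ind.push_tensorDesc, Ind.push_homMk, Equiv.apply_symm_apply, El.push_comp,
      El.tensor_push_right, El.push_toHom, El.res_id]

theorem indIhomHomEquiv_naturality (A : Ind T) {B B' W : Ind T} (f : B' ⟶ B) (h : B ⟶ indIhom A W) :
    indIhomHomEquiv A B' W (f ≫ h) = A ◁ f ≫ indIhomHomEquiv A B W h := by
  apply Ind.tensor_hom_ext
  intro P Q a b
  simp only [indIhomHomEquiv, Equiv.coe_fn_mk]
  rw [El.push_comp, El.tensor_push_right, Ind.push_tensorDesc, Ind.push_tensorDesc, El.push_comp]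

/-- The presheaf of maps from `A ⊗ -` to `W` is left exact, hence an ind-object, and represents the
right adjoint at `W`. Consequently the tensor product of `Ind T` preserves all colimits in each
variable. -/
instance (A : Ind T) : (tensorLeft A).IsLeftAdjoint := by
  apply Functor.isLeftAdjoint_of_rightAdjointObjIsDefined_eq_top
  ext W
  simp only [Pi.top_apply, Prop.top_eq_true, iff_true, Functor.rightAdjointObjIsDefined_iff]
  refine ⟨⟨indIhom A W, ⟨{ homEquiv := fun {B} => indIhomHomEquiv A B W, homEquiv_comp := ?_ }⟩⟩⟩
  intro B B' f g
  exact indIhomHomEquiv_naturality A f g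

end IndClosed

/-! ### `Ind T` is abelian -/

section IndAbelian

variable {T : Type u} [Category.{v} T] [EssentiallySmall.{v} T] [Abelian T]

attribute [local instance] HasFiniteBiproducts.of_hasFiniteCoproducts Abelian.hasFiniteBiproducts

/-- Ind-objects as left exact functors. -/
def indToLeftExact : Ind T ⥤ (Tᵒᵖ ⥤ₗ Type v) :=
  ObjectProperty.lift _ (Ind.inclusion T) fun A => by
    simp only [leftExactFunctor_iff]; infer_instance

instance : (indToLeftExact (T := T)).Full := by unfold indToLeftExact; infer_instance
instance : (indToLeftExact (T := T)).Faithful := by unfold indToLeftExact; infer_instance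

/-- A left exact presheaf of sets on an additive category takes values in abelian groups
canonically, so `Ind T` embeds fully faithfully in a category of additive presheaves. -/
instance indPreadditive : Preadditive (Ind T) :=
  .ofFullyFaithful (((Functor.FullyFaithful.ofFullyFaithful (indToLeftExact (T := T))).comp
    (AddCommGrpCat.leftExactFunctorForgetEquivalence Tᵒᵖ).symm.fullyFaithfulFunctor).comp
      (ObjectProperty.fullyFaithfulι _))

/-- Every morphism of ind-objects is a filtered colimit of morphisms of `T`. Forming this colimit
preserves the comparison from coimage to image, which is invertible in the abelian category `T`. -/
instance indCoimage {X Y : Ind T} (f : X ⟶ Y) : IsIso (Abelian.coimageImageComparison f) := by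
  obtain ⟨I, _, _, F, G, ϕ, ⟨i⟩⟩ := Ind.exists_nonempty_arrow_mk_iso_ind_lim (f := f)
  let i' : Arrow.mk (Abelian.coimageImageComparison f) ≅
      Arrow.mk (Abelian.coimageImageComparison ((Ind.lim I).map ϕ)) :=
    Abelian.coimageImageComparisonFunctor.mapIso i
  have := Iso.isIso_hom i'
  rw [Arrow.isIso_iff_isIso_of_isIso i'.hom,
    Arrow.isIso_iff_isIso_of_isIso (Abelian.PreservesCoimageImageComparison.iso (Ind.lim I) ϕ).inv]
  infer_instance

instance indAbelian : Abelian (Ind T) :=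
  haveI : HasFiniteBiproducts (Ind T) := HasFiniteBiproducts.of_hasFiniteCoproducts
  .ofCoimageImageComparisonIsIso

instance : (Ind.yoneda (C := T)).Additive :=
  Functor.additive_of_preserves_binary_products _

end IndAbelian

/-! ### Compactness of the objects of `T` in `Ind T` -/

section IndCompact

variable {T : Type u} [Category.{v} T] [MonoidalCategory T] [EssentiallySmall.{v} T]

instance : PreservesColimitsOfShape ℕ (Ind.inclusion T) :=
  preservesColimitsOfShape_of_equiv (AsSmall.equiv.{0, 0, v} (C := ℕ)).symm _

/-- Morphisms from an object of `T` to a sequential colimit. -/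
theorem Ind.eq_of_comp_colimit_eq {P : T} {F : ℕ ⥤ Ind T} {c : Cocone F} (hc : IsColimit c) {n : ℕ}
    {f g : Ind.yoneda.obj P ⟶ F.obj n} (h : f ≫ c.ι.app n = g ≫ c.ι.app n) :
    ∃ (m : ℕ) (i : n ⟶ m), f ≫ F.map i = g ≫ F.map i := by
  have hc' := isColimitOfPreserves (Ind.inclusion T ⋙ (evaluation _ _).obj (op P)) hc
  have h' : El.push (El.push (yel (𝟙 P)) f) (c.ι.app n) = El.push (El.push (yel (𝟙 P)) g) (c.ι.app n) := by
    rw [← El.push_comp, ← El.push_comp, h]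
  obtain ⟨m, i, hi⟩ := (Types.FilteredColimit.isColimit_eq_iff' hc'
    (x := El.push (yel (𝟙 P)) f) (y := El.push (yel (𝟙 P)) g)).1 h'
  refine ⟨m, i, Ind.yoneda_hom_ext ?_⟩
  rw [El.push_comp, El.push_comp]
  exact hi

end IndCompact

/-! ### Additivity of right exact functors and of the tensor product -/

section RightExactAdditive

variable {C : Type u} [Category.{v} C] [Abelian C] {D : Type u₂} [Category.{v₂} D] [Abelian D]

attribute [local instance] Abelian.hasFiniteBiproducts

theorem additive_of_preservesFiniteColimits (F : C ⥤ D) [PreservesFiniteColimits F] :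
    F.Additive := by
  have : PreservesColimit (Functor.empty.{0} C) F := inferInstance
  have : F.PreservesZeroMorphisms := inferInstance
  have : PreservesBinaryBiproducts F := preservesBinaryBiproducts_of_preservesBinaryCoproducts F
  exact Functor.additive_of_preservesBinaryBiproducts F

end RightExactAdditive

section IndTensorAdditive

variable {T : Type u} [Category.{v} T] [EssentiallySmall.{v} T] [Abelian T] [MonoidalCategory T]
  [SymmetricCategory T] [∀ X : T, PreservesFiniteColimits (tensorLeft X)]

instance (A : Ind T) : PreservesColimitsOfSize.{w, w} (tensorLeft A) :=
  (Adjunction.ofIsLeftAdjoint (tensorLeft A)).leftAdjoint_preservesColimits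

instance (A : Ind T) : PreservesColimitsOfSize.{w, w} (tensorRight A) :=
  preservesColimits_of_natIso (BraidedCategory.tensorLeftIsoTensorRight A)

attribute [local instance] Abelian.hasFiniteBiproducts

instance : MonoidalPreadditive (Ind T) := by
  have hl (A : Ind T) : (tensorLeft A).Additive :=
    additive_of_preservesFiniteColimits _
  have hr (A : Ind T) : (tensorRight A).Additive :=
    additive_of_preservesFiniteColimits _
  exact
    { whiskerLeft_zero := fun {X Y Z} => (tensorLeft X).map_zero Y Z
      zero_whiskerRight := fun {X Y Z} => (tensorRight X).map_zero Y Z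
      whiskerLeft_add := fun {X _ _} f g => (tensorLeft X).map_add
      add_whiskerRight := fun {X _ _} f g => (tensorRight X).map_add }

end IndTensorAdditive

/-! ### Transfer of coherence along a faithful functor with epimorphic comparison maps -/

section EpiLax

variable {C : Type u} [Category.{v} C] [MonoidalCategoryStruct C] {D : Type u₂} [Category.{v₂} D]
  [MonoidalCategory D]

/-- A faithful functor to a monoidal category, with epimorphisms `U X ⊗ U Y ⟶ U (X ⊗ Y)` that are
compatible with all the structure. -/
structure EpiLax (U : C ⥤ D) where
  m (X Y : C) : U.obj X ⊗ U.obj Y ⟶ U.obj (X ⊗ Y)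
  epi_right (X Y : C) (Z : D) : Epi (m X Y ▷ Z)
  tensorHom {X X' Y Y' : C} (f : X ⟶ X') (g : Y ⟶ Y') :
    m X Y ≫ U.map (f ⊗ₘ g) = (U.map f ⊗ₘ U.map g) ≫ m X' Y'
  whiskerLeft (X : C) {Y Y' : C} (g : Y ⟶ Y') :
    m X Y ≫ U.map (X ◁ g) = U.obj X ◁ U.map g ≫ m X Y'
  whiskerRight {X X' : C} (f : X ⟶ X') (Y : C) :
    m X Y ≫ U.map (f ▷ Y) = U.map f ▷ U.obj Y ≫ m X' Y
  assoc (X Y Z : C) : m X Y ▷ U.obj Z ≫ m (X ⊗ Y) Z ≫ U.map (α_ X Y Z).hom =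
    (α_ _ _ _).hom ≫ U.obj X ◁ m Y Z ≫ m X (Y ⊗ Z)

namespace EpiLax

variable {U : C ⥤ D} (E : EpiLax U)

/-- The structure asks for epimorphisms after whiskering, since tensoring in `D` is not assumed to
preserve epimorphisms; whiskering by the unit recovers the map itself. -/
theorem epi (X Y : C) : Epi (E.m X Y) := by
  have := E.epi_right X Y (𝟙_ D)
  have h : E.m X Y = (ρ_ _).inv ≫ E.m X Y ▷ 𝟙_ D ≫ (ρ_ _).hom := by simp
  rw [h]
  infer_instance

theorem epi_right_right (X Y : C) (Z W : D) : Epi (E.m X Y ▷ Z ▷ W) := by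
  have := E.epi_right X Y (Z ⊗ W)
  have h : E.m X Y ▷ Z ▷ W = (α_ _ _ _).hom ≫ E.m X Y ▷ (Z ⊗ W) ≫ (α_ _ _ _).inv := by simp
  rw [h]
  infer_instance

theorem hom_ext [U.Faithful] {X Y W : C} {f g : X ⊗ Y ⟶ W} (h : E.m X Y ≫ U.map f = E.m X Y ≫ U.map g) :
    f = g := by
  have := E.epi X Y
  exact U.map_injective ((cancel_epi _).1 h)

theorem hom_ext₃ [U.Faithful] {X Y Z W : C} {f g : (X ⊗ Y) ⊗ Z ⟶ W}
    (h : E.m X Y ▷ U.obj Z ≫ E.m (X ⊗ Y) Z ≫ U.map f = E.m X Y ▷ U.obj Z ≫ E.m (X ⊗ Y) Z ≫ U.map g) :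
    f = g := by
  have := E.epi_right X Y (U.obj Z)
  exact E.hom_ext ((cancel_epi _).1 h)

theorem hom_ext₄ [U.Faithful] {X Y Z W V : C} {f g : ((X ⊗ Y) ⊗ Z) ⊗ W ⟶ V}
    (h : E.m X Y ▷ U.obj Z ▷ U.obj W ≫ E.m (X ⊗ Y) Z ▷ U.obj W ≫ E.m _ W ≫ U.map f =
      E.m X Y ▷ U.obj Z ▷ U.obj W ≫ E.m (X ⊗ Y) Z ▷ U.obj W ≫ E.m _ W ≫ U.map g) :
    f = g := by
  have := E.epi_right_right X Y (U.obj Z) (U.obj W)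
  exact E.hom_ext₃ ((cancel_epi _).1 h)

/-- The coherence laws hold if they hold in the target. -/
abbrev monoidal [U.Faithful]
    (hl : ∀ {X Y : C} (f : X ⟶ Y), 𝟙_ C ◁ f ≫ (λ_ Y).hom = (λ_ X).hom ≫ f)
    (hr : ∀ {X Y : C} (f : X ⟶ Y), f ▷ 𝟙_ C ≫ (ρ_ Y).hom = (ρ_ X).hom ≫ f)
    (ht : ∀ X Y : C, (α_ X (𝟙_ C) Y).hom ≫ X ◁ (λ_ Y).hom = (ρ_ X).hom ▷ Y) : MonoidalCategory C where
  tensorHom_def f g := E.hom_ext (by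
    rw [E.tensorHom, Functor.map_comp, reassoc_of% E.whiskerRight, E.whiskerLeft,
      MonoidalCategory.tensorHom_def, Category.assoc])
  id_tensorHom_id X Y := E.hom_ext (by simp [E.tensorHom])
  tensorHom_comp_tensorHom f g h k := E.hom_ext (by simp [E.tensorHom, reassoc_of% E.tensorHom])
  whiskerLeft_id X Y := E.hom_ext (by simp [E.whiskerLeft])
  id_whiskerRight X Y := E.hom_ext (by simp [E.whiskerRight])
  associator_naturality f g h := E.hom_ext₃ (by
    rw [Functor.map_comp, Functor.map_comp, reassoc_of% E.tensorHom, reassoc_of% E.assoc, E.tensorHom,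
      ← tensorHom_id, tensorHom_comp_tensorHom_assoc, E.tensorHom, Category.id_comp,
      ← Category.comp_id (U.map h), ← tensorHom_comp_tensorHom_assoc, tensorHom_id, E.assoc,
      associator_naturality_assoc, ← id_tensorHom, ← id_tensorHom, tensorHom_comp_tensorHom_assoc,
      tensorHom_comp_tensorHom_assoc, Category.comp_id, Category.id_comp, E.tensorHom])
  leftUnitor_naturality := hl
  rightUnitor_naturality := hr
  triangle := ht
  -- After precomposition with the epimorphism from the fourfold tensor product in `D`, the pentagon
  -- becomes the one of `D`.
  pentagon W X Y Z := E.hom_ext₄ (by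
    simp only [Functor.map_comp, reassoc_of% E.whiskerRight, ← comp_whiskerRight_assoc, E.assoc, reassoc_of% E.assoc]
    rw [comp_whiskerRight_assoc, comp_whiskerRight_assoc, reassoc_of% E.assoc, E.whiskerLeft,
      whisker_assoc_assoc, Iso.inv_hom_id_assoc, ← whiskerLeft_comp_assoc, ← whiskerLeft_comp_assoc,
      Category.assoc, E.assoc, associator_naturality_left_assoc, ← whisker_exchange_assoc, E.assoc]
    simp)

end EpiLax

end EpiLax

/-! ### Transfer of symmetry -/

section EpiLaxSymmetric

variable {C : Type u} [Category.{v} C] [MonoidalCategory C] {D : Type u₂} [Category.{v₂} D]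
  [MonoidalCategory D]

namespace EpiLax

variable {U : C ⥤ D} (E : EpiLax U)

/-- The lax monoidal structure. -/
abbrev laxMonoidal (e : 𝟙_ D ⟶ U.obj (𝟙_ C))
    (hl : ∀ X : C, e ▷ U.obj X ≫ E.m _ _ ≫ U.map (λ_ X).hom = (λ_ _).hom)
    (hr : ∀ X : C, U.obj X ◁ e ≫ E.m _ _ ≫ U.map (ρ_ X).hom = (ρ_ _).hom) : U.LaxMonoidal where
  ε := e
  μ := E.m
  μ_natural_left f X := (E.whiskerRight f X).symm
  μ_natural_right X f := (E.whiskerLeft X f).symm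
  associativity := E.assoc
  left_unitality X := (hl X).symm
  right_unitality X := (hr X).symm

theorem monoidalPreadditive (E : EpiLax U) [U.Faithful] [Preadditive C] [Preadditive D] [U.Additive]
    [MonoidalPreadditive D] : MonoidalPreadditive C where
  whiskerLeft_zero := E.hom_ext (by simp [E.whiskerLeft])
  zero_whiskerRight := E.hom_ext (by simp [E.whiskerRight])
  whiskerLeft_add f g := E.hom_ext (by simp [E.whiskerLeft, U.map_add])
  add_whiskerRight f g := E.hom_ext (by simp [E.whiskerRight, U.map_add])

variable [SymmetricCategory D]

theorem epi_left (X Y : C) (Z : D) : Epi (Z ◁ E.m X Y) := by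
  have := E.epi_right X Y Z
  have h : Z ◁ E.m X Y = (β_ _ _).hom ≫ E.m X Y ▷ Z ≫ (β_ _ _).hom := by
    rw [BraidedCategory.braiding_naturality_left, SymmetricCategory.symmetry_assoc]
  rw [h]
  infer_instance

theorem hom_ext₃' [U.Faithful] {X Y Z W : C} {f g : X ⊗ Y ⊗ Z ⟶ W}
    (h : U.obj X ◁ E.m Y Z ≫ E.m X (Y ⊗ Z) ≫ U.map f = U.obj X ◁ E.m Y Z ≫ E.m X (Y ⊗ Z) ≫ U.map g) :
    f = g := by
  have := E.epi_left Y Z (U.obj X)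
  exact E.hom_ext ((cancel_epi _).1 h)

theorem assoc_inv (X Y Z : C) : U.obj X ◁ E.m Y Z ≫ E.m X (Y ⊗ Z) ≫ U.map (α_ X Y Z).inv =
    (α_ _ _ _).inv ≫ E.m X Y ▷ U.obj Z ≫ E.m (X ⊗ Y) Z := by
  rw [Iso.eq_inv_comp, ← reassoc_of% E.assoc, ← U.map_comp, Iso.hom_inv_id, U.map_id, Category.comp_id]

/-- The symmetry laws hold if they hold in the target. -/
abbrev symmetric [U.Faithful] (b : ∀ X Y : C, X ⊗ Y ⟶ Y ⊗ X)
    (hb : ∀ X Y : C, E.m X Y ≫ U.map (b X Y) = (β_ _ _).hom ≫ E.m Y X) : SymmetricCategory C :=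
  have hb' (X Y : C) {W : D} (f : U.obj (Y ⊗ X) ⟶ W) :
      E.m X Y ≫ U.map (b X Y) ≫ f = (β_ _ _).hom ≫ E.m Y X ≫ f := by
    rw [← Category.assoc, hb, Category.assoc]
  have hs (X Y : C) : b X Y ≫ b Y X = 𝟙 _ := E.hom_ext (by simp [hb, hb'])
  { braiding := fun X Y => ⟨b X Y, b Y X, hs X Y, hs Y X⟩
    braiding_naturality_left := fun f Z => E.hom_ext (by
      simp [hb, hb', E.whiskerLeft, reassoc_of% E.whiskerRight])
    braiding_naturality_right := fun Z _ _ f => E.hom_ext (by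
      simp [hb, hb', E.whiskerRight, reassoc_of% E.whiskerLeft])
    hexagon_forward := fun X Y Z => E.hom_ext₃ (by
      simp only [Functor.map_comp, reassoc_of% E.assoc, hb', reassoc_of% E.whiskerRight,
        ← comp_whiskerRight_assoc, hb]
      rw [BraidedCategory.braiding_naturality_right_assoc, E.assoc, comp_whiskerRight_assoc,
        reassoc_of% E.assoc, E.whiskerLeft, ← whiskerLeft_comp_assoc, hb, whiskerLeft_comp_assoc,
        BraidedCategory.hexagon_forward_assoc])
    hexagon_reverse := fun X Y Z => E.hom_ext₃' (by
      simp only [Functor.map_comp, reassoc_of% E.assoc_inv, hb', reassoc_of% E.whiskerLeft,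
        ← whiskerLeft_comp_assoc, hb]
      rw [BraidedCategory.braiding_naturality_left_assoc, E.assoc_inv, whiskerLeft_comp_assoc,
        reassoc_of% E.assoc_inv, E.whiskerRight, ← comp_whiskerRight_assoc, hb, comp_whiskerRight_assoc,
        BraidedCategory.hexagon_reverse_assoc])
    symmetry := hs }

end EpiLax

end EpiLaxSymmetric

/-! ### Modules over an algebra as algebras over the monad `A ⊗ -` -/

section AlgebraModules

variable {D : Type u} [Category.{v} D] [MonoidalCategory D]

/-- The monad `A ⊗ -` of an algebra `A`. -/
abbrev algMonad (A : D) [MonObj A] : Monad D where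
  toFunctor := tensorLeft A
  η :=
    { app := fun X => (λ_ X).inv ≫ MonObj.one (X := A) ▷ X
      naturality := fun X Y f => by
        change f ≫ (λ_ Y).inv ≫ MonObj.one ▷ Y = ((λ_ X).inv ≫ MonObj.one ▷ X) ≫ A ◁ f
        rw [leftUnitor_inv_naturality_assoc, Category.assoc, whisker_exchange] }
  μ :=
    { app := fun X => (α_ A A X).inv ≫ MonObj.mul (X := A) ▷ X
      naturality := fun X Y f => by
        change A ◁ A ◁ f ≫ (α_ A A Y).inv ≫ MonObj.mul ▷ Y =
          ((α_ A A X).inv ≫ MonObj.mul ▷ X) ≫ A ◁ f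
        rw [associator_inv_naturality_right_assoc, Category.assoc, whisker_exchange] }
  assoc X := by
    change A ◁ ((α_ A A X).inv ≫ MonObj.mul ▷ X) ≫ (α_ A A X).inv ≫ MonObj.mul ▷ X =
      ((α_ A A (A ⊗ X)).inv ≫ MonObj.mul ▷ (A ⊗ X)) ≫ (α_ A A X).inv ≫ MonObj.mul ▷ X
    rw [Category.assoc, associator_inv_naturality_left_assoc, ← comp_whiskerRight, MonObj.mul_assoc]
    monoidal
  left_unit X := by
    change ((λ_ (A ⊗ X)).inv ≫ MonObj.one ▷ (A ⊗ X)) ≫ (α_ A A X).inv ≫ MonObj.mul ▷ X = 𝟙 _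
    rw [Category.assoc, associator_inv_naturality_left_assoc, ← comp_whiskerRight, MonObj.one_mul]
    monoidal
  right_unit X := by
    change A ◁ ((λ_ X).inv ≫ MonObj.one ▷ X) ≫ (α_ A A X).inv ≫ MonObj.mul ▷ X = 𝟙 _
    rw [MonoidalCategory.whiskerLeft_comp_assoc, associator_inv_naturality_middle_assoc,
      ← comp_whiskerRight, MonObj.mul_one]
    monoidal

/-- Modules over the algebra `A`. -/
abbrev AMod (A : D) [MonObj A] := (algMonad A).Algebra

namespace AMod

variable {A : D} [MonObj A]

/-- The action of `A` on a module. -/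
abbrev act (M : AMod A) : A ⊗ M.A ⟶ M.A := M.a

theorem one_act (M : AMod A) : MonObj.one ▷ M.A ≫ M.act = (λ_ M.A).hom := by
  have h : ((λ_ M.A).inv ≫ MonObj.one ▷ M.A) ≫ M.act = 𝟙 _ := M.unit
  rwa [Category.assoc, Iso.inv_comp_eq, Category.comp_id] at h

theorem mul_act (M : AMod A) : MonObj.mul ▷ M.A ≫ M.act = (α_ _ _ _).hom ≫ A ◁ M.act ≫ M.act := by
  have h : ((α_ A A M.A).inv ≫ MonObj.mul ▷ M.A) ≫ M.act = A ◁ M.act ≫ M.act := M.assoc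
  rwa [Category.assoc, Iso.inv_comp_eq] at h

theorem hom_act {M N : AMod A} (f : M ⟶ N) : A ◁ f.f ≫ N.act = M.act ≫ f.f := f.h

/-- Construct a module. -/
abbrev mk' (X : D) (a : A ⊗ X ⟶ X) (h1 : MonObj.one ▷ X ≫ a = (λ_ X).hom)
    (h2 : MonObj.mul ▷ X ≫ a = (α_ _ _ _).hom ≫ A ◁ a ≫ a) : AMod A where
  A := X
  a := a
  unit := by
    change ((λ_ X).inv ≫ MonObj.one ▷ X) ≫ a = 𝟙 _
    rw [Category.assoc, h1, Iso.inv_hom_id]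
  assoc := by
    change ((α_ A A X).inv ≫ MonObj.mul ▷ X) ≫ a = A ◁ a ≫ a
    rw [Category.assoc, h2, Iso.inv_hom_id_assoc]

/-- Construct a morphism of modules. -/
abbrev homMk {M N : AMod A} (f : M.A ⟶ N.A) (h : A ◁ f ≫ N.act = M.act ≫ f) : M ⟶ N := ⟨f, h⟩

theorem comp_f' {M N P : AMod A} (f : M ⟶ N) (g : N ⟶ P) : (f ≫ g).f = f.f ≫ g.f := rfl

theorem id_f' (M : AMod A) : Monad.Algebra.Hom.f (𝟙 M) = 𝟙 M.A := rfl

theorem hom_ext {M N : AMod A} {f g : M ⟶ N} (h : f.f = g.f) : f = g := Monad.Algebra.Hom.ext h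

/-- The tensor product of a module and an object. -/
abbrev tens (M : AMod A) (Z : D) : AMod A :=
  mk' (M.A ⊗ Z) ((α_ _ _ _).inv ≫ M.act ▷ Z)
    (by rw [associator_inv_naturality_left_assoc, ← comp_whiskerRight, one_act]; monoidal)
    (by rw [associator_inv_naturality_left_assoc, ← comp_whiskerRight, mul_act]; monoidal)

theorem tens_act (M : AMod A) (Z : D) : (M.tens Z).act = (α_ _ _ _).inv ≫ M.act ▷ Z := rfl

/-- Functoriality of `tens` in the object. -/
abbrev tensMap (M : AMod A) {Z Z' : D} (f : Z ⟶ Z') : M.tens Z ⟶ M.tens Z' :=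
  homMk (M.A ◁ f) (by
    rw [tens_act, tens_act]
    change A ◁ M.A ◁ f ≫ (α_ A M.A Z').inv ≫ M.act ▷ Z' = ((α_ A M.A Z).inv ≫ M.act ▷ Z) ≫ M.A ◁ f
    rw [associator_inv_naturality_right_assoc, Category.assoc, whisker_exchange])

/-- The functor `- ⊗ Z` on modules. -/
abbrev tensRight (Z : D) : AMod A ⥤ AMod A where
  obj M := M.tens Z
  map {M N} f := homMk (f.f ▷ Z) (by
    change A ◁ (f.f ▷ Z) ≫ (α_ A N.A Z).inv ≫ N.act ▷ Z = ((α_ A M.A Z).inv ≫ M.act ▷ Z) ≫ f.f ▷ Z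
    rw [associator_inv_naturality_middle_assoc, ← comp_whiskerRight, hom_act, comp_whiskerRight,
      Category.assoc])
  map_id M := hom_ext (id_whiskerRight M.A Z)
  map_comp f g := hom_ext (comp_whiskerRight f.f g.f Z)

/-- Associativity of `tens`. -/
def tensAssoc (M : AMod A) (Y Z : D) : (M.tens Y).tens Z ≅ M.tens (Y ⊗ Z) :=
  Monad.Algebra.isoMk (α_ M.A Y Z) (by
    change A ◁ (α_ M.A Y Z).hom ≫ (α_ A M.A (Y ⊗ Z)).inv ≫ M.act ▷ (Y ⊗ Z) =
      ((α_ A (M.A ⊗ Y) Z).inv ≫ ((α_ A M.A Y).inv ≫ M.act ▷ Y) ▷ Z) ≫ (α_ M.A Y Z).hom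
    simp)

/-- The regular module. -/
abbrev unit (A : D) [MonObj A] : AMod A := mk' A MonObj.mul (MonObj.one_mul A) (MonObj.mul_assoc A)

theorem unit_act : (unit A).act = MonObj.mul := rfl

/-- The right unitor for `tens`. -/
def tensUnit (M : AMod A) : M.tens (𝟙_ D) ≅ M :=
  Monad.Algebra.isoMk (ρ_ M.A) (by
    change A ◁ (ρ_ M.A).hom ≫ M.act = ((α_ A M.A (𝟙_ D)).inv ≫ M.act ▷ (𝟙_ D)) ≫ (ρ_ M.A).hom
    simp)

section Symmetric

variable [SymmetricCategory D] [IsCommMonObj A]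

/-- The right action on a module. -/
def ract (M : AMod A) : M.tens A ⟶ M :=
  homMk ((β_ _ _).hom ≫ M.act) (by
    change A ◁ ((β_ M.A A).hom ≫ M.act) ≫ M.act =
      ((α_ A M.A A).inv ≫ M.act ▷ A) ≫ (β_ M.A A).hom ≫ M.act
    have h := M.mul_act
    rw [← Iso.inv_comp_eq] at h
    rw [MonoidalCategory.whiskerLeft_comp_assoc, ← h, Category.assoc,
      BraidedCategory.braiding_naturality_left_assoc, ← h, BraidedCategory.braiding_tensor_left_hom]
    -- Commutativity of `A` enters here: it absorbs the braiding of `A` with itself into the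
    -- multiplication.
    simp [← comp_whiskerRight_assoc])

theorem ract_f (M : AMod A) : M.ract.f = (β_ _ _).hom ≫ M.act := rfl

theorem ract_tens (M : AMod A) (Z : D) :
    (M.tens Z).ract.f = (α_ _ _ _).hom ≫ M.A ◁ (β_ Z A).hom ≫ (α_ _ _ _).inv ≫ M.ract.f ▷ Z := by
  rw [ract_f, ract_f, tens_act]
  change (β_ (M.A ⊗ Z) A).hom ≫ (α_ A M.A Z).inv ≫ M.act ▷ Z = _
  rw [BraidedCategory.braiding_tensor_left_hom, comp_whiskerRight]
  simp

theorem ract_naturality {M N : AMod A} (f : M ⟶ N) : f.f ▷ A ≫ N.ract.f = M.ract.f ≫ f.f := by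
  rw [ract_f, ract_f, BraidedCategory.braiding_naturality_left_assoc, hom_act, Category.assoc]

end Symmetric

end AMod

end AlgebraModules

section CokernelDescent

theorem exists_desc_map_cokernel {C : Type u} [Category.{v} C] [Abelian C] {D : Type u₂}
    [Category.{v₂} D] [Abelian D] (F : C ⥤ D) [PreservesFiniteColimits F] {X Y : C} (f : X ⟶ Y)
    {W : D} (h : F.obj Y ⟶ W) (hw : F.map f ≫ h = 0) :
    ∃ g : F.obj (cokernel f) ⟶ W, F.map (cokernel.π f) ≫ g = h := by
  have := additive_of_preservesFiniteColimits F
  exact ⟨_, (Cofork.IsColimit.desc' (isColimitOfHasCokernelOfPreservesColimit F f) h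
    (by rw [hw, zero_comp])).2⟩

end CokernelDescent

/-! ### Modules form an abelian category -/

section AlgebraModulesAbelian

variable {D : Type u} [Category.{v} D] [MonoidalCategory D] [Abelian D] [MonoidalPreadditive D]
  [hD : ∀ A : D, PreservesFiniteColimits (tensorLeft A)]

namespace AMod

variable {A : D} [MonObj A]

instance algMonad_preserves : PreservesFiniteColimits (algMonad A).toFunctor := hD A

instance algMonad_additive : Functor.Additive (algMonad A).toFunctor :=
  inferInstanceAs (tensorLeft A).Additive

instance : HasFiniteLimits (AMod A) where
  out _ _ _ := hasLimitsOfShape_of_hasLimitsOfShape_createsLimitsOfShape (algMonad A).forget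

instance : HasFiniteColimits (AMod A) where
  out _ _ _ := hasColimitsOfShape_of_hasColimitsOfShape_createsColimitsOfShape (algMonad A).forget

instance : PreservesFiniteLimits (algMonad A).forget where
  preservesFiniteLimits _ _ _ := inferInstance

instance : PreservesFiniteColimits (algMonad A).forget where
  preservesFiniteColimits _ _ _ := inferInstance

instance preadditive : Preadditive (AMod A) := Monad.algebraPreadditive D (algMonad A)

instance : (algMonad A).forget.Additive := Monad.forget_additive D (algMonad A)

/-- The forgetful functor is exact and reflects isomorphisms, so the comparison from coimage to
image may be inspected in `D`. -/
instance {M N : AMod A} (f : M ⟶ N) : IsIso (Abelian.coimageImageComparison f) := by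
  have h := Abelian.PreservesCoimage.hom_coimageImageComparison (F := (algMonad A).forget) f
  have : IsIso ((algMonad A).forget.map (Abelian.coimageImageComparison f)) := by
    rw [← Iso.comp_inv_eq] at h
    rw [← h]
    infer_instance
  exact isIso_of_reflects_iso _ (algMonad A).forget

instance abelian : Abelian (AMod A) :=
  haveI : HasFiniteBiproducts (AMod A) := HasFiniteBiproducts.of_hasFiniteProducts
  .ofCoimageImageComparisonIsIso

end AMod

end AlgebraModulesAbelian

/-! ### The tensor product over `A` as a cokernel -/

section AlgebraModulesTensor

variable {D : Type u} [Category.{v} D] [MonoidalCategory D] [Abelian D] [MonoidalPreadditive D]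
  [hD : ∀ A : D, PreservesFiniteColimits (tensorLeft A)] [SymmetricCategory D]

instance (A : D) : PreservesFiniteColimits (tensorRight A) :=
  ⟨fun _ _ _ => preservesColimitsOfShape_of_natIso (BraidedCategory.tensorLeftIsoTensorRight A)⟩

namespace AMod

variable {A : D} [MonObj A]

theorem epi_f {M N : AMod A} (f : M ⟶ N) [Epi f] : Epi f.f :=
  inferInstanceAs (Epi ((algMonad A).forget.map f))

instance tensRight_preserves (J : Type) [SmallCategory J] [FinCategory J] (Z : D) :
    PreservesColimitsOfShape J (tensRight (A := A) Z) :=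
  have : PreservesColimitsOfShape J (tensRight (A := A) Z ⋙ (algMonad A).forget) :=
    inferInstanceAs (PreservesColimitsOfShape J ((algMonad A).forget ⋙ tensorRight Z))
  preservesColimitsOfShape_of_reflects_of_preserves _ (algMonad A).forget

instance (Z : D) : PreservesFiniteColimits (tensRight (A := A) Z) := ⟨fun _ _ _ => inferInstance⟩

instance tensRight_additive (Z : D) : (tensRight (A := A) Z).Additive where
  map_add {_ _ f g} := hom_ext (MonoidalPreadditive.add_whiskerRight f.f g.f)

variable [IsCommMonObj A]

/-- The difference of the two actions of `A` on the middle factor. -/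
def rel (M N : AMod A) : M.tens (A ⊗ N.A) ⟶ M.tens N.A :=
  M.tensMap N.act - (M.tensAssoc A N.A).inv ≫ (tensRight N.A).map M.ract

/-- The tensor product of modules. -/
def tensorObj (M N : AMod A) : AMod A := cokernel (rel M N)

/-- The projection onto the tensor product of modules. -/
def tensorπ (M N : AMod A) : M.tens N.A ⟶ tensorObj M N := cokernel.π (rel M N)

instance (M N : AMod A) : Epi (tensorπ M N) := inferInstanceAs (Epi (cokernel.π _))

instance (M N : AMod A) : Epi (tensorπ M N).f := epi_f _

theorem tensorπ_bal (M N : AMod A) : M.A ◁ N.act ≫ (tensorπ M N).f =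
    (α_ _ _ _).inv ≫ M.ract.f ▷ N.A ≫ (tensorπ M N).f := by
  have h := cokernel.condition (rel M N)
  rw [rel, Preadditive.sub_comp, sub_eq_zero, Category.assoc] at h
  exact congrArg Monad.Algebra.Hom.f h

theorem tensorπ_act (M N : AMod A) : A ◁ (tensorπ M N).f ≫ (tensorObj M N).act =
    (α_ _ _ _).inv ≫ M.act ▷ N.A ≫ (tensorπ M N).f := by
  rw [hom_act, tens_act, Category.assoc]

/-- On `M ⊗ N` the scalar is first moved past `N` to act on `M`; balancedness then carries it back
to act on `N`. -/
theorem tensorπ_ract (M N : AMod A) : (tensorπ M N).f ▷ A ≫ (tensorObj M N).ract.f =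
    (α_ _ _ _).hom ≫ M.A ◁ N.ract.f ≫ (tensorπ M N).f := by
  rw [ract_naturality, ract_tens, ract_f N, MonoidalCategory.whiskerLeft_comp_assoc, tensorπ_bal]
  simp only [Category.assoc]

/-- Descent along the projection. -/
def tensorDesc {M N W : AMod A} (f : M.tens N.A ⟶ W)
    (h : M.A ◁ N.act ≫ f.f = (α_ _ _ _).inv ≫ M.ract.f ▷ N.A ≫ f.f) : tensorObj M N ⟶ W :=
  cokernel.desc _ f (by
    rw [rel, Preadditive.sub_comp, sub_eq_zero, Category.assoc]
    exact hom_ext h)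

theorem tensorπ_desc {M N W : AMod A} (f : M.tens N.A ⟶ W)
    (h : M.A ◁ N.act ≫ f.f = (α_ _ _ _).inv ≫ M.ract.f ▷ N.A ≫ f.f) :
    tensorπ M N ≫ tensorDesc f h = f := cokernel.π_desc _ _ _

theorem tensorπ_desc_f {M N W : AMod A} (f : M.tens N.A ⟶ W)
    (h : M.A ◁ N.act ≫ f.f = (α_ _ _ _).inv ≫ M.ract.f ▷ N.A ≫ f.f) :
    (tensorπ M N).f ≫ (tensorDesc f h).f = f.f := congrArg Monad.Algebra.Hom.f (tensorπ_desc f h)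

/-- Tensoring with `Z` is right exact, so the whiskered projection is again a cokernel and can be
descended along. The associator needs this. -/
theorem exists_tensorDesc {M N W : AMod A} {Z : D} (f : (M.tens N.A).tens Z ⟶ W)
    (h : (M.A ◁ N.act) ▷ Z ≫ f.f = (α_ _ _ _).inv ▷ Z ≫ M.ract.f ▷ N.A ▷ Z ≫ f.f) :
    ∃ g : (tensorObj M N).tens Z ⟶ W, (tensorπ M N).f ▷ Z ≫ g.f = f.f := by
  have hw : (tensRight Z).map (rel M N) ≫ f = 0 := by
    rw [rel, Functor.map_sub, Preadditive.sub_comp, sub_eq_zero, Functor.map_comp, Category.assoc]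
    exact hom_ext h
  obtain ⟨g, hg⟩ := exists_desc_map_cokernel _ _ _ hw
  exact ⟨g, congrArg Monad.Algebra.Hom.f hg⟩

/-- Descent along the projection tensored with an object. -/
def tensorDesc' {M N W : AMod A} {Z : D} (f : (M.tens N.A).tens Z ⟶ W)
    (h : (M.A ◁ N.act) ▷ Z ≫ f.f = (α_ _ _ _).inv ▷ Z ≫ M.ract.f ▷ N.A ▷ Z ≫ f.f) :
    (tensorObj M N).tens Z ⟶ W := (exists_tensorDesc f h).choose

theorem tensorπ_desc' {M N W : AMod A} {Z : D} (f : (M.tens N.A).tens Z ⟶ W)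
    (h : (M.A ◁ N.act) ▷ Z ≫ f.f = (α_ _ _ _).inv ▷ Z ≫ M.ract.f ▷ N.A ▷ Z ≫ f.f) :
    (tensorπ M N).f ▷ Z ≫ (tensorDesc' f h).f = f.f := (exists_tensorDesc f h).choose_spec

instance tensorπ_epi_right (M N : AMod A) (Z : D) : Epi ((tensorπ M N).f ▷ Z) :=
  inferInstanceAs (Epi ((tensorRight Z).map (tensorπ M N).f))

end AMod

end AlgebraModulesTensor

/-! ### Associator, braiding and unitor over `A` -/

section AlgebraModulesMonoidal

variable {D : Type u} [Category.{v} D] [MonoidalCategory D] [Abelian D] [MonoidalPreadditive D]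
  [hD : ∀ A : D, PreservesFiniteColimits (tensorLeft A)] [SymmetricCategory D]

namespace AMod

variable {A : D} [MonObj A] [IsCommMonObj A]

/-- The associator before descent. -/
abbrev assocAux (M N P : AMod A) : (M.tens N.A).tens P.A ⟶ tensorObj M (tensorObj N P) :=
  (M.tensAssoc N.A P.A).hom ≫ M.tensMap (tensorπ N P).f ≫ tensorπ M (tensorObj N P)

theorem assocAux_f (M N P : AMod A) : (assocAux M N P).f =
    (α_ _ _ _).hom ≫ M.A ◁ (tensorπ N P).f ≫ (tensorπ M (tensorObj N P)).f := rfl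

/-- Acting on `N` inside `N ⊗ P` is the action on the module `tensorObj N P`, and this module is
balanced against `M`. -/
theorem assocAux_bal (M N P : AMod A) : (M.A ◁ N.act) ▷ P.A ≫ (assocAux M N P).f =
    (α_ _ _ _).inv ▷ P.A ≫ M.ract.f ▷ N.A ▷ P.A ≫ (assocAux M N P).f := by
  rw [assocAux_f, associator_naturality_middle_assoc, ← MonoidalCategory.whiskerLeft_comp_assoc]
  have h := tensorπ_act N P
  rw [Iso.eq_inv_comp] at h
  rw [← h, MonoidalCategory.whiskerLeft_comp_assoc, MonoidalCategory.whiskerLeft_comp_assoc,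
    tensorπ_bal, associator_inv_naturality_right_assoc, whisker_exchange_assoc,
    associator_naturality_left_assoc]
  monoidal

/-- The associator after the first descent. -/
abbrev assocAux' (M N P : AMod A) : (tensorObj M N).tens P.A ⟶ tensorObj M (tensorObj N P) :=
  tensorDesc' (assocAux M N P) (assocAux_bal M N P)

theorem assocAux'_f (M N P : AMod A) : (tensorπ M N).f ▷ P.A ≫ (assocAux' M N P).f =
    (α_ _ _ _).hom ≫ M.A ◁ (tensorπ N P).f ≫ (tensorπ M (tensorObj N P)).f :=
  tensorπ_desc' _ _

/-- The right action on `tensorObj M N` is the right action on `N`, so after cancelling an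
epimorphism this is the balancedness of `N` against `P`. -/
theorem assocAux'_bal (M N P : AMod A) : (tensorObj M N).A ◁ P.act ≫ (assocAux' M N P).f =
    (α_ _ _ _).inv ≫ (tensorObj M N).ract.f ▷ P.A ≫ (assocAux' M N P).f := by
  rw [← cancel_epi ((tensorπ M N).f ▷ (A ⊗ P.A)), ← whisker_exchange_assoc, assocAux'_f,
    associator_inv_naturality_left_assoc, ← comp_whiskerRight_assoc, tensorπ_ract]
  simp only [comp_whiskerRight, Category.assoc, assocAux'_f]
  rw [associator_naturality_middle_assoc, ← MonoidalCategory.whiskerLeft_comp_assoc,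
    associator_naturality_right_assoc, ← MonoidalCategory.whiskerLeft_comp_assoc, tensorπ_bal]
  monoidal

/-- The associator. -/
def assocHom (M N P : AMod A) : tensorObj (tensorObj M N) P ⟶ tensorObj M (tensorObj N P) :=
  tensorDesc (assocAux' M N P) (assocAux'_bal M N P)

theorem assocHom_f (M N P : AMod A) : (tensorπ M N).f ▷ P.A ≫ (tensorπ (tensorObj M N) P).f ≫
    (assocHom M N P).f = (α_ _ _ _).hom ≫ M.A ◁ (tensorπ N P).f ≫ (tensorπ M (tensorObj N P)).f := by
  rw [assocHom, tensorπ_desc_f, assocAux'_f]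

/-- The braiding before descent. -/
abbrev braidAux (M N : AMod A) : M.tens N.A ⟶ tensorObj N M :=
  homMk ((β_ _ _).hom ≫ (tensorπ N M).f) (by
    rw [MonoidalCategory.whiskerLeft_comp_assoc, tensorπ_act, tens_act]
    simp only [Category.assoc]
    rw [BraidedCategory.braiding_naturality_left_assoc, tensorπ_bal, ract_f,
      comp_whiskerRight_assoc, BraidedCategory.braiding_tensor_left_hom]
    simp only [Category.assoc, Iso.hom_inv_id_assoc]
    rw [← comp_whiskerRight_assoc (β_ A N.A).hom, SymmetricCategory.symmetry, id_whiskerRight,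
      Category.id_comp, Iso.inv_hom_id_assoc])

theorem braidAux_bal (M N : AMod A) : M.A ◁ N.act ≫ (braidAux M N).f =
    (α_ _ _ _).inv ≫ M.ract.f ▷ N.A ≫ (braidAux M N).f := by
  change M.A ◁ N.act ≫ (β_ _ _).hom ≫ (tensorπ N M).f = (α_ _ _ _).inv ≫ M.ract.f ▷ N.A ≫
    (β_ _ _).hom ≫ (tensorπ N M).f
  rw [BraidedCategory.braiding_naturality_right_assoc, BraidedCategory.braiding_naturality_left_assoc,
    ract_f]
  rw [MonoidalCategory.whiskerLeft_comp_assoc, tensorπ_bal, ract_f,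
    ← BraidedCategory.braiding_naturality_left_assoc, BraidedCategory.braiding_tensor_left_hom,
    BraidedCategory.braiding_tensor_right_hom, comp_whiskerRight_assoc]
  simp only [Category.assoc, Iso.hom_inv_id_assoc]
  rw [← comp_whiskerRight_assoc (β_ A N.A).hom, SymmetricCategory.symmetry, id_whiskerRight,
    Category.id_comp]

/-- The braiding. -/
def braidHom (M N : AMod A) : tensorObj M N ⟶ tensorObj N M :=
  tensorDesc (braidAux M N) (braidAux_bal M N)

theorem braidHom_f (M N : AMod A) : (tensorπ M N).f ≫ (braidHom M N).f =
    (β_ _ _).hom ≫ (tensorπ N M).f := tensorπ_desc_f _ _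

theorem ract_bal (M : AMod A) : M.A ◁ (unit A).act ≫ M.ract.f =
    (α_ M.A A (unit A).A).inv ≫ M.ract.f ▷ (unit A).A ≫ M.ract.f := by
  rw [ract_f]
  change M.A ◁ MonObj.mul ≫ (β_ M.A A).hom ≫ M.act = (α_ M.A A A).inv ≫
    ((β_ _ _).hom ≫ M.act) ▷ A ≫ (β_ _ _).hom ≫ M.act
  have h := M.mul_act
  rw [← Iso.inv_comp_eq] at h
  rw [← IsCommMonObj.mul_comm A, BraidedCategory.braiding_naturality_right_assoc,
    comp_whiskerRight_assoc, comp_whiskerRight_assoc, BraidedCategory.braiding_naturality_left_assoc, ← h,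
    BraidedCategory.braiding_tensor_left_hom, BraidedCategory.braiding_tensor_right_hom]
  simp only [Category.assoc, Iso.hom_inv_id_assoc]

/-- The right unitor. -/
def runit (M : AMod A) : tensorObj M (unit A) ≅ M where
  hom := tensorDesc (N := unit A) M.ract (ract_bal M)
  inv := (M.tensUnit).inv ≫ M.tensMap MonObj.one ≫ tensorπ M (unit A)
  hom_inv_id := by
    rw [← cancel_epi (tensorπ M (unit A)), reassoc_of% tensorπ_desc, Category.comp_id]
    apply hom_ext
    change M.ract.f ≫ (ρ_ M.A).inv ≫ M.A ◁ MonObj.one ≫ (tensorπ M (unit A)).f = _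
    have h := tensorπ_bal M (unit A)
    rw [Iso.eq_inv_comp] at h
    rw [rightUnitor_inv_naturality_assoc, ← whisker_exchange_assoc, ← h,
      associator_naturality_right_assoc, ← MonoidalCategory.whiskerLeft_comp_assoc,
      unit_act, MonObj.mul_one]
    monoidal
  inv_hom_id := by
    rw [Category.assoc, Category.assoc, tensorπ_desc]
    apply hom_ext
    change (ρ_ M.A).inv ≫ M.A ◁ MonObj.one ≫ (β_ M.A A).hom ≫ M.act = 𝟙 _
    rw [BraidedCategory.braiding_naturality_right_assoc, one_act]
    simp

end AMod

end AlgebraModulesMonoidal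

/-! ### The symmetric monoidal category of modules -/

section AlgebraModulesMonoidalStruct

variable {D : Type u} [Category.{v} D] [MonoidalCategory D] [Abelian D] [MonoidalPreadditive D]
  [hD : ∀ A : D, PreservesFiniteColimits (tensorLeft A)] [SymmetricCategory D]

/-- Reversing three factors, reassociating and reversing back inverts the associator. The inverse
associator of modules is built in this way, which avoids a second descent. -/
theorem braiding_reverse (X Y Z : D) : (β_ X (Y ⊗ Z)).hom ≫ (β_ Y Z).hom ▷ X ≫ (α_ Z Y X).hom ≫
    Z ◁ (β_ Y X).hom ≫ (β_ Z (X ⊗ Y)).hom = (α_ X Y Z).inv := by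
  rw [← BraidedCategory.braiding_naturality_right_assoc,
    BraidedCategory.braiding_tensor_right_hom, BraidedCategory.braiding_tensor_right_hom]
  simp only [Category.assoc, Iso.inv_hom_id_assoc]
  rw [← MonoidalCategory.whiskerLeft_comp_assoc Z, SymmetricCategory.symmetry,
    MonoidalCategory.whiskerLeft_id, Category.id_comp, Iso.hom_inv_id_assoc,
    ← comp_whiskerRight_assoc, SymmetricCategory.symmetry, id_whiskerRight, Category.id_comp,
    Iso.inv_hom_id_assoc, ← MonoidalCategory.whiskerLeft_comp_assoc, SymmetricCategory.symmetry,
    MonoidalCategory.whiskerLeft_id, Category.id_comp]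

namespace AMod

variable {A : D} [MonObj A] [IsCommMonObj A]

instance tensorπ_epi_left (M N : AMod A) (Z : D) : Epi (Z ◁ (tensorπ M N).f) :=
  inferInstanceAs (Epi ((tensorLeft Z).map (tensorπ M N).f))

theorem tensor_hom_ext {M N W : AMod A} {f g : tensorObj M N ⟶ W}
    (h : (tensorπ M N).f ≫ f.f = (tensorπ M N).f ≫ g.f) : f = g :=
  hom_ext ((cancel_epi _).1 h)

/-- Tensoring a morphism with a module on the right. -/
def whiskR {M M' : AMod A} (f : M ⟶ M') (N : AMod A) : tensorObj M N ⟶ tensorObj M' N :=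
  tensorDesc ((tensRight N.A).map f ≫ tensorπ M' N) (by
    change M.A ◁ N.act ≫ f.f ▷ N.A ≫ (tensorπ M' N).f =
      (α_ _ _ _).inv ≫ M.ract.f ▷ N.A ≫ f.f ▷ N.A ≫ (tensorπ M' N).f
    rw [whisker_exchange_assoc, tensorπ_bal, ← comp_whiskerRight_assoc, ← ract_naturality,
      associator_inv_naturality_left_assoc, comp_whiskerRight_assoc])

theorem whiskR_f {M M' : AMod A} (f : M ⟶ M') (N : AMod A) :
    (tensorπ M N).f ≫ (whiskR f N).f = f.f ▷ N.A ≫ (tensorπ M' N).f :=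
  tensorπ_desc_f _ _

/-- Tensoring a morphism with a module on the left. -/
def whiskL (M : AMod A) {N N' : AMod A} (g : N ⟶ N') : tensorObj M N ⟶ tensorObj M N' :=
  tensorDesc (M.tensMap g.f ≫ tensorπ M N') (by
    change M.A ◁ N.act ≫ M.A ◁ g.f ≫ (tensorπ M N').f =
      (α_ _ _ _).inv ≫ M.ract.f ▷ N.A ≫ M.A ◁ g.f ≫ (tensorπ M N').f
    rw [← whisker_exchange_assoc, ← MonoidalCategory.whiskerLeft_comp_assoc, ← hom_act,
      MonoidalCategory.whiskerLeft_comp_assoc, tensorπ_bal, associator_inv_naturality_right_assoc])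

theorem whiskL_f (M : AMod A) {N N' : AMod A} (g : N ⟶ N') :
    (tensorπ M N).f ≫ (whiskL M g).f = M.A ◁ g.f ≫ (tensorπ M N').f :=
  tensorπ_desc_f _ _

/-- The inverse associator. -/
def assocInv (M N P : AMod A) : tensorObj M (tensorObj N P) ⟶ tensorObj (tensorObj M N) P :=
  braidHom _ _ ≫ whiskR (braidHom N P) M ≫ assocHom P N M ≫ whiskL P (braidHom N M) ≫ braidHom _ _

theorem assocInv_f (M N P : AMod A) : M.A ◁ (tensorπ N P).f ≫ (tensorπ M (tensorObj N P)).f ≫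
    (assocInv M N P).f = (α_ _ _ _).inv ≫ (tensorπ M N).f ▷ P.A ≫ (tensorπ (tensorObj M N) P).f := by
  simp only [assocInv, comp_f', reassoc_of% braidHom_f, reassoc_of% whiskR_f]
  rw [BraidedCategory.braiding_naturality_right_assoc, ← comp_whiskerRight_assoc, braidHom_f,
    comp_whiskerRight_assoc, reassoc_of% assocHom_f, reassoc_of% whiskL_f, ← MonoidalCategory.whiskerLeft_comp_assoc,
    braidHom_f, braidHom_f, MonoidalCategory.whiskerLeft_comp_assoc,
    BraidedCategory.braiding_naturality_right_assoc, ← braiding_reverse]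
  simp only [Category.assoc]

/-- The associator. -/
def assocIso (M N P : AMod A) : tensorObj (tensorObj M N) P ≅ tensorObj M (tensorObj N P) where
  hom := assocHom M N P
  inv := assocInv M N P
  hom_inv_id := by
    apply tensor_hom_ext
    rw [← cancel_epi ((tensorπ M N).f ▷ P.A), comp_f', reassoc_of% assocHom_f, assocInv_f,
      Iso.hom_inv_id_assoc, id_f', Category.comp_id]
  inv_hom_id := by
    apply tensor_hom_ext
    rw [← cancel_epi (M.A ◁ (tensorπ N P).f), comp_f', reassoc_of% assocInv_f, assocHom_f,
      Iso.inv_hom_id_assoc, id_f', Category.comp_id]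

instance braidIso (M N : AMod A) : IsIso (braidHom M N) :=
  have h (M N : AMod A) : braidHom M N ≫ braidHom N M = 𝟙 _ := tensor_hom_ext (by
    rw [comp_f', reassoc_of% braidHom_f, braidHom_f, SymmetricCategory.symmetry_assoc, id_f',
      Category.comp_id])
  ⟨braidHom N M, h M N, h N M⟩

instance monoidalStruct : MonoidalCategoryStruct (AMod A) where
  tensorObj := tensorObj
  whiskerLeft M _ _ g := whiskL M g
  whiskerRight f N := whiskR f N
  tensorUnit := unit A
  associator := assocIso
  leftUnitor M := asIso (braidHom (unit A) M) ≪≫ runit M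
  rightUnitor := runit

/-- The projections define a lax structure on the forgetful functor. -/
def epiLax (A : D) [MonObj A] [IsCommMonObj A] : EpiLax (algMonad A).forget where
  m M N := (tensorπ M N).f
  epi_right M N Z := tensorπ_epi_right M N Z
  tensorHom {M M' N N'} f g := by
    change (tensorπ M N).f ≫ (whiskR f N ≫ whiskL M' g).f = (f.f ⊗ₘ g.f) ≫ (tensorπ M' N').f
    rw [comp_f', reassoc_of% whiskR_f, whiskL_f, MonoidalCategory.tensorHom_def, Category.assoc]
  whiskerLeft M _ _ g := whiskL_f M g
  whiskerRight f N := whiskR_f f N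
  assoc M N P := assocHom_f M N P

theorem runit_f (M : AMod A) : (tensorπ M (unit A)).f ≫ (runit M).hom.f = M.ract.f :=
  tensorπ_desc_f (N := unit A) M.ract (ract_bal M)

theorem lunit_f (M : AMod A) : (tensorπ (unit A) M).f ≫ Monad.Algebra.Hom.f (λ_ M).hom = M.act := by
  change (tensorπ (unit A) M).f ≫ (braidHom (unit A) M ≫ (runit M).hom).f = M.act
  rw [comp_f', reassoc_of% braidHom_f, runit_f, ract_f]
  simp

instance monoidal : MonoidalCategory (AMod A) :=
  (epiLax A).monoidal
    (fun {X Y} f => tensor_hom_ext (by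
      refine ((reassoc_of% (whiskL_f (unit A) f)) _).trans ?_
      refine Eq.trans ?_ ((lunit_f X).symm ▸ Category.assoc _ _ _)
      exact (congrArg _ (lunit_f Y)).trans (hom_act f)))
    (fun {X Y} f => tensor_hom_ext (by
      refine ((reassoc_of% (whiskR_f f (unit A))) _).trans ?_
      refine Eq.trans ?_ ((runit_f X).symm ▸ Category.assoc _ _ _)
      exact (congrArg _ (runit_f Y)).trans (ract_naturality f)))
    (fun X Y => (epiLax A).hom_ext₃ (by
      change (tensorπ X (unit A)).f ▷ Y.A ≫ (tensorπ (tensorObj X (unit A)) Y).f ≫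
        (assocHom X (unit A) Y).f ≫ (whiskL X (λ_ Y).hom).f =
        (tensorπ X (unit A)).f ▷ Y.A ≫ (tensorπ (tensorObj X (unit A)) Y).f ≫ (whiskR (runit X).hom Y).f
      rw [reassoc_of% assocHom_f, whiskL_f, whiskR_f, ← MonoidalCategory.whiskerLeft_comp_assoc, lunit_f,
        ← comp_whiskerRight_assoc, runit_f]
      have h := tensorπ_bal X Y
      rwa [Iso.eq_inv_comp] at h))

instance symmetric : SymmetricCategory (AMod A) := (epiLax A).symmetric braidHom braidHom_f

end AMod

end AlgebraModulesMonoidalStruct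

/-! ### Braided functors from their oplax structure -/

section BraidedFunctor

open Functor.OplaxMonoidal

/-- The monoidal structure of the free module functor comes from an adjunction as an oplax one, so
compatibility with braidings is most easily checked on `δ`. -/
theorem braided_of_δ_aux {C : Type u} [Category.{v} C] [MonoidalCategory C] [BraidedCategory C]
    {D : Type u₂} [Category.{v₂} D] [MonoidalCategory D] [BraidedCategory D] {F : C ⥤ D} [F.Monoidal]
    {X Y : C} (h : δ F X Y ≫ (β_ _ _).hom = F.map (β_ X Y).hom ≫ δ F Y X) :
    Functor.LaxMonoidal.μ F X Y ≫ F.map (β_ X Y).hom = (β_ _ _).hom ≫ Functor.LaxMonoidal.μ F Y X := by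
  rw [← cancel_epi (δ F X Y), ← cancel_mono (δ F Y X)]
  simp [h]

/-- A monoidal functor is braided if its oplax structure is. -/
abbrev braided_of_δ {C : Type u} [Category.{v} C] [MonoidalCategory C] [BraidedCategory C]
    {D : Type u₂} [Category.{v₂} D] [MonoidalCategory D] [BraidedCategory D] {F : C ⥤ D} [F.Monoidal]
    (h : ∀ X Y, δ F X Y ≫ (β_ _ _).hom = F.map (β_ X Y).hom ≫ δ F Y X) : F.Braided where
  braided X Y := braided_of_δ_aux (h X Y)

end BraidedFunctor

/-! ### Free modules -/

section FreeModules

variable {D : Type u} [Category.{v} D] [MonoidalCategory D]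

namespace AMod

variable {A : D} [MonObj A]

/-- The free module functor. -/
abbrev free (A : D) [MonObj A] : D ⥤ AMod A where
  obj X := (unit A).tens X
  map f := (unit A).tensMap f
  map_id X := hom_ext (MonoidalCategory.whiskerLeft_id A X)
  map_comp f g := hom_ext (MonoidalCategory.whiskerLeft_comp A f g)

/-- The inclusion of the generators of a free module. -/
def freeι (A : D) [MonObj A] (X : D) : X ⟶ A ⊗ X := (λ_ X).inv ≫ MonObj.one ▷ X

/-- The universal property of free modules. -/
abbrev freeDesc {X : D} {M : AMod A} (f : X ⟶ M.A) : (free A).obj X ⟶ M :=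
  homMk (A ◁ f ≫ M.act) (by
    change A ◁ (A ◁ f ≫ M.act) ≫ M.act = ((α_ A A X).inv ≫ MonObj.mul ▷ X) ≫ A ◁ f ≫ M.act
    rw [Category.assoc, ← whisker_exchange_assoc, mul_act]
    simp)

theorem freeι_act {X : D} {M : AMod A} (f : X ⟶ M.A) : freeι A X ≫ A ◁ f ≫ M.act = f := by
  rw [freeι, Category.assoc, ← whisker_exchange_assoc, one_act]
  simp

theorem freeι_freeDesc {X : D} {M : AMod A} (f : X ⟶ M.A) : freeι A X ≫ (freeDesc f).f = f :=
  freeι_act f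

theorem freeDesc_freeι {X : D} {M : AMod A} (f : (free A).obj X ⟶ M) :
    freeDesc (freeι A X ≫ f.f) = f := by
  apply hom_ext
  change A ◁ (((λ_ X).inv ≫ MonObj.one ▷ X) ≫ f.f) ≫ M.act = f.f
  rw [MonoidalCategory.whiskerLeft_comp_assoc, hom_act, tens_act, unit_act]
  simp only [MonoidalCategory.whiskerLeft_comp, Category.assoc]
  rw [associator_inv_naturality_middle_assoc, ← comp_whiskerRight_assoc, MonObj.mul_one]
  simp

theorem free_hom_ext {X : D} {M : AMod A} {f g : (free A).obj X ⟶ M}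
    (h : freeι A X ≫ f.f = freeι A X ≫ g.f) : f = g := by
  rw [← freeDesc_freeι f, ← freeDesc_freeι g]
  exact congrArg freeDesc h

theorem freeι_mul (Y : D) : A ◁ freeι A Y ≫ ((free A).obj Y).act = 𝟙 (A ⊗ Y) := by
  have h := congrArg Monad.Algebra.Hom.f (freeDesc_freeι (𝟙 ((free A).obj Y)))
  rw [id_f', Category.comp_id] at h
  exact h

/-- The adjunction between free modules and the forgetful functor. -/
abbrev freeAdj (A : D) [MonObj A] : free A ⊣ (algMonad A).forget :=
  Adjunction.mkOfUnitCounit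
    { unit :=
        { app := fun X => freeι A X
          naturality := fun X Y f => by
            change f ≫ (λ_ Y).inv ≫ MonObj.one ▷ Y = ((λ_ X).inv ≫ MonObj.one ▷ X) ≫ A ◁ f
            rw [leftUnitor_inv_naturality_assoc, Category.assoc, whisker_exchange] }
      counit :=
        { app := fun M => freeDesc (𝟙 M.A)
          naturality := fun M N f => free_hom_ext (by
            change freeι A M.A ≫ A ◁ f.f ≫ A ◁ 𝟙 _ ≫ N.act =
              freeι A M.A ≫ (A ◁ 𝟙 _ ≫ M.act) ≫ f.f
            simp [hom_act]) }
      left_triangle := by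
        ext X
        simp only [NatTrans.comp_app, Functor.whiskerRight_app, Functor.associator_hom_app,
          Functor.whiskerLeft_app, Category.id_comp]
        change A ◁ freeι A X ≫ A ◁ 𝟙 _ ≫ ((unit A).tens X).act = 𝟙 _
        rw [MonoidalCategory.whiskerLeft_id, Category.id_comp]
        exact freeι_mul X
      right_triangle := by
        ext M
        simp only [NatTrans.comp_app, Functor.whiskerRight_app, Functor.associator_inv_app,
          Functor.whiskerLeft_app, Category.id_comp]
        exact freeι_act (M := M) (𝟙 _) }

theorem freeι_natural {X Y : D} (f : X ⟶ Y) : f ≫ freeι A Y = freeι A X ≫ A ◁ f :=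
  (freeAdj A).unit.naturality f

end AMod

end FreeModules

/-! ### Right exactness over `A`, and free modules as a symmetric monoidal functor -/

section AlgebraModulesRightExact

variable {D : Type u} [Category.{v} D] [MonoidalCategory D] [Abelian D] [MonoidalPreadditive D]
  [hD : ∀ A : D, PreservesFiniteColimits (tensorLeft A)] [SymmetricCategory D]

namespace AMod

variable {A : D} [MonObj A] [IsCommMonObj A]

instance monoidalPreadditive : MonoidalPreadditive (AMod A) := (epiLax A).monoidalPreadditive

/-- `tensorπ` as a natural transformation in the first module. -/
theorem tensorπ_natural {M M' : AMod A} (f : M ⟶ M') (N : AMod A) :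
    tensorπ M N ≫ whiskR f N = (tensRight N.A).map f ≫ tensorπ M' N :=
  hom_ext (whiskR_f f N)

theorem tensorπ_bal' (M N : AMod A) : M.tensMap N.act ≫ tensorπ M N =
    (M.tensAssoc A N.A).inv ≫ (tensRight N.A).map M.ract ≫ tensorπ M N :=
  hom_ext (tensorπ_bal M N)

section

variable {J : Type} [SmallCategory J] [FinCategory J] {K : J ⥤ AMod A} {c : Cocone K}
  (hc : IsColimit c) (N : AMod A)

/-- The cocone from which the universal property of a colimit of tensor products is deduced. -/
abbrev tensorRightCocone (s : Cocone (K ⋙ tensorRight N)) : Cocone (K ⋙ tensRight N.A) where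
  pt := s.pt
  ι :=
    { app := fun j => tensorπ (K.obj j) N ≫ s.ι.app j
      naturality := fun j j' f => by
        have h : whiskR (K.map f) N ≫ s.ι.app j' = s.ι.app j := s.w f
        change (tensRight N.A).map (K.map f) ≫ tensorπ (K.obj j') N ≫ s.ι.app j' =
          (tensorπ (K.obj j) N ≫ s.ι.app j) ≫ 𝟙 _
        rw [← reassoc_of% tensorπ_natural, h, Category.comp_id] }

/-- The first step of the descent. -/
abbrev tensorRightDesc (s : Cocone (K ⋙ tensorRight N)) : c.pt.tens N.A ⟶ s.pt :=
  (isColimitOfPreserves (tensRight N.A) hc).desc (tensorRightCocone N s)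

theorem tensorRightDesc_fac (s : Cocone (K ⋙ tensorRight N)) (j : J) :
    (tensRight N.A).map (c.ι.app j) ≫ tensorRightDesc hc N s = tensorπ (K.obj j) N ≫ s.ι.app j :=
  (isColimitOfPreserves (tensRight N.A) hc).fac (tensorRightCocone N s) j

theorem tensorRightDesc_bal (s : Cocone (K ⋙ tensorRight N)) :
    c.pt.tensMap N.act ≫ tensorRightDesc hc N s =
      (c.pt.tensAssoc A N.A).inv ≫ (tensRight N.A).map c.pt.ract ≫ tensorRightDesc hc N s := by
  -- Both maps start at the colimit tensored with `A ⊗ N.A`, which is again a colimit, so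
  -- balancedness is inherited from the stages.
  refine (isColimitOfPreserves (tensRight (A ⊗ N.A)) hc).hom_ext fun j => ?_
  have h1 : (tensRight (A ⊗ N.A)).map (c.ι.app j) ≫ c.pt.tensMap N.act =
      (K.obj j).tensMap N.act ≫ (tensRight N.A).map (c.ι.app j) :=
    hom_ext (whisker_exchange (c.ι.app j).f N.act).symm
  have h2 : (tensRight (A ⊗ N.A)).map (c.ι.app j) ≫ (c.pt.tensAssoc A N.A).inv ≫
      (tensRight N.A).map c.pt.ract = ((K.obj j).tensAssoc A N.A).inv ≫
        (tensRight N.A).map (K.obj j).ract ≫ (tensRight N.A).map (c.ι.app j) := by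
    apply hom_ext
    change (c.ι.app j).f ▷ (A ⊗ N.A) ≫ (α_ _ _ _).inv ≫ c.pt.ract.f ▷ N.A =
      (α_ _ _ _).inv ≫ (K.obj j).ract.f ▷ N.A ≫ (c.ι.app j).f ▷ N.A
    rw [associator_inv_naturality_left_assoc, ← comp_whiskerRight, ← comp_whiskerRight]
    congr 2
    exact ract_naturality _
  change (tensRight (A ⊗ N.A)).map (c.ι.app j) ≫ _ = (tensRight (A ⊗ N.A)).map (c.ι.app j) ≫ _
  rw [reassoc_of% h1, reassoc_of% h2, tensorRightDesc_fac, ← Category.assoc, tensorπ_bal',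
    Category.assoc, Category.assoc]

/-- The descended morphism. -/
def tensorRightDesc' (s : Cocone (K ⋙ tensorRight N)) : tensorObj c.pt N ⟶ s.pt :=
  tensorDesc (tensorRightDesc hc N s) (congrArg Monad.Algebra.Hom.f (tensorRightDesc_bal hc N s))

theorem tensorπ_tensorRightDesc' (s : Cocone (K ⋙ tensorRight N)) :
    tensorπ c.pt N ≫ tensorRightDesc' hc N s = tensorRightDesc hc N s := tensorπ_desc _ _

/-- Tensoring with a module preserves colimits. -/
def isColimitTensorRight : IsColimit ((tensorRight N).mapCocone c) where
  desc s := tensorRightDesc' hc N s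
  fac s j := by
    change whiskR (c.ι.app j) N ≫ tensorRightDesc' hc N s = _
    rw [← cancel_epi (tensorπ _ N)]
    refine ((reassoc_of% (tensorπ_natural (c.ι.app j) N)) _).trans ?_
    exact (congrArg _ (tensorπ_tensorRightDesc' hc N s)).trans (tensorRightDesc_fac hc N s j)
  uniq s m hm := by
    rw [← cancel_epi (tensorπ c.pt N), tensorπ_tensorRightDesc']
    refine (isColimitOfPreserves (tensRight N.A) hc).hom_ext fun j => ?_
    change (tensRight N.A).map (c.ι.app j) ≫ _ = (tensRight N.A).map (c.ι.app j) ≫ _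
    rw [tensorRightDesc_fac, ← hm j]
    exact ((reassoc_of% (tensorπ_natural (c.ι.app j) N)) m).symm

end

instance (N : AMod A) : PreservesFiniteColimits (tensorRight N) where
  preservesFiniteColimits _ _ _ :=
    ⟨fun {_} => ⟨fun {_} hc => ⟨isColimitTensorRight hc N⟩⟩⟩

instance (N : AMod A) : PreservesFiniteColimits (tensorLeft N) :=
  ⟨fun _ _ _ => preservesColimitsOfShape_of_natIso (BraidedCategory.tensorLeftIsoTensorRight N).symm⟩

theorem unit_isZero_iff : IsZero (𝟙_ (AMod A)) ↔ IsZero A := by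
  constructor
  · intro h
    exact (algMonad A).forget.map_isZero h
  · intro h
    rw [IsZero.iff_id_eq_zero]
    exact hom_ext (h.eq_of_src _ _)

/-- The forgetful functor is lax monoidal. -/
instance forgetLax : (algMonad A).forget.LaxMonoidal :=
  (epiLax A).laxMonoidal (MonObj.one (X := A))
    (fun M => by
      change (MonObj.one (X := A)) ▷ M.A ≫ (tensorπ (unit A) M).f ≫ Monad.Algebra.Hom.f (λ_ M).hom = _
      exact (congrArg _ (lunit_f M)).trans (one_act M))
    (fun M => by
      change M.A ◁ (MonObj.one (X := A)) ≫ (tensorπ M (unit A)).f ≫ (runit M).hom.f = (ρ_ M.A).hom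
      rw [runit_f, ract_f, BraidedCategory.braiding_naturality_right_assoc, one_act]
      simp)

/-- The free module functor is oplax monoidal. -/
instance freeOplax : (free A).OplaxMonoidal := (freeAdj A).leftAdjointOplaxMonoidal

open Functor.OplaxMonoidal

theorem free_η : freeι A (𝟙_ D) ≫ (η (free A)).f = MonObj.one := by
  have h := ((freeAdj A).homEquiv (𝟙_ D) (unit A)).apply_symm_apply (MonObj.one (X := A))
  rwa [Adjunction.homEquiv_unit] at h

theorem free_δ (X Y : D) : freeι A (X ⊗ Y) ≫ (δ (free A) X Y).f = (freeι A X ⊗ₘ freeι A Y) ≫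
      (tensorπ ((free A).obj X) ((free A).obj Y)).f := by
  have h := ((freeAdj A).homEquiv (X ⊗ Y)
    (tensorObj ((free A).obj X) ((free A).obj Y))).apply_symm_apply
      ((freeι A X ⊗ₘ freeι A Y) ≫ (tensorπ ((free A).obj X) ((free A).obj Y)).f)
  rwa [Adjunction.homEquiv_unit] at h

/-- The isomorphism `M ⊗ Y ≅ M ⊗_A (A ⊗ Y)`. -/
def tensFree (M : AMod A) (Y : D) : M.tens Y ≅ tensorObj M ((free A).obj Y) where
  hom := M.tensMap (freeι A Y) ≫ tensorπ M ((free A).obj Y)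
  inv := tensorDesc ((M.tensAssoc A Y).inv ≫ (tensRight Y).map M.ract) (by
    change M.A ◁ ((α_ A A Y).inv ≫ MonObj.mul ▷ Y) ≫ (α_ M.A A Y).inv ≫ M.ract.f ▷ Y =
      (α_ M.A A (A ⊗ Y)).inv ≫ M.ract.f ▷ (A ⊗ Y) ≫ (α_ M.A A Y).inv ≫ M.ract.f ▷ Y
    rw [associator_inv_naturality_left_assoc, ← comp_whiskerRight]
    have h := ract_bal M
    rw [Iso.eq_inv_comp] at h
    rw [← h]
    simp)
  hom_inv_id := by
    rw [Category.assoc, tensorπ_desc]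
    apply hom_ext
    change M.A ◁ ((λ_ Y).inv ≫ MonObj.one ▷ Y) ≫ (α_ M.A A Y).inv ≫
      ((β_ M.A A).hom ≫ M.act) ▷ Y = 𝟙 _
    rw [MonoidalCategory.whiskerLeft_comp_assoc, associator_inv_naturality_middle_assoc,
      ← comp_whiskerRight, BraidedCategory.braiding_naturality_right_assoc, one_act]
    simp
  inv_hom_id := by
    rw [← cancel_epi (tensorπ M ((free A).obj Y)), reassoc_of% tensorπ_desc, Category.comp_id]
    apply hom_ext
    change ((α_ M.A A Y).inv ≫ M.ract.f ▷ Y) ≫ M.A ◁ freeι A Y ≫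
      (tensorπ M ((free A).obj Y)).f = _
    have h := tensorπ_bal M ((free A).obj Y)
    rw [Iso.eq_inv_comp] at h
    rw [Category.assoc, ← whisker_exchange_assoc, ← h, associator_naturality_right_assoc,
      ← MonoidalCategory.whiskerLeft_comp_assoc, freeι_mul, MonoidalCategory.whiskerLeft_id,
      Category.id_comp, Iso.inv_hom_id_assoc]

/-- Maps out of a free module are determined on generators, and this identifies the `δ` coming from
the adjunction with an explicit isomorphism. -/
instance (X Y : D) : IsIso (δ (free A) X Y) := by
  have h : δ (free A) X Y = ((unit A).tensAssoc X Y).inv ≫ (tensFree ((free A).obj X) Y).hom := by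
    apply free_hom_ext
    rw [free_δ]
    change _ = freeι A (X ⊗ Y) ≫ (α_ A X Y).inv ≫ (A ⊗ X) ◁ freeι A Y ≫ _
    rw [MonoidalCategory.tensorHom_def]
    simp [freeι]
  rw [h]
  infer_instance

instance : IsIso (η (free A)) := by
  have h : η (free A) = (unit A).tensUnit.hom := by
    apply free_hom_ext
    rw [free_η]
    change _ = freeι A (𝟙_ D) ≫ (ρ_ A).hom
    simp [freeι, unitors_inv_equal]
  rw [h]
  infer_instance

instance freeMonoidal : (free A).Monoidal := Functor.Monoidal.ofOplaxMonoidal _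

instance freeBraided : (free A).Braided :=
  braided_of_δ fun X Y => by
      apply free_hom_ext
      rw [comp_f', comp_f']
      refine ((reassoc_of% (free_δ (A := A) X Y)) _).trans ?_
      change _ ≫ (tensorπ ((free A).obj X) ((free A).obj Y)).f ≫ (braidHom _ _).f =
        freeι A (X ⊗ Y) ≫ A ◁ (β_ X Y).hom ≫ (δ (free A) Y X).f
      rw [braidHom_f, BraidedCategory.braiding_naturality_assoc, ← reassoc_of% freeι_natural, free_δ]

end AMod

end AlgebraModulesRightExact

/-! ### The linear structure induced by a monoidal functor -/

section LinearOfFunctor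

open Functor.OplaxMonoidal Functor.LaxMonoidal

variable {k : Type w} [Field k] {T : Type u} [Category.{v} T] [Preadditive T] [Linear k T]
  [MonoidalCategory T] [MonoidalPreadditive T] [MonoidalLinear k T]
  {C : Type u₂} [Category.{v₂} C] [Preadditive C]
  [MonoidalCategory C] [MonoidalPreadditive C] [SymmetricCategory C] (F : T ⥤ C) [F.Monoidal]
  [F.Additive]

/-- The endomorphism of the identity functor given by a scalar and a monoidal functor from a linear
category. -/
def scalar (a : k) (X : C) : X ⟶ X :=
  (λ_ X).inv ≫ (ε F ≫ F.map (a • 𝟙 (𝟙_ T)) ≫ η F) ▷ X ≫ (λ_ X).hom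

theorem scalar_natural (a : k) {X Y : C} (f : X ⟶ Y) : scalar F a X ≫ f = f ≫ scalar F a Y := by
  simp only [scalar, Category.assoc]
  rw [← leftUnitor_naturality, leftUnitor_inv_naturality_assoc, whisker_exchange_assoc]

theorem scalar_one (X : C) : scalar F (1 : k) X = 𝟙 X := by simp [scalar]

theorem scalar_mul (a b : k) (X : C) : scalar F (a * b) X = scalar F a X ≫ scalar F b X := by
  have : (a * b) • 𝟙 (𝟙_ T) = (a • 𝟙 (𝟙_ T)) ≫ (b • 𝟙 (𝟙_ T)) := by
    simp [smul_smul, mul_comm]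
  rw [scalar, this, F.map_comp]
  simp [scalar]

theorem scalar_add (a b : k) (X : C) : scalar F (a + b) X = scalar F a X + scalar F b X := by
  simp [scalar, add_smul, F.map_add]

theorem scalar_zero (X : C) : scalar F (0 : k) X = 0 := by simp [scalar]

theorem scalar_whiskerRight (a : k) (X Y : C) : scalar F a X ▷ Y = scalar F a (X ⊗ Y) := by
  simp [scalar]

theorem whiskerLeft_scalar (a : k) (X Y : C) : X ◁ scalar F a Y = scalar F a (X ⊗ Y) := by
  rw [← cancel_mono (β_ X Y).hom, BraidedCategory.braiding_naturality_right, scalar_whiskerRight,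
    scalar_natural]

/-- Scalars of `T` act on every object by tensoring with an endomorphism of the unit, and a monoidal
functor respects this description. -/
theorem map_smul_id (a : k) (X : T) : F.map (a • 𝟙 X) = scalar F a (F.obj X) := by
  have h : a • 𝟙 X = (λ_ X).inv ≫ (a • 𝟙 (𝟙_ T)) ▷ X ≫ (λ_ X).hom := by simp
  rw [h, scalar]
  simp only [Functor.map_comp, Functor.Monoidal.map_leftUnitor, Functor.Monoidal.map_leftUnitor_inv,
    Functor.Monoidal.map_whiskerRight, comp_whiskerRight, Category.assoc]
  simp

variable (k) in
/-- A preadditive symmetric monoidal category with a monoidal functor from a linear category is linear. -/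
abbrev linearOfFunctor : Linear k C where
  homModule X Y :=
    { smul := fun a f => scalar F a X ≫ f
      one_smul := fun f => by change scalar F 1 X ≫ f = f; rw [scalar_one, Category.id_comp]
      mul_smul := fun a b f => by
        change scalar F (a * b) X ≫ f = scalar F a X ≫ scalar F b X ≫ f
        rw [scalar_mul, Category.assoc]
      smul_zero := fun a => comp_zero
      smul_add := fun a f g => Preadditive.comp_add _ _ _ _ _ _
      add_smul := fun a b f => by
        change scalar F (a + b) X ≫ f = scalar F a X ≫ f + scalar F b X ≫ f
        rw [scalar_add, Preadditive.add_comp]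
      zero_smul := fun f => by
        change scalar F 0 X ≫ f = 0
        rw [scalar_zero, zero_comp] }
  smul_comp X Y Z a f g := Category.assoc _ _ _
  comp_smul X Y Z f a g := ((reassoc_of% (scalar_natural F a f)) g).symm

theorem monoidalLinear_linearOfFunctor : letI := linearOfFunctor k F; MonoidalLinear k C :=
  letI := linearOfFunctor k F
  { whiskerLeft_smul := fun X Y Z a f => by
      change X ◁ (scalar F a Y ≫ f) = scalar F a (X ⊗ Y) ≫ X ◁ f
      rw [MonoidalCategory.whiskerLeft_comp, whiskerLeft_scalar]
    smul_whiskerRight := fun a Y Z f X => by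
      change (scalar F a Y ≫ f) ▷ X = scalar F a (Y ⊗ X) ≫ f ▷ X
      rw [comp_whiskerRight, scalar_whiskerRight] }

theorem linear_linearOfFunctor : letI := linearOfFunctor k F; F.Linear k :=
  letI := linearOfFunctor k F
  { map_smul := fun {X Y} f a => by
      change F.map (a • f) = scalar F a (F.obj X) ≫ F.map f
      rw [← map_smul_id, ← F.map_comp, Linear.smul_comp, Category.id_comp] }

end LinearOfFunctor

/-! ### The tensor functor attached to an algebra -/

section TrivializedOfAlgebra

theorem preservesFiniteColimits_tensorLeft (k : Type w) [Field k] (T : Type u) [Category.{v} T]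
    [Abelian T] [Linear k T] [MonoidalCategory T] [SymmetricCategory T] [IsTensorCategory k T] :
    ∀ X : T, PreservesFiniteColimits (tensorLeft X) :=
  RightExactSymMonoidal.rightExact_left k

attribute [local instance] Abelian.hasFiniteBiproducts

variable (k : Type w) [Field k] {T : Type u} [Category.{v} T] [Abelian T] [Linear k T]
  [MonoidalCategory T] [SymmetricCategory T] [IsTensorCategory k T]

/-- If `X` becomes trivial over an algebra, it is trivialised by the functor to modules. -/
theorem trivialized_of_algebra (X : T) {A : Ind T} [MonObj A] [IsCommMonObj A] (hA : ¬ IsZero A)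
    (m : ℕ) (e : (AMod.free A).obj (Ind.yoneda.obj X) ≅
      (AMod.free A).obj (Ind.yoneda.obj (⨁ fun _ : Fin m => 𝟙_ T))) :
    TrivializedByTensorFunctor.{w, v, u, v, max u (v + 1)} k X := by
  have h1 : ∀ X : T, PreservesFiniteColimits (tensorLeft X) := preservesFiniteColimits_tensorLeft k T
  have h2 : ∀ A : Ind T, PreservesFiniteColimits (tensorLeft A) := fun A => inferInstance
  have : PreservesFiniteColimits (AMod.free A) := ⟨fun J _ _ =>
    (AMod.freeAdj A).leftAdjoint_preservesColimits.preservesColimitsOfShape⟩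
  let F : T ⥤ AMod A := Ind.yoneda ⋙ AMod.free A
  have : PreservesFiniteColimits F := comp_preservesFiniteColimits _ _
  have : F.Additive := additive_of_preservesFiniteColimits F
  let : F.Braided := inferInstanceAs (Ind.yoneda ⋙ AMod.free A).Braided
  let := linearOfFunctor k F
  have := monoidalLinear_linearOfFunctor (k := k) F
  have := linear_linearOfFunctor (k := k) F
  have hR : RightExactSymMonoidal k (AMod A) :=
    { unit_ne_zero := by rwa [AMod.unit_isZero_iff]
      rightExact_left := fun X => inferInstance
      rightExact_right := fun X => inferInstance }
  refine ⟨AMod A, inferInstance, inferInstance, inferInstance, inferInstance, inferInstance, hR,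
    F, inferInstance, inferInstance, inferInstance, inferInstance, m, ⟨?_⟩⟩
  exact e ≪≫ F.mapBiproduct _ ≪≫ biproduct.mapIso fun _ => (Functor.Monoidal.εIso F).symm

end TrivializedOfAlgebra

/-! ### Tensor powers of morphisms and the symmetric group action -/

section PermInduction

theorem perm_induction {n : ℕ} {p : Equiv.Perm (Fin n) → Prop} (h1 : p 1)
    (hs : ∀ (i : ℕ) (h : i + 1 < n), p (Equiv.swap ⟨i, Nat.lt_of_succ_lt h⟩ ⟨i + 1, h⟩))
    (hm : ∀ σ τ, p σ → p τ → p (σ * τ)) (σ : Equiv.Perm (Fin n)) : p σ := by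
  cases n with
  | zero => rwa [Subsingleton.elim σ 1]
  | succ n =>
    have hσ : σ ∈ Submonoid.closure (Set.range fun i : Fin n => Equiv.swap i.castSucc i.succ) := by
      rw [Equiv.Perm.mclosure_swap_castSucc_succ]; trivial
    refine Submonoid.closure_induction (motive := fun σ _ => p σ) ?_ h1 (fun σ τ _ _ => hm σ τ) hσ
    rintro _ ⟨i, rfl⟩
    exact hs i.val (Nat.succ_lt_succ i.isLt)

end PermInduction

section TensorPowMap

variable {C : Type u} [Category.{v} C] [MonoidalCategory C]

/-- The tensor power of a morphism. -/
def tensorPowMap {X Y : C} (f : X ⟶ Y) : (n : ℕ) → (tensorPow X n ⟶ tensorPow Y n)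
  | 0 => 𝟙 _
  | n + 1 => f ⊗ₘ tensorPowMap f n

theorem tensorPowMap_comp {X Y Z : C} (f : X ⟶ Y) (g : Y ⟶ Z) :
    ∀ n, tensorPowMap (f ≫ g) n = tensorPowMap f n ≫ tensorPowMap g n
  | 0 => (Category.comp_id _).symm
  | n + 1 => by
    change (f ≫ g) ⊗ₘ tensorPowMap (f ≫ g) n = (f ⊗ₘ tensorPowMap f n) ≫ (g ⊗ₘ tensorPowMap g n)
    rw [tensorPowMap_comp f g n, tensorHom_comp_tensorHom]

theorem tensorPowMap_id (X : C) : ∀ n, tensorPowMap (𝟙 X) n = 𝟙 _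
  | 0 => rfl
  | n + 1 => by
    change 𝟙 X ⊗ₘ tensorPowMap (𝟙 X) n = 𝟙 _
    rw [tensorPowMap_id X n, id_tensorHom_id]

variable [SymmetricCategory C]

theorem adjSwap_natural {X Y : C} (f : X ⟶ Y) : ∀ i n,
    adjSwap X i n ≫ tensorPowMap f n = tensorPowMap f n ≫ adjSwap Y i n
  | 0, 0 => (Category.id_comp _).trans (Category.comp_id _).symm
  | 0, 1 => (Category.id_comp _).trans (Category.comp_id _).symm
  | 0, n + 2 => by
    change ((α_ X X (tensorPow X n)).inv ≫ (β_ X X).hom ▷ tensorPow X n ≫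
      (α_ X X (tensorPow X n)).hom) ≫ (f ⊗ₘ (f ⊗ₘ tensorPowMap f n)) =
        (f ⊗ₘ (f ⊗ₘ tensorPowMap f n)) ≫ (α_ Y Y (tensorPow Y n)).inv ≫ (β_ Y Y).hom ▷ tensorPow Y n ≫
      (α_ Y Y (tensorPow Y n)).hom
    rw [associator_inv_naturality_assoc, Category.assoc, Category.assoc, ← associator_naturality,
      ← tensorHom_id, ← tensorHom_id, tensorHom_comp_tensorHom_assoc, tensorHom_comp_tensorHom_assoc,
      BraidedCategory.braiding_naturality, Category.id_comp, Category.comp_id]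
  | i + 1, 0 => (Category.id_comp _).trans (Category.comp_id _).symm
  | i + 1, n + 1 => by
    change X ◁ adjSwap X i n ≫ (f ⊗ₘ tensorPowMap f n) = (f ⊗ₘ tensorPowMap f n) ≫ Y ◁ adjSwap Y i n
    rw [← id_tensorHom, ← id_tensorHom, tensorHom_comp_tensorHom, tensorHom_comp_tensorHom,
      adjSwap_natural f i n, Category.id_comp, Category.comp_id]

/-- The product in `End` is composition in the opposite order, whence the reversal. -/
theorem permAction_mul (X : C) {n : ℕ} (σ τ : Equiv.Perm (Fin n)) :
    End.asHom (permAction X n (σ * τ)) = End.asHom (permAction X n τ) ≫ End.asHom (permAction X n σ) := by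
  rw [map_mul]
  rfl

theorem permAction_one (X : C) (n : ℕ) : End.asHom (permAction X n 1) = 𝟙 _ := by
  rw [map_one]
  rfl

theorem asHom_permAction_swap (X : C) (n i : ℕ) (h : i + 1 < n) :
    End.asHom (permAction X n (Equiv.swap ⟨i, Nat.lt_of_succ_lt h⟩ ⟨i + 1, h⟩)) = adjSwap X i n :=
  permAction_swap X n i h

theorem permAction_natural {X Y : C} (f : X ⟶ Y) (n : ℕ) (σ : Equiv.Perm (Fin n)) :
    End.asHom (permAction X n σ) ≫ tensorPowMap f n = tensorPowMap f n ≫ End.asHom (permAction Y n σ) := by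
  induction σ using perm_induction with
  | h1 => rw [permAction_one, permAction_one, Category.id_comp, Category.comp_id]
  | hs i h => rw [asHom_permAction_swap, asHom_permAction_swap, adjSwap_natural]
  | hm σ τ hσ hτ => rw [permAction_mul, permAction_mul, Category.assoc, hσ, reassoc_of% hτ]

theorem antisymmetrizer_natural [Abelian C] {X Y : C} (f : X ⟶ Y) (n : ℕ) :
    antisymmetrizer X n ≫ tensorPowMap f n = tensorPowMap f n ≫ antisymmetrizer Y n := by
  simp only [antisymmetrizer, Preadditive.sum_comp, Preadditive.comp_sum, Preadditive.zsmul_comp,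
    Preadditive.comp_zsmul, permAction_natural]

end TensorPowMap

/-! ### Tensor powers of copairings -/

section Pairings

variable {C : Type u} [Category.{v} C] [MonoidalCategory C] [SymmetricCategory C]

/-- The tensor product of copairings. -/
def pairTensor {A A' B B' : C} (c : 𝟙_ C ⟶ A' ⊗ A) (d : 𝟙_ C ⟶ B' ⊗ B) :
    𝟙_ C ⟶ (A' ⊗ B') ⊗ (A ⊗ B) :=
  (λ_ (𝟙_ C)).inv ≫ (c ⊗ₘ d) ≫ tensorμ A' A B' B

/-- The tensor powers of a copairing. -/
def pairPow {X X' : C} (c : 𝟙_ C ⟶ X' ⊗ X) : (n : ℕ) → (𝟙_ C ⟶ tensorPow X' n ⊗ tensorPow X n)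
  | 0 => (λ_ (𝟙_ C)).inv
  | n + 1 => pairTensor c (pairPow c n)

theorem pairTensor_comp {A A' B B' A₁ A₁' B₁ B₁' : C} (c : 𝟙_ C ⟶ A' ⊗ A) (d : 𝟙_ C ⟶ B' ⊗ B)
    (f' : A' ⟶ A₁') (f : A ⟶ A₁) (g' : B' ⟶ B₁') (g : B ⟶ B₁) :
    pairTensor c d ≫ ((f' ⊗ₘ g') ⊗ₘ (f ⊗ₘ g)) = pairTensor (c ≫ (f' ⊗ₘ f)) (d ≫ (g' ⊗ₘ g)) := by
  simp only [pairTensor, Category.assoc]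
  rw [← tensorμ_natural, tensorHom_comp_tensorHom_assoc]

theorem pairPow_comp {X X' Y Y' : C} (c : 𝟙_ C ⟶ X' ⊗ X) (f' : X' ⟶ Y') (f : X ⟶ Y) :
    ∀ n, pairPow c n ≫ (tensorPowMap f' n ⊗ₘ tensorPowMap f n) = pairPow (c ≫ (f' ⊗ₘ f)) n
  | 0 => by
    change (λ_ (𝟙_ C)).inv ≫ (𝟙 _ ⊗ₘ 𝟙 _) = (λ_ (𝟙_ C)).inv
    simp
  | n + 1 => by
    change pairTensor c (pairPow c n) ≫ ((f' ⊗ₘ tensorPowMap f' n) ⊗ₘ (f ⊗ₘ tensorPowMap f n)) =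
      pairTensor (c ≫ (f' ⊗ₘ f)) (pairPow (c ≫ (f' ⊗ₘ f)) n)
    rw [pairTensor_comp, pairPow_comp c f' f n]

theorem pairTensor_assoc {A A' B B' D D' : C} (c : 𝟙_ C ⟶ A' ⊗ A) (d : 𝟙_ C ⟶ B' ⊗ B)
    (e : 𝟙_ C ⟶ D' ⊗ D) : pairTensor c (pairTensor d e) ≫ ((α_ A' B' D').inv ⊗ₘ (α_ A B D).inv) =
      pairTensor (pairTensor c d) e := by
  have h : (α_ _ _ _).inv ≫ tensorμ A' A B' B ▷ (D' ⊗ D) ≫ tensorμ (A' ⊗ B') (A ⊗ B) D' D =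
      ((A' ⊗ A) ◁ tensorμ B' B D' D) ≫ tensorμ A' A (B' ⊗ D') (B ⊗ D) ≫
        ((α_ A' B' D').inv ⊗ₘ (α_ A B D).inv) := by
    rw [Iso.inv_comp_eq, ← reassoc_of% tensor_associativity, tensorHom_comp_tensorHom,
      Iso.hom_inv_id, Iso.hom_inv_id, id_tensorHom_id, Category.comp_id]
  have h1 : (c ⊗ₘ ((λ_ (𝟙_ C)).inv ≫ (d ⊗ₘ e) ≫ tensorμ B' B D' D)) =
      (𝟙_ C ◁ (λ_ (𝟙_ C)).inv) ≫ (c ⊗ₘ (d ⊗ₘ e)) ≫ ((A' ⊗ A) ◁ tensorμ B' B D' D) := by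
    rw [← id_tensorHom, ← id_tensorHom, tensorHom_comp_tensorHom, tensorHom_comp_tensorHom,
      Category.id_comp, Category.comp_id]
  have h2 : (((λ_ (𝟙_ C)).inv ≫ (c ⊗ₘ d) ≫ tensorμ A' A B' B) ⊗ₘ e) =
      ((λ_ (𝟙_ C)).inv ▷ 𝟙_ C) ≫ ((c ⊗ₘ d) ⊗ₘ e) ≫ (tensorμ A' A B' B ▷ (D' ⊗ D)) := by
    rw [← tensorHom_id, ← tensorHom_id, tensorHom_comp_tensorHom, tensorHom_comp_tensorHom,
      Category.id_comp, Category.comp_id]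
  simp only [pairTensor, Category.assoc]
  rw [h1, h2]
  simp only [Category.assoc]
  rw [← h, associator_inv_naturality_assoc]
  congr 1
  simp only [← Category.assoc]
  congr 4
  monoidal

theorem tensorμ_tensorμ (A B D E : C) : tensorμ A B D E ≫ tensorμ A D B E = 𝟙 _ := by
  have h : tensorμ A D B E = tensorδ A B D E := by
    simp [tensorμ, tensorδ, SymmetricCategory.braiding_swap_eq_inv_braiding B D]
  rw [h, tensorμ_tensorδ]

theorem tensorμ_braiding_tensorHom (A B D E : C) :
    tensorμ A B D E ≫ ((β_ A D).hom ⊗ₘ (β_ B E).hom) = (β_ (A ⊗ B) (D ⊗ E)).hom ≫ tensorμ D E A B := by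
  have h : tensorμ A D B E ≫ (β_ (A ⊗ B) (D ⊗ E)).hom =
      ((β_ A D).hom ⊗ₘ (β_ B E).hom) ≫ tensorμ D A E B := by
    simp [tensorμ, SymmetricCategory.braiding_swap_eq_inv_braiding B D,
      SymmetricCategory.braiding_swap_eq_inv_braiding E A, MonoidalCategory.tensorHom_def]
  rw [← (reassoc_of% (tensorμ_tensorμ A B D E)) ((β_ (A ⊗ B) (D ⊗ E)).hom ≫ _), reassoc_of% h,
    tensorμ_tensorμ, Category.comp_id]

theorem pairTensor_braiding {A A' B B' : C} (c : 𝟙_ C ⟶ A' ⊗ A) (d : 𝟙_ C ⟶ B' ⊗ B) :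
    pairTensor c d ≫ ((β_ A' B').hom ⊗ₘ (β_ A B).hom) = pairTensor d c := by
  have h := tensorμ_braiding_tensorHom A' A B' B
  have h1 : (β_ (𝟙_ C) (𝟙_ C)).hom = 𝟙 _ := by simp [unitors_inv_equal]
  simp only [pairTensor, Category.assoc, h]
  rw [BraidedCategory.braiding_naturality_assoc, h1, Category.id_comp]

theorem pairPow_adjSwap {X X' : C} (c : 𝟙_ C ⟶ X' ⊗ X) : ∀ i n,
    pairPow c n ≫ (adjSwap X' i n ⊗ₘ adjSwap X i n) = pairPow c n
  | 0, 0 => (congrArg _ (id_tensorHom_id _ _)).trans (Category.comp_id _)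
  | 0, 1 => (congrArg _ (id_tensorHom_id _ _)).trans (Category.comp_id _)
  | 0, n + 2 => by
    change pairTensor c (pairTensor c (pairPow c n)) ≫
      (((α_ _ _ _).inv ≫ (β_ X' X').hom ▷ _ ≫ (α_ _ _ _).hom) ⊗ₘ
        ((α_ _ _ _).inv ≫ (β_ X X).hom ▷ _ ≫ (α_ _ _ _).hom)) =
          pairTensor c (pairTensor c (pairPow c n))
    rw [← tensorHom_comp_tensorHom, ← tensorHom_comp_tensorHom, reassoc_of% pairTensor_assoc c c,
      ← tensorHom_id, ← tensorHom_id, reassoc_of% pairTensor_comp, pairTensor_braiding,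
      id_tensorHom_id, Category.comp_id, ← pairTensor_assoc, Category.assoc,
      tensorHom_comp_tensorHom, Iso.inv_hom_id, Iso.inv_hom_id, id_tensorHom_id, Category.comp_id]
  | i + 1, 0 => (congrArg _ (id_tensorHom_id _ _)).trans (Category.comp_id _)
  | i + 1, n + 1 => by
    change pairTensor c (pairPow c n) ≫ (X' ◁ adjSwap X' i n ⊗ₘ X ◁ adjSwap X i n) =
      pairTensor c (pairPow c n)
    rw [← id_tensorHom, ← id_tensorHom, pairTensor_comp, id_tensorHom_id, Category.comp_id,
      pairPow_adjSwap c i n]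

/-- Interchanging adjacent factors on both sides at once interchanges two equal copies of `c`; such
transpositions generate. -/
theorem pairPow_permAction {X X' : C} (c : 𝟙_ C ⟶ X' ⊗ X) (n : ℕ) (σ : Equiv.Perm (Fin n)) :
    pairPow c n ≫ (End.asHom (permAction X' n σ) ⊗ₘ End.asHom (permAction X n σ)) = pairPow c n := by
  induction σ using perm_induction with
  | h1 => rw [permAction_one, permAction_one, id_tensorHom_id, Category.comp_id]
  | hs i h => rw [asHom_permAction_swap, asHom_permAction_swap, pairPow_adjSwap]
  | hm σ τ hσ hτ =>
    rw [permAction_mul, permAction_mul, ← tensorHom_comp_tensorHom, reassoc_of% hτ, hσ]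

end Pairings

/-! ### Products of functionals with values in an algebra -/

section StarProduct

open Functor.OplaxMonoidal Functor.LaxMonoidal

variable {T : Type u} [Category.{v} T] [MonoidalCategory T] [SymmetricCategory T]
  {C : Type u₂} [Category.{v₂} C] [MonoidalCategory C] [SymmetricCategory C] (F : T ⥤ C) [F.Braided]
  {S : C} [MonObj S]

variable {F} in
/-- The product of two morphisms to an algebra. -/
def star {A B : T} (f : F.obj A ⟶ S) (g : F.obj B ⟶ S) : F.obj (A ⊗ B) ⟶ S :=
  δ F A B ≫ (f ⊗ₘ g) ≫ MonObj.mul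

variable (S) in
/-- The unit for `star`. -/
def starOne : F.obj (𝟙_ T) ⟶ S := η F ≫ MonObj.one

variable {F}

theorem map_star {A B A' B' : T} (u : A' ⟶ A) (w : B' ⟶ B) (f : F.obj A ⟶ S) (g : F.obj B ⟶ S) :
    F.map (u ⊗ₘ w) ≫ star f g = star (F.map u ≫ f) (F.map w ≫ g) := by
  rw [star, star, ← tensorHom_comp_tensorHom_assoc, Functor.OplaxMonoidal.δ_natural_assoc]

theorem star_assoc {A B D : T} (f : F.obj A ⟶ S) (g : F.obj B ⟶ S) (h : F.obj D ⟶ S) :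
    F.map (α_ A B D).hom ≫ star f (star g h) = star (star f g) h := by
  have h1 : F.map (α_ A B D).hom ≫ δ F _ _ ≫ F.obj A ◁ δ F _ _ = δ F _ _ ≫ δ F _ _ ▷ F.obj D ≫
    (α_ _ _ _).hom := by simp
  have h3 : (f ⊗ₘ (δ F B D ≫ (g ⊗ₘ h) ≫ MonObj.mul)) =
      F.obj A ◁ δ F B D ≫ (f ⊗ₘ (g ⊗ₘ h)) ≫ S ◁ MonObj.mul (X := S) := by
    rw [← id_tensorHom, ← id_tensorHom, tensorHom_comp_tensorHom, tensorHom_comp_tensorHom,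
      Category.id_comp, Category.comp_id]
  have h4 : ((δ F A B ≫ (f ⊗ₘ g) ≫ MonObj.mul) ⊗ₘ h) =
      δ F A B ▷ F.obj D ≫ ((f ⊗ₘ g) ⊗ₘ h) ≫ MonObj.mul (X := S) ▷ S := by
    rw [← tensorHom_id, ← tensorHom_id, tensorHom_comp_tensorHom, tensorHom_comp_tensorHom,
      Category.id_comp, Category.comp_id]
  simp only [star]
  rw [h3, h4]
  simp only [Category.assoc]
  rw [reassoc_of% h1, MonObj.mul_assoc, associator_naturality_assoc]

theorem star_one {A : T} (f : F.obj A ⟶ S) : F.map (ρ_ A).inv ≫ star f (starOne F S) = f := by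
  have h1 : F.map (ρ_ A).inv ≫ δ F A (𝟙_ T) ≫ F.obj A ◁ η F = (ρ_ (F.obj A)).inv := by simp
  have h3 : (f ⊗ₘ (η F ≫ MonObj.one)) = F.obj A ◁ η F ≫ f ▷ 𝟙_ C ≫ S ◁ MonObj.one (X := S) := by
    rw [MonoidalCategory.tensorHom_def', MonoidalCategory.whiskerLeft_comp, Category.assoc,
      whisker_exchange]
  rw [star, starOne, h3]
  simp only [Category.assoc]
  rw [reassoc_of% h1, MonObj.mul_one, rightUnitor_naturality, Iso.inv_hom_id_assoc]

theorem star_comp {S' : C} [MonObj S'] (φ : S ⟶ S') [IsMonHom φ] {A B : T} (f : F.obj A ⟶ S)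
    (g : F.obj B ⟶ S) : star f g ≫ φ = star (f ≫ φ) (g ≫ φ) := by
  rw [star, star, Category.assoc, Category.assoc, IsMonHom.mul_hom, tensorHom_comp_tensorHom_assoc]

theorem starOne_comp {S' : C} [MonObj S'] (φ : S ⟶ S') [IsMonHom φ] :
    starOne F S ≫ φ = starOne F S' := by
  simp [starOne, IsMonHom.one_hom]

variable [IsCommMonObj S]

theorem star_comm {A B : T} (f : F.obj A ⟶ S) (g : F.obj B ⟶ S) :
    F.map (β_ A B).hom ≫ star g f = star f g := by
  have h1 : F.map (β_ A B).hom ≫ δ F _ _ = δ F _ _ ≫ (β_ _ _).hom := by simp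
  rw [star, reassoc_of% h1, ← BraidedCategory.braiding_naturality_assoc, IsCommMonObj.mul_comm, star]

theorem star_tensorμ {A B A' B' : T} (a : F.obj A ⟶ S) (b : F.obj B ⟶ S) (a' : F.obj A' ⟶ S)
    (b' : F.obj B' ⟶ S) : F.map (tensorμ A A' B B') ≫ star (star a b) (star a' b') =
      star (star a a') (star b b') := by
  have h : F.map (tensorμ A A' B B') ≫ δ F _ _ ≫ (δ F A B ⊗ₘ δ F A' B') =
      δ F _ _ ≫ (δ F A A' ⊗ₘ δ F B B') ≫ tensorμ _ _ _ _ := by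
    have h0 := tensorμ_comp_μ_tensorHom_μ_comp_μ F A A' B B'
    have e1 : (δ F A A' ⊗ₘ δ F B B') ≫ (μ F A A' ⊗ₘ μ F B B') = 𝟙 _ := by
      rw [tensorHom_comp_tensorHom, Functor.Monoidal.δ_μ, Functor.Monoidal.δ_μ, id_tensorHom_id]
    have e2 : (μ F A B ⊗ₘ μ F A' B') ≫ (δ F A B ⊗ₘ δ F A' B') = 𝟙 _ := by
      rw [tensorHom_comp_tensorHom, Functor.Monoidal.μ_δ, Functor.Monoidal.μ_δ, id_tensorHom_id]
    have h1 : F.map (tensorμ A A' B B') = δ F _ _ ≫ (δ F A A' ⊗ₘ δ F B B') ≫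
        tensorμ (F.obj A) (F.obj A') (F.obj B) (F.obj B') ≫ (μ F A B ⊗ₘ μ F A' B') ≫ μ F _ _ := by
      rw [h0, reassoc_of% e1, Functor.Monoidal.δ_μ_assoc]
    rw [h1]
    simp only [Category.assoc, Functor.Monoidal.μ_δ_assoc, e2, Category.comp_id]
  have h3 : ((δ F A B ≫ (a ⊗ₘ b) ≫ MonObj.mul) ⊗ₘ (δ F A' B' ≫ (a' ⊗ₘ b') ≫ MonObj.mul)) =
      (δ F A B ⊗ₘ δ F A' B') ≫ ((a ⊗ₘ b) ⊗ₘ (a' ⊗ₘ b')) ≫ (MonObj.mul ⊗ₘ MonObj.mul) := by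
    simp only [tensorHom_comp_tensorHom]
  have h4 : ((δ F A A' ≫ (a ⊗ₘ a') ≫ MonObj.mul) ⊗ₘ (δ F B B' ≫ (b ⊗ₘ b') ≫ MonObj.mul)) =
      (δ F A A' ⊗ₘ δ F B B') ≫ ((a ⊗ₘ a') ⊗ₘ (b ⊗ₘ b')) ≫ (MonObj.mul ⊗ₘ MonObj.mul) := by
    simp only [tensorHom_comp_tensorHom]
  simp only [star]
  rw [h3, h4]
  simp only [Category.assoc]
  rw [reassoc_of% h, ← tensorμ_natural_assoc, MonObj.mul_mul_mul_comm]

end StarProduct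

/-! ### Iterated products of functionals -/

section StarProd

variable {T : Type u} [Category.{v} T] [MonoidalCategory T] [SymmetricCategory T]
  {C : Type u₂} [Category.{v₂} C] [MonoidalCategory C] [SymmetricCategory C] {F : T ⥤ C} [F.Braided]
  {S : C} [MonObj S]

/-- The product of morphisms from `X` to an algebra, as a morphism from the tensor power of `X`. -/
def starProd {X : T} : {n : ℕ} → (Fin n → (F.obj X ⟶ S)) → (F.obj (tensorPow X n) ⟶ S)
  | 0, _ => starOne F S
  | _ + 1, f => star (f 0) (starProd fun i => f i.succ)

theorem map_tensorPowMap_starProd {X Y : T} (u : X ⟶ Y) : ∀ {n : ℕ} (f : Fin n → (F.obj Y ⟶ S)),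
    F.map (tensorPowMap u n) ≫ starProd f = starProd fun i => F.map u ≫ f i
  | 0, _ => by
    change F.map (𝟙 _) ≫ starOne F S = starOne F S
    rw [CategoryTheory.Functor.map_id, Category.id_comp]
  | n + 1, f => by
    change F.map (u ⊗ₘ tensorPowMap u n) ≫ star (f 0) (starProd fun i => f i.succ) =
      star (F.map u ≫ f 0) (starProd fun i => F.map u ≫ f i.succ)
    rw [map_star, map_tensorPowMap_starProd u]

theorem starProd_comp {S' : C} [MonObj S'] (φ : S ⟶ S') [IsMonHom φ] {X : T} :
    ∀ {n : ℕ} (f : Fin n → (F.obj X ⟶ S)), starProd f ≫ φ = starProd fun i => f i ≫ φ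
  | 0, _ => starOne_comp φ
  | n + 1, f => by
    change star (f 0) (starProd fun i => f i.succ) ≫ φ =
      star (f 0 ≫ φ) (starProd fun i => f i.succ ≫ φ)
    rw [star_comp, starProd_comp φ]

variable [IsCommMonObj S]

theorem map_adjSwap_starProd {X : T} : ∀ {n : ℕ} (i : ℕ) (h : i + 1 < n) (f : Fin n → (F.obj X ⟶ S)),
    F.map (adjSwap X i n) ≫ starProd f =
      starProd (f ∘ Equiv.swap ⟨i, Nat.lt_of_succ_lt h⟩ ⟨i + 1, h⟩)
  | n + 2, 0, h, f => by
    have e0 : (Equiv.swap ⟨0, Nat.lt_of_succ_lt h⟩ ⟨0 + 1, h⟩ : Equiv.Perm (Fin (n + 2))) 0 = 1 :=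
      Equiv.swap_apply_left _ _
    have e1 : (Equiv.swap ⟨0, Nat.lt_of_succ_lt h⟩ ⟨0 + 1, h⟩ : Equiv.Perm (Fin (n + 2)))
        (Fin.succ 0) = 0 := Equiv.swap_apply_right _ _
    have e2 : ∀ k : Fin n, (Equiv.swap ⟨0, Nat.lt_of_succ_lt h⟩ ⟨0 + 1, h⟩ : Equiv.Perm (Fin (n + 2)))
        k.succ.succ = k.succ.succ := fun k =>
      Equiv.swap_apply_of_ne_of_ne (by simp [Fin.ext_iff]) (by simp [Fin.ext_iff])
    change F.map ((α_ X X (tensorPow X n)).inv ≫ (β_ X X).hom ▷ tensorPow X n ≫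
      (α_ X X (tensorPow X n)).hom) ≫ star (f 0) (star (f 1) (starProd fun i => f i.succ.succ)) =
      star (f _) (star (f _) (starProd fun i => f _))
    rw [e0, e1]
    simp only [e2]
    rw [Functor.map_comp, Functor.map_comp, Category.assoc, Category.assoc, star_assoc,
      ← tensorHom_id, map_star, star_comm, CategoryTheory.Functor.map_id, Category.id_comp,
      ← star_assoc, ← Functor.map_comp_assoc, Iso.inv_hom_id, CategoryTheory.Functor.map_id,
      Category.id_comp]
  | n + 1, i + 1, h, f => by
    have e0 : (Equiv.swap ⟨i + 1, Nat.lt_of_succ_lt h⟩ ⟨i + 1 + 1, h⟩ : Equiv.Perm (Fin (n + 1))) 0 = 0 :=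
      Equiv.swap_apply_of_ne_of_ne (by simp [Fin.ext_iff]) (by simp [Fin.ext_iff])
    have e1 : ∀ k : Fin n, (Equiv.swap ⟨i + 1, Nat.lt_of_succ_lt h⟩ ⟨i + 1 + 1, h⟩ :
        Equiv.Perm (Fin (n + 1))) k.succ = Fin.succ ((Equiv.swap ⟨i, Nat.lt_of_succ_lt
          (Nat.lt_of_succ_lt_succ h)⟩ ⟨i + 1, Nat.lt_of_succ_lt_succ h⟩ : Equiv.Perm (Fin n)) k) := by
      intro k
      simp only [Equiv.swap_apply_def, Fin.ext_iff]
      split_ifs <;> simp_all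
    change F.map (X ◁ adjSwap X i n) ≫ star (f 0) (starProd fun i => f i.succ) =
      star (f _) (starProd fun i => f _)
    rw [e0]
    simp only [e1]
    rw [← id_tensorHom, map_star, map_adjSwap_starProd i (Nat.lt_of_succ_lt_succ h),
      CategoryTheory.Functor.map_id, Category.id_comp]
    rfl

/-- In a commutative algebra the order of multiplication is immaterial, so permuting tensor
positions only reindexes the family. -/
theorem map_permAction_starProd {X : T} {n : ℕ} (σ : Equiv.Perm (Fin n)) (f : Fin n → (F.obj X ⟶ S)) :
    F.map (End.asHom (permAction X n σ)) ≫ starProd f = starProd (f ∘ σ) := by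
  induction σ using perm_induction generalizing f with
  | h1 => rw [permAction_one, CategoryTheory.Functor.map_id, Category.id_comp]; rfl
  | hs i h => rw [asHom_permAction_swap, map_adjSwap_starProd i h]
  | hm σ τ hσ hτ => rw [permAction_mul, Functor.map_comp, Category.assoc, hσ, hτ]; rfl

end StarProd

/-! ### The ring of sections and the pairing of functionals -/

section Sections

open Functor.OplaxMonoidal Functor.LaxMonoidal

variable {T : Type u} [Category.{v} T] [MonoidalCategory T] [SymmetricCategory T]
  {C : Type u₂} [Category.{v₂} C] [Preadditive C] [MonoidalCategory C] [SymmetricCategory C]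
  [MonoidalPreadditive C] {F : T ⥤ C} [F.Braided] {S : C} [MonObj S]

theorem add_star {A B : T} (f f' : F.obj A ⟶ S) (g : F.obj B ⟶ S) :
    star (f + f') g = star f g + star f' g := by
  simp only [star, MonoidalPreadditive.add_tensor, Preadditive.add_comp, Preadditive.comp_add]

theorem star_add {A B : T} (f : F.obj A ⟶ S) (g g' : F.obj B ⟶ S) :
    star f (g + g') = star f g + star f g' := by
  simp only [star, MonoidalPreadditive.tensor_add, Preadditive.add_comp, Preadditive.comp_add]

/-- `star f` as an additive map. -/
def starHom {A : T} (B : T) (f : F.obj A ⟶ S) : (F.obj B ⟶ S) →+ (F.obj (A ⊗ B) ⟶ S) where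
  toFun := star f
  map_zero' := by simpa using star_add f (0 : F.obj B ⟶ S) 0
  map_add' := star_add f

theorem zero_star {A B : T} (g : F.obj B ⟶ S) : star (0 : F.obj A ⟶ S) g = 0 := by
  simpa using add_star (0 : F.obj A ⟶ S) 0 g

theorem star_zero {A B : T} (f : F.obj A ⟶ S) : star f (0 : F.obj B ⟶ S) = 0 :=
  (starHom B f).map_zero

theorem star_sum {A B : T} {ι : Type*} (s : Finset ι) (f : F.obj A ⟶ S) (g : ι → (F.obj B ⟶ S)) :
    star f (∑ i ∈ s, g i) = ∑ i ∈ s, star f (g i) :=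
  map_sum (starHom B f) g s

theorem star_zsmul {A B : T} (f : F.obj A ⟶ S) (z : ℤ) (g : F.obj B ⟶ S) :
    star f (z • g) = z • star f g :=
  map_zsmul (starHom B f) z g

variable [IsCommMonObj S]

/-- The global sections of a commutative algebra form a commutative ring. -/
instance sectionsRing : CommRing (F.obj (𝟙_ T) ⟶ S) :=
  have hc : ∀ a b : F.obj (𝟙_ T) ⟶ S, F.map (λ_ (𝟙_ T)).inv ≫ star a b =
      F.map (λ_ (𝟙_ T)).inv ≫ star b a := fun a b => by
    have h1 : (β_ (𝟙_ T) (𝟙_ T)).hom = 𝟙 _ := by simp [unitors_inv_equal]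
    have h2 := star_comm a b
    rw [h1, CategoryTheory.Functor.map_id, Category.id_comp] at h2
    rw [h2]
  have ho : ∀ a : F.obj (𝟙_ T) ⟶ S, F.map (λ_ (𝟙_ T)).inv ≫ star a (starOne F S) = a := fun a => by
    have h := star_one a
    rwa [← unitors_inv_equal] at h
  { (inferInstance : AddCommGroup (F.obj (𝟙_ T) ⟶ S)) with
    mul := fun a b => F.map (λ_ (𝟙_ T)).inv ≫ star a b
    one := starOne F S
    mul_assoc := fun a b c => by
      change F.map (λ_ (𝟙_ T)).inv ≫ star (F.map (λ_ (𝟙_ T)).inv ≫ star a b) c =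
        F.map (λ_ (𝟙_ T)).inv ≫ star a (F.map (λ_ (𝟙_ T)).inv ≫ star b c)
      have e1 : star (F.map (λ_ (𝟙_ T)).inv ≫ star a b) c =
          F.map ((λ_ (𝟙_ T)).inv ⊗ₘ 𝟙 _) ≫ star (star a b) c := by
        rw [map_star, CategoryTheory.Functor.map_id, Category.id_comp]
      have e2 : star a (F.map (λ_ (𝟙_ T)).inv ≫ star b c) =
          F.map (𝟙 _ ⊗ₘ (λ_ (𝟙_ T)).inv) ≫ star a (star b c) := by
        rw [map_star, CategoryTheory.Functor.map_id, Category.id_comp]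
      rw [e1, e2, ← star_assoc, ← Functor.map_comp_assoc, ← Functor.map_comp_assoc,
        ← Functor.map_comp_assoc]
      congr 2
      monoidal
    one_mul := fun a => (hc _ _).trans (ho a)
    mul_one := ho
    mul_comm := hc
    zero_mul := fun a => by
      change F.map (λ_ (𝟙_ T)).inv ≫ star 0 a = 0
      rw [zero_star, comp_zero]
    mul_zero := fun a => by
      change F.map (λ_ (𝟙_ T)).inv ≫ star a 0 = 0
      rw [star_zero, comp_zero]
    left_distrib := fun a b c => by
      change F.map (λ_ (𝟙_ T)).inv ≫ star a (b + c) = F.map (λ_ (𝟙_ T)).inv ≫ star a b +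
        F.map (λ_ (𝟙_ T)).inv ≫ star a c
      rw [star_add, Preadditive.comp_add]
    right_distrib := fun a b c => by
      change F.map (λ_ (𝟙_ T)).inv ≫ star (a + b) c = F.map (λ_ (𝟙_ T)).inv ≫ star a c +
        F.map (λ_ (𝟙_ T)).inv ≫ star b c
      rw [add_star, Preadditive.comp_add]
    zsmul := fun z a => z • a
    zsmul_zero' := fun a => zero_smul ℤ a
    zsmul_succ' := fun n a => SubNegMonoid.zsmul_succ' n a
    zsmul_neg' := fun n a => SubNegMonoid.zsmul_neg' n a }

theorem sections_mul_def (a b : F.obj (𝟙_ T) ⟶ S) : a * b = F.map (λ_ (𝟙_ T)).inv ≫ star a b := rfl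

theorem sections_one_def : (1 : F.obj (𝟙_ T) ⟶ S) = starOne F S := rfl

/-- The value of a copairing on a pair of morphisms to an algebra. -/
def contract {A A' : T} (c : 𝟙_ T ⟶ A' ⊗ A) (a : F.obj A' ⟶ S) (b : F.obj A ⟶ S) :
    F.obj (𝟙_ T) ⟶ S :=
  F.map c ≫ star a b

theorem contract_comp {A A' B B' : T} (c : 𝟙_ T ⟶ A' ⊗ A) (f' : A' ⟶ B') (f : A ⟶ B)
    (a : F.obj B' ⟶ S) (b : F.obj B ⟶ S) :
    contract (c ≫ (f' ⊗ₘ f)) a b = contract c (F.map f' ≫ a) (F.map f ≫ b) := by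
  rw [contract, contract, Functor.map_comp, Category.assoc, map_star]

/-- The interchange law `star_tensorμ` undoes the shuffle in `pairTensor`; it needs commutativity of
`S`. -/
theorem contract_pairTensor {A A' B B' : T} (c : 𝟙_ T ⟶ A' ⊗ A) (d : 𝟙_ T ⟶ B' ⊗ B)
    (a : F.obj A' ⟶ S) (b : F.obj A ⟶ S) (a' : F.obj B' ⟶ S) (b' : F.obj B ⟶ S) :
    contract (pairTensor c d) (star a a') (star b b') = contract c a b * contract d a' b' := by
  rw [contract, pairTensor, Functor.map_comp, Functor.map_comp, Category.assoc, Category.assoc,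
    star_tensorμ, map_star, sections_mul_def, contract, contract]

theorem contract_pairPow {X X' : T} (c : 𝟙_ T ⟶ X' ⊗ X) : ∀ {n : ℕ} (a : Fin n → (F.obj X' ⟶ S))
    (b : Fin n → (F.obj X ⟶ S)),
    contract (pairPow c n) (starProd a) (starProd b) = ∏ i, contract c (a i) (b i)
  | 0, a, b => (mul_one (1 : F.obj (𝟙_ T) ⟶ S))
  | n + 1, a, b => by
    rw [Fin.prod_univ_succ, ← contract_pairPow c]
    exact contract_pairTensor c (pairPow c n) _ _ _ _

end Sections

/-! ### Antisymmetrisers and determinants -/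

section Determinant

variable {T : Type u} [Category.{v} T] [Abelian T] [MonoidalCategory T] [SymmetricCategory T]
  {C : Type u₂} [Category.{v₂} C] [Preadditive C] [MonoidalCategory C] [SymmetricCategory C]
  [MonoidalPreadditive C] {F : T ⥤ C} [F.Braided] [F.Additive] {S : C} [MonObj S] [IsCommMonObj S]

theorem map_antisymmetrizer_starProd {X : T} {n : ℕ} (f : Fin n → (F.obj X ⟶ S)) :
    F.map (antisymmetrizer X n) ≫ starProd f =
      ∑ σ : Equiv.Perm (Fin n), ((Equiv.Perm.sign σ : ℤˣ) : ℤ) • starProd (f ∘ σ) := by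
  simp only [antisymmetrizer, Functor.map_sum, Functor.map_zsmul, Preadditive.sum_comp,
    Preadditive.zsmul_comp, map_permAction_starProd]

/-- Pairing is multiplicative, so the term of a permutation `σ` is the signed product of the
pairings of `a k` with `b (σ k)`: the sum is the Leibniz expansion. -/
theorem contract_antisymmetrizer {X X' : T} (c : 𝟙_ T ⟶ X' ⊗ X) {n : ℕ} (a : Fin n → (F.obj X' ⟶ S))
    (b : Fin n → (F.obj X ⟶ S)) :
    contract (pairPow c n) (starProd a) (F.map (antisymmetrizer X n) ≫ starProd b) =
      (Matrix.of fun i k => contract c (a k) (b i)).det := by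
  rw [map_antisymmetrizer_starProd, Matrix.det_apply, contract, star_sum, Preadditive.comp_sum]
  refine Finset.sum_congr rfl fun σ _ => ?_
  rw [star_zsmul, Preadditive.comp_zsmul]
  change _ • contract (pairPow c n) (starProd a) (starProd (b ∘ σ)) = _
  rw [contract_pairPow]
  rfl

end Determinant

/-! ### Coevaluations and duality -/

section Coevaluations

variable {C : Type u} [Category.{v} C] [MonoidalCategory C]

/-- A copairing is a coevaluation if it is part of an exact pairing. -/
def IsCoevaluation {A' A : C} (c : 𝟙_ C ⟶ A' ⊗ A) : Prop :=
  ∃ P : ExactPairing A' A, @ExactPairing.coevaluation _ _ _ A' A P = c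

/-- Composing with a coevaluation is the duality bijection between maps `A ⟶ Z` and maps `𝟙_ C ⟶ A'
⊗ Z`, hence injective. -/
theorem IsCoevaluation.eq_zero [Preadditive C] [MonoidalPreadditive C] {A' A Z : C}
    {c : 𝟙_ C ⟶ A' ⊗ A} (hc : IsCoevaluation c)
    (f : A ⟶ Z) (h : c ≫ (𝟙 A' ⊗ₘ f) = 0) : f = 0 := by
  obtain ⟨P, rfl⟩ := hc
  have h1 := tensorLeftHomEquiv_symm_coevaluation_comp_whiskerLeft (Y := A') f
  have h2 := tensorLeftHomEquiv_symm_coevaluation_comp_whiskerLeft (Y := A') (0 : A ⟶ Z)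
  rw [id_tensorHom] at h
  rw [h] at h1
  rw [MonoidalPreadditive.whiskerLeft_zero, comp_zero, h1] at h2
  exact (cancel_epi (ρ_ A).hom).1 h2

/-- The hypothesis says that `u` and `v` are transposes of each other; by the triangle identity the
two sides then have the same adjunct. -/
theorem evaluation_transpose {A' A : C} [ExactPairing A' A] (u : A' ⟶ A') (v : A ⟶ A)
    (h : ExactPairing.coevaluation A' A ≫ A' ◁ v = ExactPairing.coevaluation A' A ≫ u ▷ A) :
    A ◁ u ≫ ExactPairing.evaluation A' A = v ▷ A' ≫ ExactPairing.evaluation A' A := by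
  apply (tensorLeftHomEquiv A' A' A (𝟙_ C)).injective
  have h1 := ExactPairing.evaluation_coevaluation A' A
  change (λ_ A').inv ≫ _ ▷ _ ≫ (α_ _ _ _).hom ≫ A' ◁ _ =
    (λ_ A').inv ≫ _ ▷ _ ≫ (α_ _ _ _).hom ≫ A' ◁ _
  congr 1
  rw [MonoidalCategory.whiskerLeft_comp, MonoidalCategory.whiskerLeft_comp,
    ← associator_naturality_right_assoc, ← associator_naturality_middle_assoc,
    ← comp_whiskerRight_assoc, h, ← whisker_exchange_assoc, h1, comp_whiskerRight_assoc,
    associator_naturality_left_assoc, ← whisker_exchange, reassoc_of% h1]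
  simp

variable [SymmetricCategory C]

theorem coevaluation_slide {A A' : C} (c : 𝟙_ C ⟶ A' ⊗ A) (Y : C) :
    (ρ_ Y).inv ≫ Y ◁ c ≫ (α_ Y A' A).inv ≫ (β_ Y A').hom ▷ A ≫ (α_ A' Y A).hom =
      (λ_ Y).inv ≫ c ▷ Y ≫ (α_ A' A Y).hom ≫ A' ◁ (β_ A Y).hom := by
  have h := BraidedCategory.hexagon_reverse Y A' A
  have h1 := BraidedCategory.braiding_naturality_right Y c
  have h2 : A' ◁ (β_ Y A).hom ≫ A' ◁ (β_ A Y).hom = 𝟙 _ := by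
    rw [← MonoidalCategory.whiskerLeft_comp, SymmetricCategory.symmetry, MonoidalCategory.whiskerLeft_id]
  have h3 : (ρ_ Y).inv ≫ (β_ Y (𝟙_ C)).hom = (λ_ Y).inv := by simp
  rw [← h3, Category.assoc, ← reassoc_of% h1]
  have h4 : (β_ Y (A' ⊗ A)).hom ≫ (α_ A' A Y).hom ≫ A' ◁ (β_ A Y).hom =
      (α_ Y A' A).inv ≫ (β_ Y A').hom ▷ A ≫ (α_ A' Y A).hom := by
    have h5 : (β_ Y (A' ⊗ A)).hom ≫ (α_ A' A Y).hom = (α_ Y A' A).inv ≫ (β_ Y A').hom ▷ A ≫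
        (α_ A' Y A).hom ≫ A' ◁ (β_ Y A).hom := by simp
    rw [reassoc_of% h5, h2, Category.comp_id]
  rw [h4]

/-- Sliding `c` past `B'` turns the shuffle into a nesting of `c` inside `d`, the form in which a
tensor product of two exact pairings has its coevaluation. -/
theorem pairTensor_eq {A A' B B' : C} (c : 𝟙_ C ⟶ A' ⊗ A) (d : 𝟙_ C ⟶ B' ⊗ B) :
    pairTensor c d = (d ⊗≫ (B' ◁ c) ▷ B ⊗≫ 𝟙 ((B' ⊗ A') ⊗ (A ⊗ B))) ≫ (β_ B' A').hom ▷ (A ⊗ B) := by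
  have h := coevaluation_slide c B'
  have h1 : pairTensor c d = d ⊗≫ ((λ_ B').inv ≫ c ▷ B' ≫ (α_ A' A B').hom ≫ A' ◁ (β_ A B').hom) ▷ B
      ⊗≫ 𝟙 _ := by
    rw [pairTensor, MonoidalCategory.tensorHom_def', tensorμ]
    have h2 : (λ_ (𝟙_ C)).inv ≫ 𝟙_ C ◁ d = d ≫ (λ_ _).inv := by simp
    simp only [Category.assoc]
    rw [reassoc_of% h2]
    monoidal
  rw [h1, ← h]
  monoidal

theorem IsCoevaluation.pairTensor {A A' B B' : C} {c : 𝟙_ C ⟶ A' ⊗ A} {d : 𝟙_ C ⟶ B' ⊗ B}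
    (hc : IsCoevaluation c) (hd : IsCoevaluation d) : IsCoevaluation (pairTensor c d) := by
  obtain ⟨P, rfl⟩ := hc
  obtain ⟨Q, rfl⟩ := hd
  exact ⟨exactPairingCongrLeft (β_ B' A').symm, (pairTensor_eq _ _).symm⟩

theorem IsCoevaluation.pairPow {X X' : C} {c : 𝟙_ C ⟶ X' ⊗ X} (hc : IsCoevaluation c) :
    ∀ n, IsCoevaluation (pairPow c n)
  | 0 => ⟨exactPairingUnit, unitors_inv_equal.symm⟩
  | n + 1 => hc.pairTensor (hc.pairPow n)

theorem exists_isCoevaluation {X X' : C} (P : ExactPairing X X') :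
    ∃ c : 𝟙_ C ⟶ X' ⊗ X, IsCoevaluation c :=
  ⟨_, BraidedCategory.exactPairing_swap X X', rfl⟩

end Coevaluations

/-! ### Exactness of the tensor product in a rigid category -/

section RigidExact

/-- All objects have duals. -/
class HasDuals (T : Type u) [Category.{v} T] [MonoidalCategory T] : Prop where
  exists_exactPairing : ∀ X : T, ∃ X' : T, Nonempty (ExactPairing X X')

variable {T : Type u} [Category.{v} T] [MonoidalCategory T] [SymmetricCategory T] [HasDuals T]



/-- Tensoring with `X` is right adjoint to tensoring with its dual, and by the symmetry of duality
also left adjoint to it. -/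
instance preservesFiniteLimits_tensorLeft_of_dual (X : T) : PreservesFiniteLimits (tensorLeft X) := by
  obtain ⟨X', ⟨P⟩⟩ := HasDuals.exists_exactPairing X
  have := (tensorLeftAdjunction X X').rightAdjoint_preservesLimits
  exact PreservesLimits.preservesFiniteLimits _

instance preservesFiniteColimits_tensorLeft_of_dual (X : T) : PreservesFiniteColimits (tensorLeft X) := by
  obtain ⟨X', ⟨P⟩⟩ := HasDuals.exists_exactPairing X
  let := BraidedCategory.exactPairing_swap X X'
  have := (tensorLeftAdjunction X' X).leftAdjoint_preservesColimits
  exact PreservesColimits.preservesFiniteColimits _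

instance preservesFiniteLimits_tensorRight_of_dual (X : T) : PreservesFiniteLimits (tensorRight X) :=
  preservesFiniteLimits_of_natIso (BraidedCategory.tensorLeftIsoTensorRight X)

instance preservesFiniteColimits_tensorRight_of_dual (X : T) : PreservesFiniteColimits (tensorRight X) :=
  preservesFiniteColimits_of_natIso (BraidedCategory.tensorLeftIsoTensorRight X)

end RigidExact

/-! ### Universal properties of symmetric and divided powers -/

section SymmetricDivided

attribute [local instance] Abelian.hasFiniteBiproducts

variable {T : Type u} [Category.{v} T] [Abelian T] [MonoidalCategory T] [SymmetricCategory T]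

theorem permAction_symPowπ (X : T) (n : ℕ) (σ : Equiv.Perm (Fin n)) :
    End.asHom (permAction X n σ) ≫ symPowπ X n = symPowπ X n := by
  have h : biproduct.ι (fun _ : Equiv.Perm (Fin n) => tensorPow X n) σ ≫
    biproduct.desc (fun σ : Equiv.Perm (Fin n) => 𝟙 (tensorPow X n) - End.asHom (permAction X n σ)) ≫
      symPowπ X n = 0 := by
    exact (congrArg _ (cokernel.condition _)).trans comp_zero
  rw [biproduct.ι_desc_assoc, Preadditive.sub_comp, sub_eq_zero, Category.id_comp] at h
  exact h.symm

theorem divPowι_permAction (X : T) (n : ℕ) (σ : Equiv.Perm (Fin n)) :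
    divPowι X n ≫ End.asHom (permAction X n σ) = divPowι X n := by
  have h : (divPowι X n ≫
    biproduct.lift (fun σ : Equiv.Perm (Fin n) => 𝟙 (tensorPow X n) - End.asHom (permAction X n σ))) ≫
      biproduct.π (fun _ : Equiv.Perm (Fin n) => tensorPow X n) σ = 0 := by
    exact (congrArg (· ≫ _) (kernel.condition _)).trans zero_comp
  rw [Category.assoc, biproduct.lift_π, Preadditive.comp_sub, sub_eq_zero, Category.comp_id] at h
  exact h.symm

instance (X : T) (n : ℕ) : Epi (symPowπ X n) := inferInstanceAs (Epi (cokernel.π _))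

instance (X : T) (n : ℕ) : Mono (divPowι X n) := inferInstanceAs (Mono (kernel.ι _))

variable {D : Type u₂} [Category.{v₂} D] [Abelian D] (G : T ⥤ D)

/-- A right exact functor preserves the cokernel that defines `symPow`. The functor is kept general
because the property is used after tensoring as well as after applying `F`. -/
theorem exists_desc_symPow [PreservesFiniteColimits G] {X : T} {n : ℕ} {W : D}
    (h : G.obj (tensorPow X n) ⟶ W)
    (hs : ∀ σ, G.map (End.asHom (permAction X n σ)) ≫ h = h) :
    ∃ g : G.obj (symPow X n) ⟶ W, G.map (symPowπ X n) ≫ g = h := by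
  have := additive_of_preservesFiniteColimits G
  refine exists_desc_map_cokernel G _ h ?_
  rw [biproduct.desc_eq, Functor.map_sum, Preadditive.sum_comp]
  refine Finset.sum_eq_zero fun σ _ => ?_
  rw [Functor.map_comp, Category.assoc, Functor.map_sub, Preadditive.sub_comp, hs σ,
    CategoryTheory.Functor.map_id, Category.id_comp, sub_self, comp_zero]

theorem exists_lift_divPow [PreservesFiniteLimits G] {X : T} {n : ℕ} {W : D}
    (h : W ⟶ G.obj (tensorPow X n))
    (hs : ∀ σ, h ≫ G.map (End.asHom (permAction X n σ)) = h) :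
    ∃ g : W ⟶ G.obj (divPow X n), g ≫ G.map (divPowι X n) = h := by
  have := Functor.additive_of_preserves_binary_products G
  have hw : h ≫ G.map (biproduct.lift (fun σ : Equiv.Perm (Fin n) =>
      𝟙 (tensorPow X n) - End.asHom (permAction X n σ))) = 0 := by
    rw [biproduct.lift_eq, Functor.map_sum, Preadditive.comp_sum]
    refine Finset.sum_eq_zero fun σ _ => ?_
    rw [Functor.map_comp, ← Category.assoc, Functor.map_sub, Preadditive.comp_sub, hs σ,
      CategoryTheory.Functor.map_id, Category.comp_id, sub_self, zero_comp]
  exact ⟨_, (Fork.IsLimit.lift' (isLimitOfHasKernelOfPreservesLimit G _) h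
    (by rw [hw, comp_zero])).2⟩

theorem exists_desc_starProd {C : Type u₂} [Category.{v₂} C] [Abelian C] [MonoidalCategory C]
    [SymmetricCategory C] (F : T ⥤ C) [F.Braided] [PreservesFiniteColimits F] {S : C} [MonObj S]
    [IsCommMonObj S] {X : T} (b : F.obj X ⟶ S) (n : ℕ) :
    ∃ r : F.obj (symPow X n) ⟶ S, F.map (symPowπ X n) ≫ r = starProd fun _ : Fin n => b :=
  exists_desc_symPow F _ fun σ => map_permAction_starProd σ _

end SymmetricDivided

/-! ### Exterior powers of Frobenius twists through duality -/

section ExteriorFrobenius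

variable {T : Type u} [Category.{v} T] [Abelian T] [MonoidalCategory T] [SymmetricCategory T]

theorem isZero_image_iff {X Y : T} (f : X ⟶ Y) : IsZero (image f) ↔ f = 0 := by
  constructor
  · intro h
    rw [← image.fac f, h.eq_of_tgt (factorThruImage f) 0, zero_comp]
  · intro h
    apply IsZero.of_mono_eq_zero (image.ι f)
    rw [← cancel_epi (factorThruImage f), image.fac, h, comp_zero]

theorem isZero_extPow_iff (X : T) (n : ℕ) : IsZero (extPow X n) ↔ antisymmetrizer X n = 0 :=
  isZero_image_iff _

variable [MonoidalPreadditive T] [HasDuals T]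



theorem epi_tensorPowMap {X Y : T} (f : X ⟶ Y) [Epi f] : ∀ n, Epi (tensorPowMap f n)
  | 0 => inferInstanceAs (Epi (𝟙 _))
  | n + 1 => by
    have := epi_tensorPowMap f n
    change Epi (f ⊗ₘ tensorPowMap f n)
    rw [MonoidalCategory.tensorHom_def]
    have h1 : Epi (f ▷ tensorPow X n) := inferInstanceAs (Epi ((tensorRight _).map f))
    have h2 : Epi (Y ◁ tensorPowMap f n) := inferInstanceAs (Epi ((tensorLeft _).map (tensorPowMap f n)))
    exact epi_comp _ _

theorem mono_tensorPowMap {X Y : T} (f : X ⟶ Y) [Mono f] : ∀ n, Mono (tensorPowMap f n)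
  | 0 => inferInstanceAs (Mono (𝟙 _))
  | n + 1 => by
    have := mono_tensorPowMap f n
    change Mono (f ⊗ₘ tensorPowMap f n)
    rw [MonoidalCategory.tensorHom_def]
    have h1 : Mono (f ▷ tensorPow X n) := inferInstanceAs (Mono ((tensorRight _).map f))
    have h2 : Mono (Y ◁ tensorPowMap f n) := inferInstanceAs (Mono ((tensorLeft _).map (tensorPowMap f n)))
    exact mono_comp _ _

/-- The antisymmetriser is natural, and tensor powers of the two halves of an image factorisation
are epimorphic and monomorphic, so they may be cancelled. -/
theorem isZero_extPow_image_iff {X Y Z : T} (f : X ⟶ Y) (g : Y ⟶ Z) (m : ℕ) :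
    IsZero (extPow (image (f ≫ g)) m) ↔
      tensorPowMap f m ≫ antisymmetrizer Y m ≫ tensorPowMap g m = 0 := by
  rw [isZero_extPow_iff, ← reassoc_of% antisymmetrizer_natural, ← tensorPowMap_comp]
  conv_rhs => rw [← image.fac (f ≫ g), tensorPowMap_comp, reassoc_of% antisymmetrizer_natural]
  have := epi_tensorPowMap (factorThruImage (f ≫ g)) m
  have := mono_tensorPowMap (image.ι (f ≫ g)) m
  rw [← cancel_epi (tensorPowMap (factorThruImage (f ≫ g)) m), comp_zero,
    ← cancel_mono (tensorPowMap (image.ι (f ≫ g)) m), zero_comp, Category.assoc]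

/-- The divided power of `X` is dual to the symmetric power of the dual of `X`. -/
theorem exists_isCoevaluation_divPow {X X' : T} {c : 𝟙_ T ⟶ X' ⊗ X} (hc : IsCoevaluation c) (n : ℕ) :
    ∃ w : 𝟙_ T ⟶ symPow X' n ⊗ divPow X n, IsCoevaluation w ∧ w ≫ (𝟙 _ ⊗ₘ divPowι X n) =
      pairPow c n ≫ (symPowπ X' n ⊗ₘ 𝟙 _) := by
  -- The canonical element is invariant under the diagonal action. Once the first factor is
  -- projected to coinvariants, the second factor is invariant by itself, so the element lifts to
  -- the divided power.
  obtain ⟨w, hw⟩ : ∃ w : 𝟙_ T ⟶ symPow X' n ⊗ divPow X n,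
      w ≫ _ ◁ divPowι X n = pairPow c n ≫ (symPowπ X' n ▷ _) := exists_lift_divPow (tensorLeft (symPow X' n)) (X := X) (n := n)
    (pairPow c n ≫ (symPowπ X' n ▷ _)) (fun σ => by
      change (pairPow c n ≫ (symPowπ X' n ▷ _)) ≫ _ ◁ End.asHom (permAction X n σ) = _
      conv_rhs => rw [← pairPow_permAction c n σ]
      rw [Category.assoc, Category.assoc, MonoidalCategory.tensorHom_def', Category.assoc,
        ← comp_whiskerRight, permAction_symPowπ, whisker_exchange])
  obtain ⟨P, hP⟩ := hc.pairPow n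
  let ev : tensorPow X n ⊗ tensorPow X' n ⟶ 𝟙_ T := @ExactPairing.evaluation _ _ _ _ _ P
  have hev1 : tensorPow X n ◁ pairPow c n ≫ (α_ _ _ _).inv ≫ ev ▷ _ = (ρ_ _).hom ≫ (λ_ _).inv := by
    rw [← hP]
    exact @ExactPairing.coevaluation_evaluation _ _ _ _ _ P
  have hev2 : pairPow c n ▷ _ ≫ (α_ _ _ _).hom ≫ _ ◁ ev = (λ_ _).hom ≫ (ρ_ _).inv := by
    rw [← hP]
    exact @ExactPairing.evaluation_coevaluation _ _ _ _ _ P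
  -- Under duality `σ` on `X'` is transpose to `σ⁻¹` on `X`, which acts trivially on the divided
  -- power; hence the evaluation descends to the symmetric power of `X'`.
  have hperm : ∀ σ : Equiv.Perm (Fin n), (divPow X n) ◁ End.asHom (permAction X' n σ) ≫
      divPowι X n ▷ _ ≫ ev = divPowι X n ▷ _ ≫ ev := by
    intro σ
    have h1 : @ExactPairing.coevaluation _ _ _ _ _ P ≫ _ ◁ End.asHom (permAction X n σ⁻¹) =
        @ExactPairing.coevaluation _ _ _ _ _ P ≫ End.asHom (permAction X' n σ) ▷ _ := by
      rw [hP]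
      conv_lhs => rw [← pairPow_permAction c n σ]
      rw [Category.assoc, MonoidalCategory.tensorHom_def, Category.assoc,
        ← MonoidalCategory.whiskerLeft_comp, ← permAction_mul, inv_mul_cancel, permAction_one,
        MonoidalCategory.whiskerLeft_id, Category.comp_id]
    have h2 := evaluation_transpose _ _ h1
    rw [whisker_exchange_assoc]
    refine (congrArg _ h2).trans ?_
    rw [← comp_whiskerRight_assoc, divPowι_permAction]
  obtain ⟨e, he⟩ : ∃ e : divPow X n ⊗ symPow X' n ⟶ 𝟙_ T,
      _ ◁ symPowπ X' n ≫ e = divPowι X n ▷ _ ≫ ev := exists_desc_symPow (tensorLeft (divPow X n)) (X := X') (n := n)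
    (divPowι X n ▷ _ ≫ ev) hperm
  refine ⟨w, ⟨⟨w, e, ?_, ?_⟩, rfl⟩, ?_⟩
  -- The triangle identities are tested against the inclusion of the divided power, respectively the
  -- projection to the symmetric power, where they reduce to those of tensor powers.
  · rw [← cancel_mono (λ_ _).hom, ← cancel_mono (divPowι X n)]
    have h1 : (λ_ (divPow X n)).hom ≫ divPowι X n = _ ◁ divPowι X n ≫ (λ_ _).hom := by simp
    have h2 : e ▷ divPow X n ≫ 𝟙_ T ◁ divPowι X n = _ ◁ divPowι X n ≫ e ▷ _ :=
      (whisker_exchange _ _).symm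
    simp only [Category.assoc]
    rw [h1, reassoc_of% h2, ← associator_inv_naturality_right_assoc,
      ← MonoidalCategory.whiskerLeft_comp_assoc, hw, MonoidalCategory.whiskerLeft_comp_assoc,
      associator_inv_naturality_middle_assoc, ← comp_whiskerRight_assoc, he,
      comp_whiskerRight_assoc, ← associator_inv_naturality_left_assoc, whisker_exchange_assoc,
      reassoc_of% hev1]
    simp
  · have : Epi (𝟙_ T ◁ symPowπ X' n) := inferInstanceAs (Epi ((tensorLeft _).map _))
    rw [← cancel_epi (𝟙_ T ◁ symPowπ X' n)]
    rw [whisker_exchange_assoc, associator_naturality_right_assoc,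
      ← MonoidalCategory.whiskerLeft_comp, he, MonoidalCategory.whiskerLeft_comp,
      ← associator_naturality_middle_assoc, ← comp_whiskerRight_assoc, hw, comp_whiskerRight_assoc,
      associator_naturality_left_assoc, ← whisker_exchange, reassoc_of% hev2]
    simp
  · rw [id_tensorHom, hw, tensorHom_id]

/-- The vanishing of exterior powers of `Fr X` in terms of coevaluations. -/
theorem isZero_extPow_frob_iff {X X' : T} {c : 𝟙_ T ⟶ X' ⊗ X} (hc : IsCoevaluation c) (p j m : ℕ) :
    IsZero (extPow (frob p j X) m) ↔ pairPow (pairPow c (p ^ j)) m ≫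
      (tensorPowMap (symPowπ X' (p ^ j)) m ⊗ₘ
        (antisymmetrizer (tensorPow X (p ^ j)) m ≫ tensorPowMap (symPowπ X (p ^ j)) m)) = 0 := by
  obtain ⟨w, hw, hw'⟩ := exists_isCoevaluation_divPow hc (p ^ j)
  rw [frob, isZero_extPow_image_iff]
  -- The inclusions of divided powers are traded, through the duality `w`, for projections to the
  -- symmetric powers of `X'`.
  have h : pairPow (pairPow c (p ^ j)) m ≫
      (tensorPowMap (symPowπ X' (p ^ j)) m ⊗ₘ
        (antisymmetrizer (tensorPow X (p ^ j)) m ≫ tensorPowMap (symPowπ X (p ^ j)) m)) =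
      pairPow w m ≫ (𝟙 _ ⊗ₘ (tensorPowMap (divPowι X (p ^ j)) m ≫
        antisymmetrizer (tensorPow X (p ^ j)) m ≫ tensorPowMap (symPowπ X (p ^ j)) m)) := by
    have h1 := pairPow_comp w (𝟙 _) (divPowι X (p ^ j)) m
    have h2 := pairPow_comp (pairPow c (p ^ j)) (symPowπ X' (p ^ j)) (𝟙 _) m
    rw [tensorPowMap_id] at h1 h2
    rw [← Category.comp_id (𝟙 (tensorPow (symPow X' (p ^ j)) m)), ← tensorHom_comp_tensorHom,
      reassoc_of% h1, hw', ← reassoc_of% h2, tensorHom_comp_tensorHom, Category.comp_id,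
      Category.id_comp]
  rw [h]
  constructor
  · intro h0
    rw [h0, MonoidalPreadditive.tensor_zero, comp_zero]
  · exact (hw.pairPow m).eq_zero _

end ExteriorFrobenius

/-! ### Simplicity of the unit and faithfulness of tensor functors -/

section SimpleUnit

variable {T : Type u} [Category.{v} T] [Abelian T] [MonoidalCategory T] [SymmetricCategory T]
  [MonoidalPreadditive T]

theorem isZero_tensor_left {X : T} (hX : IsZero X) (Y : T) : IsZero (X ⊗ Y) := by
  rw [IsZero.iff_id_eq_zero] at hX ⊢
  rw [← MonoidalCategory.id_whiskerRight, hX, MonoidalPreadditive.zero_whiskerRight]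

theorem isZero_tensor_right (X : T) {Y : T} (hY : IsZero Y) : IsZero (X ⊗ Y) :=
  (isZero_tensor_left hY X).of_iso (β_ X Y)

/-- In a rigid category in which the endomorphism ring of the unit is a field, the unit is simple. -/
theorem epi_of_ne_zero [HasDuals T] (hE : ∀ a : 𝟙_ T ⟶ 𝟙_ T, a ≠ 0 → IsIso a) {W : T}
    (u : W ⟶ 𝟙_ T) (hu : u ≠ 0) : Epi u := by
  let U := image u
  let i : U ⟶ 𝟙_ T := image.ι u
  let Q := cokernel i
  let q : 𝟙_ T ⟶ Q := cokernel.π i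
  have hi : i ≠ 0 := fun h => hu (by rw [← image.fac u]; exact (congrArg _ h).trans comp_zero)
  have hiq : i ≫ q = 0 := cokernel.condition i
  obtain ⟨U', ⟨P⟩⟩ := HasDuals.exists_exactPairing U
  -- The monomorphism `i ▷ Q` vanishes: precomposed with the epimorphism `U ◁ q` it is essentially
  -- `i ≫ q`.
  have hUQ : IsZero (U ⊗ Q) := by
    have h1 : Mono (i ▷ Q) := inferInstanceAs (Mono ((tensorRight Q).map i))
    have h2 : Epi (U ◁ q) := inferInstanceAs (Epi ((tensorLeft U).map q))
    apply IsZero.of_mono_eq_zero (i ▷ Q)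
    rw [← cancel_epi (U ◁ q), comp_zero, whisker_exchange]
    have h3 : i ▷ 𝟙_ T = (ρ_ U).hom ≫ i ≫ (ρ_ _).inv := by simp
    have h4 : 𝟙_ T ◁ q = (λ_ _).hom ≫ q ≫ (λ_ _).inv := by simp
    rw [h3, h4, unitors_equal]
    simp only [Category.assoc, Iso.inv_hom_id_assoc]
    rw [reassoc_of% hiq, zero_comp, comp_zero]
  -- By the triangle identity `U'` is a retract of a tensor product with `U` as a factor.
  have hU'Q : IsZero (U' ⊗ Q) := by
    have hz : IsZero ((U' ⊗ (U ⊗ U')) ⊗ Q) :=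
      (isZero_tensor_right (U' ⊗ U') hUQ).of_iso
        (α_ _ _ _ ≪≫ whiskerLeftIso U' (whiskerRightIso (β_ U U') Q ≪≫ α_ _ _ _) ≪≫ (α_ _ _ _).symm)
    have h := ExactPairing.coevaluation_evaluation U U'
    rw [IsZero.iff_id_eq_zero]
    have h2 : 𝟙 U' = (ρ_ U').inv ≫ (U' ◁ ExactPairing.coevaluation U U' ≫ (α_ _ _ _).inv ≫
        ExactPairing.evaluation U U' ▷ U') ≫ (λ_ U').hom := by rw [h]; simp
    rw [← MonoidalCategory.id_whiskerRight, h2, comp_whiskerRight, comp_whiskerRight, comp_whiskerRight,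
      hz.eq_of_tgt ((U' ◁ ExactPairing.coevaluation U U') ▷ Q) 0]
    simp
  have hsurj : Epi (U' ◁ i) := by
    have h : U' ◁ i ≫ U' ◁ q = 0 := by
      rw [← MonoidalCategory.whiskerLeft_comp, hiq, MonoidalPreadditive.whiskerLeft_zero]
    have : (tensorLeft U').Additive := additive_of_preservesFiniteColimits _
    refine Preadditive.epi_of_cancel_zero _ fun {Z} g hg => ?_
    obtain ⟨g', hg'⟩ := exists_desc_map_cokernel (tensorLeft U') i g hg
    rw [← hg', hU'Q.eq_of_src g' 0, comp_zero]
  have hinj : Mono (U' ◁ i) := inferInstanceAs (Mono ((tensorLeft U').map i))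
  have hiso : IsIso (U' ◁ i) := isIso_of_mono_of_epi _
  -- Since `U' ◁ i` is invertible, the evaluation can be read as a map `s` on `U'`; below, `t` is
  -- the transpose of `i`. The aim is that `t ≫ s` fixes `i`.
  let s : U' ⟶ 𝟙_ T := (ρ_ U').inv ≫ inv (U' ◁ i) ≫ ExactPairing.evaluation U U'
  have hs : U' ◁ i ≫ (ρ_ U').hom ≫ s = ExactPairing.evaluation U U' := by simp [s]
  let t : 𝟙_ T ⟶ U' := ExactPairing.coevaluation U U' ≫ i ▷ U' ≫ (λ_ U').hom
  have ht : t ▷ U ≫ ExactPairing.evaluation U U' = (λ_ U).hom ≫ i := by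
    have h := ExactPairing.evaluation_coevaluation U U'
    have h1 : (λ_ U').hom ▷ U ≫ ExactPairing.evaluation U U' =
      (α_ _ _ _).hom ≫ 𝟙_ T ◁ ExactPairing.evaluation U U' ≫ (λ_ _).hom := by simp
    simp only [t, comp_whiskerRight, Category.assoc]
    rw [h1, associator_naturality_left_assoc, ← whisker_exchange_assoc, reassoc_of% h,
      unitors_equal, rightUnitor_naturality, Iso.inv_hom_id_assoc]
  have hts : i ≫ (t ≫ s) = i := by
    rw [← hs] at ht
    have h : t ▷ U ≫ U' ◁ i ≫ (ρ_ U').hom = (λ_ U).hom ≫ i ≫ t := by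
      rw [← whisker_exchange_assoc, rightUnitor_naturality, ← unitors_equal, leftUnitor_naturality_assoc]
    rw [reassoc_of% h] at ht
    exact (cancel_epi (λ_ U).hom).1 ht
  -- Otherwise `t ≫ s - 𝟙` is an invertible endomorphism of the unit annihilating the nonzero `i`.
  have hts1 : t ≫ s = 𝟙 _ := by
    by_contra hne
    have hne' : t ≫ s - 𝟙 _ ≠ 0 := sub_ne_zero.2 hne
    have := hE _ hne'
    apply hi
    rw [← cancel_mono (t ≫ s - 𝟙 _), zero_comp, Preadditive.comp_sub, hts, Category.comp_id, sub_self]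
  -- The unit is now a retract of `U'`, so `Q` is a retract of `U' ⊗ Q`, which is zero.
  have hQ : IsZero Q := by
    have h : 𝟙 (𝟙_ T ⊗ Q) = 0 := by
      rw [← MonoidalCategory.id_whiskerRight, ← hts1, comp_whiskerRight, hU'Q.eq_of_src (s ▷ Q) 0,
        comp_zero]
    exact ((IsZero.iff_id_eq_zero _).2 h).of_iso (λ_ Q).symm
  have hepi : Epi i := Preadditive.epi_of_isZero_cokernel i hQ
  rw [← image.fac u]
  exact epi_comp (factorThruImage u) i

variable {C : Type u₂} [Category.{v₂} C] [Abelian C] [MonoidalCategory C] [MonoidalPreadditive C]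

/-- A nonzero morphism has a nonzero transpose to the unit, which is an epimorphism by simplicity. A
right exact monoidal functor keeps it an epimorphism onto a nonzero unit, so it cannot kill the
original morphism. -/
theorem eq_zero_of_map_eq_zero [HasDuals T] (hE : ∀ a : 𝟙_ T ⟶ 𝟙_ T, a ≠ 0 → IsIso a)
    (hC : ¬ IsZero (𝟙_ C)) (F : T ⥤ C) [F.Monoidal] [PreservesFiniteColimits F] {Y Z : T} (f : Y ⟶ Z)
    (hf : F.map f = 0) : f = 0 := by
  obtain ⟨Z', ⟨P⟩⟩ := HasDuals.exists_exactPairing Z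
  let := BraidedCategory.exactPairing_swap Z Z'
  have hP := ExactPairing.coevaluation_evaluation Z' Z
  have hg : f ▷ Z' ≫ ExactPairing.evaluation Z' Z = 0 := by
    by_contra hne
    have := epi_of_ne_zero hE _ hne
    have h1 : F.map (f ▷ Z' ≫ ExactPairing.evaluation Z' Z) = 0 := by
      rw [Functor.map_comp, Functor.Monoidal.map_whiskerRight, hf,
        MonoidalPreadditive.zero_whiskerRight]
      simp
    have h2 : Epi (F.map (f ▷ Z' ≫ ExactPairing.evaluation Z' Z)) := inferInstance
    rw [h1] at h2
    exact hC ((IsZero.of_epi_eq_zero (0 : F.obj (Y ⊗ Z') ⟶ F.obj (𝟙_ T)) rfl).of_iso (Functor.Monoidal.εIso F))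
  have h : f = (ρ_ Y).inv ≫ Y ◁ ExactPairing.coevaluation Z' Z ≫ (α_ _ _ _).inv ≫
      (f ▷ Z' ≫ ExactPairing.evaluation Z' Z) ▷ Z ≫ (λ_ Z).hom := by
    rw [comp_whiskerRight, Category.assoc, ← associator_inv_naturality_left_assoc,
      whisker_exchange_assoc, reassoc_of% hP]
    simp
  rw [h, hg]
  simp

end SimpleUnit

/-! ### Alternation -/

section RepeatedFactor

variable {T : Type u} [Category.{v} T] [Abelian T] [MonoidalCategory T] [SymmetricCategory T]
  {C : Type u₂} [Category.{v₂} C] [Preadditive C] [MonoidalCategory C] [SymmetricCategory C]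
  [MonoidalPreadditive C] {F : T ⥤ C} [F.Braided] [F.Additive] {S : C} [MonObj S] [IsCommMonObj S]

/-- The terms of `σ` and of its product with the transposition cancel in pairs. Nothing is divided
by two, so the argument holds in characteristic two as well. -/
theorem map_antisymmetrizer_starProd_eq_zero {X : T} {n : ℕ} (f : Fin n → (F.obj X ⟶ S)) {i j : Fin n}
    (hij : i ≠ j) (hf : f i = f j) : F.map (antisymmetrizer X n) ≫ starProd f = 0 := by
  rw [map_antisymmetrizer_starProd]
  refine Finset.sum_involution (fun σ _ => Equiv.swap i j * σ) ?_ ?_ ?_ ?_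
  · intro σ _
    have h : f ∘ (Equiv.swap i j * σ : Equiv.Perm (Fin n)) = f ∘ σ := by
      funext x
      change f (Equiv.swap i j (σ x)) = f (σ x)
      rw [Equiv.swap_apply_def]
      split_ifs with h1 h2
      · rw [h1, hf]
      · rw [h2, hf]
      · rfl
    rw [h, Equiv.Perm.sign_mul, Equiv.Perm.sign_swap hij]
    simp
  · intro σ _ _ h
    exact hij (Equiv.swap_eq_one_iff.1 (mul_eq_right.1 h))
  · intro σ _
    exact Finset.mem_univ _
  · intro σ _
    rw [← mul_assoc, Equiv.swap_mul_self, one_mul]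

end RepeatedFactor

/-! ### Objects that become free of finite rank -/

section TrivialObject

open Functor.OplaxMonoidal Functor.LaxMonoidal

variable {T : Type u} [Category.{v} T] [Abelian T] [MonoidalCategory T] [SymmetricCategory T]
  {C : Type u₂} [Category.{v₂} C] [Preadditive C] [MonoidalCategory C] [SymmetricCategory C]
  [MonoidalPreadditive C] {F : T ⥤ C} [F.Braided]

theorem exists_sum_starProd {X : T} {m : ℕ} (b : Fin m → (F.obj X ⟶ 𝟙_ C)) (e : Fin m → (𝟙_ C ⟶ F.obj X))
    (h : ∑ i, b i ≫ e i = 𝟙 _) : ∀ n, ∃ g : (Fin n → Fin m) → (𝟙_ C ⟶ F.obj (tensorPow X n)),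
      ∑ f, starProd (b ∘ f) ≫ g f = 𝟙 _
  | 0 => ⟨fun _ => ε F, by
      rw [Fintype.sum_unique]
      change (η F ≫ 𝟙 _) ≫ ε F = 𝟙 _
      rw [Category.comp_id, Functor.Monoidal.η_ε]⟩
  | n + 1 => by
    obtain ⟨g, hg⟩ := exists_sum_starProd b e h n
    refine ⟨fun f => (λ_ (𝟙_ C)).inv ≫ (e (f 0) ⊗ₘ g (Fin.tail f)) ≫ μ F _ _, ?_⟩
    rw [← (Fin.consEquiv fun _ => Fin m).sum_comp, Fintype.sum_prod_type]
    have h1 : ∀ (i : Fin m) (f : Fin n → Fin m), starProd (b ∘ Fin.cons i f) ≫ (λ_ (𝟙_ C)).inv ≫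
        (e i ⊗ₘ g f) ≫ μ F _ _ = δ F _ _ ≫ ((b i ≫ e i) ⊗ₘ (starProd (b ∘ f) ≫ g f)) ≫ μ F _ _ := by
      intro i f
      change (δ F _ _ ≫ (b i ⊗ₘ starProd (b ∘ f)) ≫ (λ_ _).hom) ≫ _ = _
      simp only [Category.assoc, Iso.hom_inv_id_assoc, tensorHom_comp_tensorHom_assoc]
    refine (Finset.sum_congr rfl fun i _ => Finset.sum_congr rfl fun f _ => h1 i f).trans ?_
    have h2 : ∀ i, ∑ f : Fin n → Fin m, δ F X (tensorPow X n) ≫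
        ((b i ≫ e i) ⊗ₘ (starProd (b ∘ f) ≫ g f)) ≫ μ F _ _ =
        δ F _ _ ≫ ((b i ≫ e i) ⊗ₘ 𝟙 _) ≫ μ F _ _ := fun i => by
      rw [← hg, tensor_sum, Preadditive.sum_comp, Preadditive.comp_sum]
    refine (Finset.sum_congr rfl fun i _ => h2 i).trans ?_
    rw [← Preadditive.comp_sum, ← Preadditive.sum_comp, ← sum_tensor, h,
      id_tensorHom_id, Category.id_comp]
    exact Functor.Monoidal.δ_μ F _ _

/-- The identity of `F.obj (tensorPow X n)` is a sum of maps factoring through products of `n` of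
the functionals `b i`; with only `m < n` of them, each product has a repeated factor. -/
theorem map_antisymmetrizer_eq_zero [F.Additive] {X : T} {m : ℕ} (b : Fin m → (F.obj X ⟶ 𝟙_ C))
    (e : Fin m → (𝟙_ C ⟶ F.obj X)) (h : ∑ i, b i ≫ e i = 𝟙 _) {n : ℕ} (hn : m < n) :
    F.map (antisymmetrizer X n) = 0 := by
  obtain ⟨g, hg⟩ := exists_sum_starProd b e h n
  rw [← Category.comp_id (F.map _), ← hg, Preadditive.comp_sum]
  refine Finset.sum_eq_zero fun f _ => ?_
  obtain ⟨i, j, hij, hf⟩ := Fintype.exists_ne_map_eq_of_card_lt f (by simpa using hn)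
  rw [← Category.assoc, map_antisymmetrizer_starProd_eq_zero (b ∘ f) hij (congrArg b hf), zero_comp]

/-- An element of `F.obj X` is a functional on the dual through the evaluation, and the triangle
identity turns pairing with it into evaluation at `e`. -/
theorem exists_contract_eq {X X' : T} {c : 𝟙_ T ⟶ X' ⊗ X} (hc : IsCoevaluation c) (e : 𝟙_ C ⟶ F.obj X) :
    ∃ a : F.obj X' ⟶ 𝟙_ C, ∀ b : F.obj X ⟶ 𝟙_ C, contract c a b = η F ≫ e ≫ b := by
  obtain ⟨P, rfl⟩ := hc
  let a : F.obj X' ⟶ 𝟙_ C := (λ_ _).inv ≫ e ▷ F.obj X' ≫ μ F X X' ≫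
    F.map (ExactPairing.evaluation X' X) ≫ η F
  refine ⟨a, fun b => ?_⟩
  have h1 : F.map (ExactPairing.coevaluation X' X) ≫ δ F _ _ ≫ a ▷ F.obj X ≫ (λ_ _).hom =
      η F ≫ e := by
    have h2 : e = e ≫ F.map ((ρ_ X).inv ≫ (X ◁ ExactPairing.coevaluation X' X ≫ (α_ _ _ _).inv ≫
        ExactPairing.evaluation X' X ▷ X) ≫ (λ_ _).hom) := by
      rw [ExactPairing.coevaluation_evaluation]; simp
    conv_rhs => rw [h2]
    simp only [a, Functor.map_comp, Functor.Monoidal.map_whiskerLeft,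
      Functor.Monoidal.map_whiskerRight, Functor.Monoidal.map_associator_inv]
    simp only [Category.assoc, Functor.Monoidal.μ_δ_assoc]
    have r1 : F.map (ρ_ X).inv ≫ δ F X (𝟙_ T) = (ρ_ _).inv ≫ F.obj X ◁ ε F := by simp
    have r2 : F.map (ExactPairing.evaluation X' X) ▷ F.obj X ≫ μ F (𝟙_ T) X ≫ F.map (λ_ X).hom =
        (F.map (ExactPairing.evaluation X' X) ≫ η F) ▷ F.obj X ≫ (λ_ _).hom := by simp
    have r3 : η F ≫ (ρ_ (𝟙_ C)).inv ≫ 𝟙_ C ◁ (ε F ≫ F.map (ExactPairing.coevaluation X' X) ≫ δ F X' X) =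
        F.map (ExactPairing.coevaluation X' X) ≫ δ F X' X ≫ (λ_ _).inv := by
      rw [← unitors_inv_equal, ← leftUnitor_inv_naturality]
      simp
    rw [r2, reassoc_of% r1, rightUnitor_inv_naturality_assoc]
    simp only [← MonoidalCategory.whiskerLeft_comp_assoc]
    rw [← whisker_exchange_assoc, reassoc_of% r3, associator_inv_naturality_left_assoc]
    have r4 : (λ_ (F.obj X' ⊗ F.obj X)).inv ≫ (α_ _ _ _).inv = (λ_ (F.obj X')).inv ▷ F.obj X := by monoidal
    rw [reassoc_of% r4]
    simp only [comp_whiskerRight, Category.assoc]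
  rw [contract, star, MonoidalCategory.tensorHom_def]
  have h3 : 𝟙_ C ◁ b ≫ MonObj.mul (X := 𝟙_ C) = (λ_ _).hom ≫ b := leftUnitor_naturality b
  rw [Category.assoc, h3, reassoc_of% h1]

end TrivialObject

/-! ### Exterior powers vanish from some degree on -/

section Monotonicity

variable {T : Type u} [Category.{v} T] [MonoidalCategory T] [SymmetricCategory T]

theorem permAction_decomposeFin_zero (X : T) {n : ℕ} (τ : Equiv.Perm (Fin n)) :
    End.asHom (permAction X (n + 1) (Equiv.Perm.decomposeFin.symm (0, τ))) =
      X ◁ End.asHom (permAction X n τ) := by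
  induction τ using perm_induction with
  | h1 =>
    have h : Equiv.Perm.decomposeFin.symm (0, (1 : Equiv.Perm (Fin n))) = 1 := by
      ext1 x
      refine Fin.cases ?_ (fun x => ?_) x <;> simp
    rw [h, permAction_one, permAction_one, MonoidalCategory.whiskerLeft_id]
    rfl
  | hs i h =>
    have h' : Equiv.Perm.decomposeFin.symm (0, Equiv.swap ⟨i, Nat.lt_of_succ_lt h⟩ ⟨i + 1, h⟩) =
        Equiv.swap ⟨i + 1, Nat.lt_of_succ_lt (Nat.succ_lt_succ h)⟩ ⟨i + 1 + 1, Nat.succ_lt_succ h⟩ := by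
      ext1 x
      refine Fin.cases ?_ (fun x => ?_) x
      · rw [Equiv.Perm.decomposeFin_symm_apply_zero, Equiv.swap_apply_of_ne_of_ne] <;>
          simp [Fin.ext_iff]
      · rw [Equiv.Perm.decomposeFin_symm_apply_succ, Equiv.swap_self, Equiv.refl_apply]
        exact (Fin.succ_injective n).swap_apply ⟨i, Nat.lt_of_succ_lt h⟩ ⟨i + 1, h⟩ x |>.symm
    rw [h', asHom_permAction_swap, asHom_permAction_swap]
    rfl
  | hm σ τ hσ hτ =>
    have h : Equiv.Perm.decomposeFin.symm (0, σ * τ) = Equiv.Perm.decomposeFin.symm (0, σ) *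
        Equiv.Perm.decomposeFin.symm (0, τ) := by
      ext1 x
      refine Fin.cases ?_ (fun x => ?_) x <;> simp
    rw [h, permAction_mul, permAction_mul, hσ, hτ]
    exact (MonoidalCategory.whiskerLeft_comp _ _ _).symm

/-- Splitting the larger symmetric group into cosets of the stabiliser of `0`, with representatives
the transpositions of `0` and `q`, makes every partial sum factor through `X ◁ antisymmetrizer X n`.
-/
theorem antisymmetrizer_succ_eq_zero {T : Type u} [Category.{v} T] [Abelian T] [MonoidalCategory T]
    [SymmetricCategory T] [MonoidalPreadditive T] (X : T) {n : ℕ}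
    (h : antisymmetrizer X n = 0) : antisymmetrizer X (n + 1) = 0 := by
  rw [antisymmetrizer, ← Equiv.Perm.decomposeFin.symm.sum_comp, Fintype.sum_prod_type]
  refine Finset.sum_eq_zero fun q _ => ?_
  have h1 : ∀ τ : Equiv.Perm (Fin n),
      ((Equiv.Perm.sign (Equiv.Perm.decomposeFin.symm (q, τ)) : ℤˣ) : ℤ) •
      End.asHom (permAction X (n + 1) (Equiv.Perm.decomposeFin.symm (q, τ))) =
      (X ◁ (((Equiv.Perm.sign τ : ℤˣ) : ℤ) • End.asHom (permAction X n τ))) ≫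
        (((if q = 0 then 1 else -1 : ℤˣ) : ℤ) • End.asHom (permAction X (n + 1) (Equiv.swap 0 q))) := by
    intro τ
    have h2 : Equiv.Perm.decomposeFin.symm (q, τ) = Equiv.swap 0 q * Equiv.Perm.decomposeFin.symm (0, τ) := by
      ext1 x
      refine Fin.cases ?_ (fun x => ?_) x <;> simp
    have h3 : X ◁ (((Equiv.Perm.sign τ : ℤˣ) : ℤ) • End.asHom (permAction X n τ)) =
        ((Equiv.Perm.sign τ : ℤˣ) : ℤ) • (X ◁ End.asHom (permAction X n τ)) :=
      (tensorLeft X).map_zsmul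
    rw [Equiv.Perm.decomposeFin.symm_sign, h2, permAction_mul, permAction_decomposeFin_zero, h3,
      Units.val_mul, mul_smul]
    exact ((Preadditive.comp_zsmul ..).trans (congrArg _ (Preadditive.zsmul_comp ..))).symm
  refine (Finset.sum_congr rfl fun τ _ => h1 τ).trans ?_
  refine (Preadditive.sum_comp _ _ _).symm.trans ?_
  have h4 : ∑ τ : Equiv.Perm (Fin n), X ◁ (((Equiv.Perm.sign τ : ℤˣ) : ℤ) •
      End.asHom (permAction X n τ)) = X ◁ antisymmetrizer X n := by
    rw [antisymmetrizer, whiskerLeft_sum]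
  exact (congrArg (· ≫ _) (h4.trans (by rw [h, MonoidalPreadditive.whiskerLeft_zero]))).trans zero_comp

theorem isZero_extPow_mono {T : Type u} [Category.{v} T] [Abelian T] [MonoidalCategory T]
    [SymmetricCategory T] [MonoidalPreadditive T] (X : T) {n r : ℕ} (hr : n ≤ r)
    (h : IsZero (extPow X n)) : IsZero (extPow X r) := by
  rw [isZero_extPow_iff] at h ⊢
  induction r, hr using Nat.le_induction with
  | base => exact h
  | succ r _ ih => exact antisymmetrizer_succ_eq_zero X ih

end Monotonicity

/-! ### Determinants of Frobenius powers -/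

section FrobeniusDeterminant

attribute [local instance] Abelian.hasFiniteBiproducts

variable {T : Type u} [Category.{v} T] [Abelian T] [MonoidalCategory T] [SymmetricCategory T]
  [MonoidalPreadditive T] [HasDuals T]
  {C : Type u₂} [Category.{v₂} C] [Abelian C] [MonoidalCategory C] [SymmetricCategory C]
  [MonoidalPreadditive C] (F : T ⥤ C) [F.Braided] [PreservesFiniteColimits F] {S : C} [MonObj S]
  [IsCommMonObj S]

/-- The `p ^ j`-th power of a functional factors through the symmetric power. The determinant is
therefore a value of the canonical morphism that vanishes by `isZero_extPow_frob_iff`. -/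
theorem det_contract_pow_eq_zero [F.Additive] {X X' : T} {c : 𝟙_ T ⟶ X' ⊗ X} (hc : IsCoevaluation c)
    (p j : ℕ) {n : ℕ} (hn : IsZero (extPow (frob p j X) n)) (a : Fin n → (F.obj X' ⟶ S))
    (b : Fin n → (F.obj X ⟶ S)) :
    (Matrix.of fun i k => contract c (a k) (b i) ^ p ^ j).det = 0 := by
  choose r hr using fun k => exists_desc_starProd F (a k) (p ^ j)
  choose s hs using fun i => exists_desc_starProd F (b i) (p ^ j)
  rw [isZero_extPow_frob_iff hc] at hn
  have h1 : ∀ i k, contract c (a k) (b i) ^ p ^ j =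
      contract (pairPow c (p ^ j)) (F.map (symPowπ X' (p ^ j)) ≫ r k) (F.map (symPowπ X (p ^ j)) ≫ s i) := by
    intro i k
    rw [hr, hs, contract_pairPow, Finset.prod_const, Finset.card_univ, Fintype.card_fin]
  simp only [h1]
  rw [← contract_antisymmetrizer, ← map_tensorPowMap_starProd, ← map_tensorPowMap_starProd,
    ← Category.assoc, ← Functor.map_comp, ← contract_comp, hn, contract, Functor.map_zero, zero_comp]

end FrobeniusDeterminant

/-! ### From a trivialising functor to the numerical condition -/

section TrivializedNumerics

attribute [local instance] Abelian.hasFiniteBiproducts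

variable (k : Type w) [Field k] {T : Type u} [Category.{v} T] [Abelian T] [Linear k T]
  [MonoidalCategory T] [SymmetricCategory T]

theorem hasDuals (T : Type u) [Category.{v} T] [Abelian T] [Linear k T]
    [MonoidalCategory T] [SymmetricCategory T] [IsTensorCategory k T] : HasDuals T :=
  ⟨IsTensorCategory.exists_dual k⟩

theorem isIso_of_ne_zero [IsTensorCategory k T] (a : 𝟙_ T ⟶ 𝟙_ T) (ha : a ≠ 0) : IsIso a := by
  obtain ⟨x, rfl⟩ := (IsTensorCategory.bijective_smul_id (k := k) (T := T)).2 a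
  have hx : x ≠ 0 := fun h => ha (by simp [h])
  exact ⟨x⁻¹ • 𝟙 _, by simp [smul_smul, hx], by simp [smul_smul, hx]⟩

/-- An object that becomes trivial has a vanishing exterior power, and an exterior power of it
vanishes as soon as the one of some Frobenius twist does. -/
theorem numerics_of_trivialized [IsTensorCategory k T] (p : ℕ) [Fact p.Prime] (X : T)
    (h : TrivializedByTensorFunctor.{w, v, u, v₂, u₂} k X) :
    (∃ n : ℕ, IsZero (extPow X n)) ∧
      ∀ j n : ℕ, IsZero (extPow (frob p j X) n) → IsZero (extPow X n) := by
  obtain ⟨C, _, _, _, _, _, hC, F, _, _, _, _, m, ⟨φ⟩⟩ := h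
  have := hasDuals k T
  have hMT : MonoidalPreadditive T := inferInstance
  let b : Fin m → (F.obj X ⟶ 𝟙_ C) := fun i => φ.hom ≫ biproduct.π (fun _ : Fin m => 𝟙_ C) i
  let e : Fin m → (𝟙_ C ⟶ F.obj X) := fun i => biproduct.ι (fun _ : Fin m => 𝟙_ C) i ≫ φ.inv
  have hbe : ∑ i, b i ≫ e i = 𝟙 _ := by
    have : ∀ i, b i ≫ e i = φ.hom ≫ (biproduct.π (fun _ : Fin m => 𝟙_ C) i ≫ biproduct.ι (fun _ : Fin m => 𝟙_ C) i) ≫ φ.inv := fun i => by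
      simp [b, e]
    simp only [this]
    rw [← Preadditive.comp_sum, ← Preadditive.sum_comp, biproduct.total, Category.id_comp,
      Iso.hom_inv_id]
  have heb : ∀ i k, e k ≫ b i = if i = k then 𝟙 _ else 0 := by
    intro i k
    simp only [b, e, Category.assoc, Iso.inv_hom_id_assoc]
    by_cases h : i = k
    · subst h; simp
    · rw [if_neg h, biproduct.ι_π_ne _ (Ne.symm h)]
  have hzero : ∀ n, m < n → IsZero (extPow X n) := by
    intro n hn
    rw [isZero_extPow_iff]
    exact eq_zero_of_map_eq_zero (isIso_of_ne_zero k) (RightExactSymMonoidal.unit_ne_zero k) F _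
      (map_antisymmetrizer_eq_zero b e hbe hn)
  refine ⟨⟨m + 1, hzero _ (Nat.lt_succ_self m)⟩, fun j n hn => hzero n ?_⟩
  by_contra hnm
  rw [not_lt] at hnm
  obtain ⟨X', ⟨P⟩⟩ := HasDuals.exists_exactPairing X
  obtain ⟨c, hc⟩ := exists_isCoevaluation P
  choose a ha using fun i => exists_contract_eq (F := F) hc (e i)
  -- The first `n` basis vectors and dual functionals have the identity as Gram matrix. Its entries
  -- are unchanged by the nonzero power `p ^ j`, so its determinant `1` would be zero.
  have h1 := det_contract_pow_eq_zero F hc p j hn (fun k => a (Fin.castLE hnm k))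
    (fun i => b (Fin.castLE hnm i))
  have h2 : (Matrix.of fun i k : Fin n => contract c (a (Fin.castLE hnm k)) (b (Fin.castLE hnm i)) ^ p ^ j) =
      1 := by
    ext i k
    rw [Matrix.of_apply, ha, heb, Matrix.one_apply]
    simp only [(Fin.castLE_injective hnm).eq_iff]
    have hp : p ^ j ≠ 0 := pow_ne_zero _ (Fact.out : p.Prime).ne_zero
    split_ifs
    · exact one_pow _
    · rw [comp_zero]; exact zero_pow hp
  rw [h2, Matrix.det_one, sections_one_def] at h1
  apply RightExactSymMonoidal.unit_ne_zero k (C := C)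
  rw [IsZero.iff_id_eq_zero, ← Functor.Monoidal.ε_η F]
  have h3 : Functor.OplaxMonoidal.η F ≫ 𝟙 _ = 0 := h1
  rw [Category.comp_id] at h3
  rw [h3, comp_zero]

end TrivializedNumerics

/-! ### Maps out of preserved countable coproducts -/

section SigmaDescent

variable {D : Type u} [Category.{v} D] {D' : Type u₂} [Category.{v₂} D'] (f : ℕ → D) [HasCoproduct f]
  (G : D ⥤ D') [PreservesColimitsOfShape (Discrete ℕ) G]

theorem exists_desc_map_sigma {W : D'} (h : ∀ n, G.obj (f n) ⟶ W) :
    ∃ g : G.obj (∐ f) ⟶ W, ∀ n, G.map (Sigma.ι f n) ≫ g = h n :=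
  ⟨Cofan.IsColimit.desc (isColimitMapCoconeCofanMkEquiv G f _
      (isColimitOfPreserves G (coproductIsCoproduct f))) h,
    fun n => Cofan.IsColimit.fac (isColimitMapCoconeCofanMkEquiv G f _
      (isColimitOfPreserves G (coproductIsCoproduct f))) h n⟩

theorem map_sigma_hom_ext {W : D'} {g h : G.obj (∐ f) ⟶ W}
    (e : ∀ n, G.map (Sigma.ι f n) ≫ g = G.map (Sigma.ι f n) ≫ h) : g = h :=
  Cofan.IsColimit.hom_ext (isColimitMapCoconeCofanMkEquiv G f _
      (isColimitOfPreserves G (coproductIsCoproduct f))) _ _ e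

end SigmaDescent

/-! ### Algebra laws by induction on generators -/

section SymmetricAlgebraLaws

variable {D : Type u} [Category.{v} D] [MonoidalCategory D] [SymmetricCategory D]

/-- A presentation of an algebra `R` generated by commuting elements `V`. -/
structure SymPresentation (V R : D) where
  /-- Multiplication by elements of `V`. -/
  x : V ⊗ R ⟶ R
  /-- The unit. -/
  one : 𝟙_ D ⟶ R
  /-- The multiplication. -/
  mul : R ⊗ R ⟶ R
  x_comm : (α_ V V R).inv ≫ (β_ V V).hom ▷ R ≫ (α_ V V R).hom ≫ V ◁ x ≫ x = V ◁ x ≫ x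
  one_mul : one ▷ R ≫ mul = (λ_ R).hom
  x_mul : x ▷ R ≫ mul = (α_ V R R).hom ≫ V ◁ mul ≫ x
  ext : ∀ {Z W : D} (y : V ⊗ W ⟶ W) {f g : R ⊗ Z ⟶ W},
    x ▷ Z ≫ f = (α_ V R Z).hom ≫ V ◁ f ≫ y → x ▷ Z ≫ g = (α_ V R Z).hom ≫ V ◁ g ≫ y →
      one ▷ Z ≫ f = one ▷ Z ≫ g → f = g

namespace SymPresentation

variable {V R : D} (s : SymPresentation V R)

theorem mul_one : R ◁ s.one ≫ s.mul = (ρ_ R).hom := by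
  refine s.ext s.x ?_ ?_ ?_
  · rw [← whisker_exchange_assoc, s.x_mul]
    simp
  · simp
  · rw [← whisker_exchange_assoc, s.one_mul]
    simp [unitors_equal]

/-- Both sides satisfy the same recursion in the first variable and agree on the unit, so `ext`
identifies them. -/
theorem mul_assoc : s.mul ▷ R ≫ s.mul = (α_ R R R).hom ≫ R ◁ s.mul ≫ s.mul := by
  rw [← Iso.inv_comp_eq]
  refine s.ext s.x ?_ ?_ ?_
  · rw [associator_inv_naturality_left_assoc, ← comp_whiskerRight_assoc, s.x_mul]
    simp only [comp_whiskerRight, Category.assoc]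
    rw [s.x_mul]
    simp
  · rw [← whisker_exchange_assoc, s.x_mul]
    simp
  · rw [associator_inv_naturality_left_assoc, ← comp_whiskerRight_assoc, s.one_mul,
      ← whisker_exchange_assoc, s.one_mul]
    simp

/-- Induction in the first variable. The inductive step moves one generator past another, which is
the only use of `x_comm`; commutativity of the multiplication follows from this. -/
theorem mul_x : R ◁ s.x ≫ s.mul = (α_ R V R).inv ≫ (β_ R V).hom ▷ R ≫ (α_ V R R).hom ≫
    V ◁ s.mul ≫ s.x := by
  refine s.ext s.x ?_ ?_ ?_
  · rw [← whisker_exchange_assoc, s.x_mul]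
    simp
  · have h1 : (α_ (V ⊗ R) V R).inv ≫ (β_ (V ⊗ R) V).hom ▷ R ≫ (α_ V (V ⊗ R) R).hom ≫
        V ◁ (α_ V R R).hom = (α_ V R (V ⊗ R)).hom ≫ V ◁ ((α_ R V R).inv ≫ (β_ R V).hom ▷ R ≫
          (α_ V R R).hom) ≫ (α_ V V (R ⊗ R)).inv ≫ (β_ V V).hom ▷ (R ⊗ R) ≫ (α_ V V (R ⊗ R)).hom := by
      rw [BraidedCategory.braiding_tensor_left_hom]
      monoidal
    have h2 : V ◁ V ◁ s.mul ≫ V ◁ s.x ≫ s.x = ((α_ V V (R ⊗ R)).inv ≫ (β_ V V).hom ▷ (R ⊗ R) ≫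
        (α_ V V (R ⊗ R)).hom) ≫ V ◁ V ◁ s.mul ≫ V ◁ s.x ≫ s.x := by
      conv_lhs => rw [← s.x_comm]
      rw [associator_inv_naturality_right_assoc, whisker_exchange_assoc, associator_naturality_right_assoc]
      simp only [Category.assoc]
    rw [associator_inv_naturality_left_assoc, ← comp_whiskerRight_assoc,
      BraidedCategory.braiding_naturality_left, comp_whiskerRight_assoc,
      associator_naturality_middle_assoc, ← MonoidalCategory.whiskerLeft_comp_assoc, s.x_mul]
    simp only [MonoidalCategory.whiskerLeft_comp, Category.assoc] at h1 ⊢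
    rw [reassoc_of% h1]
    conv_rhs => rw [h2]
    simp only [Category.assoc]
  · rw [← whisker_exchange_assoc, s.one_mul, associator_inv_naturality_left_assoc,
      ← comp_whiskerRight_assoc, BraidedCategory.braiding_naturality_left]
    have h := s.one_mul
    rw [comp_whiskerRight_assoc, associator_naturality_middle_assoc,
      ← MonoidalCategory.whiskerLeft_comp_assoc, h]
    simp

theorem mul_comm : (β_ R R).hom ≫ s.mul = s.mul := by
  refine s.ext s.x ?_ s.x_mul ?_
  · have h1 : (β_ (V ⊗ R) R).hom ≫ (α_ R V R).inv ≫ (β_ R V).hom ▷ R ≫ (α_ V R R).hom =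
        (α_ V R R).hom ≫ V ◁ (β_ R R).hom := by
      rw [BraidedCategory.braiding_tensor_left_hom]
      simp only [Category.assoc, Iso.hom_inv_id_assoc]
      rw [← comp_whiskerRight_assoc, SymmetricCategory.symmetry, MonoidalCategory.id_whiskerRight,
        Category.id_comp, Iso.inv_hom_id, Category.comp_id]
    rw [BraidedCategory.braiding_naturality_left_assoc, s.mul_x, reassoc_of% h1,
      MonoidalCategory.whiskerLeft_comp_assoc]
  · rw [BraidedCategory.braiding_naturality_left_assoc, s.mul_one, s.one_mul]
    simp

/-- The multiplication of a presented algebra. -/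
abbrev monObj : MonObj R where
  one := s.one
  mul := s.mul
  one_mul := s.one_mul
  mul_one := s.mul_one
  mul_assoc := s.mul_assoc

theorem isCommMonObj : @IsCommMonObj _ _ _ _ R s.monObj :=
  letI := s.monObj
  ⟨s.mul_comm⟩

/-- The inclusion of the generators. -/
def ι : V ⟶ R := (ρ_ V).inv ≫ V ◁ s.one ≫ s.x

theorem ι_mul : s.ι ▷ R ≫ s.mul = s.x := by
  rw [ι, comp_whiskerRight_assoc, comp_whiskerRight_assoc, s.x_mul,
    associator_naturality_middle_assoc, ← MonoidalCategory.whiskerLeft_comp_assoc, s.one_mul]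
  simp

end SymPresentation

end SymmetricAlgebraLaws

/-! ### The symmetric algebra and its universal functional -/

section SymmetricAlgebra

open Functor.OplaxMonoidal Functor.LaxMonoidal

attribute [local instance] Abelian.hasFiniteBiproducts

variable {T : Type u} [Category.{v} T] [Abelian T] [MonoidalCategory T] [SymmetricCategory T]

/-- Permutations of the last `n` factors are permutations of all factors that fix the first, so they
are already trivial on the larger symmetric power. -/
theorem exists_symPow_succ [∀ X : T, PreservesFiniteColimits (tensorLeft X)] (X : T) (n : ℕ) :
    ∃ s : X ⊗ symPow X n ⟶ symPow X (n + 1), X ◁ symPowπ X n ≫ s = symPowπ X (n + 1) := by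
  refine exists_desc_symPow (tensorLeft X) (symPowπ X (n + 1)) fun σ => ?_
  have h := permAction_symPowπ X (n + 1) (Equiv.Perm.decomposeFin.symm (0, σ))
  rwa [permAction_decomposeFin_zero] at h

variable {D : Type u₂} [Category.{v₂} D] [Abelian D] [MonoidalCategory D] [SymmetricCategory D]
  (F : T ⥤ D) [F.Braided] (X : T)

/-- `F (⊗⁰ X) ≅ 𝟙`. -/
def powZero : 𝟙_ D ≅ F.obj (tensorPow X 0) := Functor.Monoidal.εIso F

/-- `F (⊗ⁿ⁺¹ X) ≅ F X ⊗ F (⊗ⁿ X)`. -/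
def powSucc (n : ℕ) : F.obj X ⊗ F.obj (tensorPow X n) ≅ F.obj (tensorPow X (n + 1)) :=
  Functor.Monoidal.μIso F X (tensorPow X n)

theorem map_braiding_whiskerRight_δ (Z : T) :
    F.map ((α_ X X Z).inv ≫ (β_ X X).hom ▷ Z ≫ (α_ X X Z).hom) ≫ δ F X (X ⊗ Z) ≫ F.obj X ◁ δ F X Z =
      δ F X (X ⊗ Z) ≫ F.obj X ◁ δ F X Z ≫ (α_ _ _ _).inv ≫ (β_ (F.obj X) (F.obj X)).hom ▷ _ ≫
        (α_ _ _ _).hom := by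
  have h1 : F.map (β_ X X).hom ≫ δ F X X = δ F X X ≫ (β_ (F.obj X) (F.obj X)).hom := by
    simp [Functor.map_braiding]
  have h2 : F.map ((β_ X X).hom ▷ Z) ≫ δ F (X ⊗ X) Z = δ F (X ⊗ X) Z ≫ F.map (β_ X X).hom ▷ F.obj Z :=
    (Functor.OplaxMonoidal.δ_natural_left F _ Z).symm
  have h3 := Functor.OplaxMonoidal.associativity F X X Z
  have h4 : δ F X (X ⊗ Z) ≫ F.obj X ◁ δ F X Z ≫ (α_ _ _ _).inv =
      F.map (α_ X X Z).inv ≫ δ F (X ⊗ X) Z ≫ δ F X X ▷ F.obj Z := by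
    rw [← cancel_mono (α_ _ _ _).hom, ← cancel_epi (F.map (α_ X X Z).hom)]
    simp
  rw [reassoc_of% h4, Functor.map_comp, Functor.map_comp, Category.assoc, Category.assoc, ← h3,
    reassoc_of% h2, ← comp_whiskerRight_assoc, h1, comp_whiskerRight_assoc]

theorem map_headSwap_powSucc (n : ℕ) : F.map (headSwap X (n + 2)) ≫ (powSucc F X (n + 1)).inv ≫
    F.obj X ◁ (powSucc F X n).inv = (powSucc F X (n + 1)).inv ≫ F.obj X ◁ (powSucc F X n).inv ≫
      (α_ _ _ _).inv ≫ (β_ (F.obj X) (F.obj X)).hom ▷ _ ≫ (α_ _ _ _).hom :=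
  map_braiding_whiskerRight_δ F X (tensorPow X n)

theorem map_adjSwap_succ_powSucc (i n : ℕ) : F.map (adjSwap X (i + 1) (n + 1)) ≫ (powSucc F X n).inv =
    (powSucc F X n).inv ≫ F.obj X ◁ F.map (adjSwap X i n) :=
  (Functor.OplaxMonoidal.δ_natural_right F X (adjSwap X i n)).symm

variable [HasCoproductsOfShape ℕ D]

/-- The symmetric algebra of an object. -/
def symAlg : D := ∐ fun n => F.obj (symPow X n)

/-- The inclusion of symmetric powers in the symmetric algebra. -/
def symAlgι (n : ℕ) : F.obj (symPow X n) ⟶ symAlg F X := Sigma.ι (fun n => F.obj (symPow X n)) n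

theorem exists_symAlg_retraction (n : ℕ) : ∃ r, symAlgι F X n ≫ r = 𝟙 _ :=
  ⟨Sigma.π (fun n => F.obj (symPow X n)) n, Sigma.ι_π_eq_id _ n⟩

theorem exists_desc_symAlg {D' : Type u₂} [Category.{v₂} D'] (G : D ⥤ D')
    [PreservesColimitsOfShape (Discrete ℕ) G] {W : D'} (h : ∀ n, G.obj (F.obj (symPow X n)) ⟶ W) :
    ∃ g : G.obj (symAlg F X) ⟶ W, ∀ n, G.map (symAlgι F X n) ≫ g = h n :=
  exists_desc_map_sigma (fun n => F.obj (symPow X n)) G h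

/-- The projection from tensor powers to the symmetric algebra. -/
def symAlgπ (n : ℕ) : F.obj (tensorPow X n) ⟶ symAlg F X :=
  F.map (symPowπ X n) ≫ symAlgι F X n

variable [PreservesFiniteColimits F]

theorem symAlg_hom_ext {D' : Type u₂} [Category.{v₂} D'] (G : D ⥤ D')
    [PreservesColimitsOfShape (Discrete ℕ) G] [G.PreservesEpimorphisms] {W : D'}
    {f g : G.obj (symAlg F X) ⟶ W}
    (h : ∀ n, G.map (symAlgπ F X n) ≫ f = G.map (symAlgπ F X n) ≫ g) : f = g := by
  refine map_sigma_hom_ext _ G fun n => ?_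
  change G.map (symAlgι F X n) ≫ f = G.map (symAlgι F X n) ≫ g
  rw [← cancel_epi (G.map (F.map (symPowπ X n)))]
  have := h n
  simpa only [symAlgπ, Functor.map_comp, Category.assoc] using this

theorem map_permAction_symAlgπ (n : ℕ) (σ : Equiv.Perm (Fin n)) :
    F.map (End.asHom (permAction X n σ)) ≫ symAlgπ F X n = symAlgπ F X n := by
  rw [symAlgπ, ← Functor.map_comp_assoc, permAction_symPowπ]

variable [∀ X : T, PreservesFiniteColimits (tensorLeft X)]
  [∀ A : D, PreservesFiniteColimits (tensorLeft A)]
  [∀ A : D, PreservesColimitsOfShape (Discrete ℕ) (tensorLeft A)]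
  [∀ A : D, PreservesFiniteColimits (tensorRight A)]
  [∀ A : D, PreservesColimitsOfShape (Discrete ℕ) (tensorRight A)]

theorem exists_symAlgX : ∃ x : F.obj X ⊗ symAlg F X ⟶ symAlg F X, ∀ n,
    F.obj X ◁ symAlgπ F X n ≫ x = (powSucc F X n).hom ≫ symAlgπ F X (n + 1) := by
  choose s hs using exists_symPow_succ X
  obtain ⟨x, hx⟩ := exists_desc_symAlg F X (tensorLeft (F.obj X))
    fun n => μ F _ _ ≫ F.map (s n) ≫ symAlgι F X (n + 1)
  refine ⟨x, fun n => ?_⟩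
  have h1 : F.obj X ◁ symAlgι F X n ≫ x = _ := hx n
  have h2 : F.obj X ◁ F.map (symPowπ X n) ≫ μ F X (symPow X n) =
    (powSucc F X n).hom ≫ F.map (X ◁ symPowπ X n) := Functor.LaxMonoidal.μ_natural_right F X _
  have h3 : F.map (X ◁ symPowπ X n) ≫ F.map (s n) = F.map (symPowπ X (n + 1)) := by
    rw [← Functor.map_comp, hs]
    rfl
  rw [symAlgπ, MonoidalCategory.whiskerLeft_comp, Category.assoc, h1, reassoc_of% h2, symAlgπ]
  exact congrArg _ ((Category.assoc _ _ _).symm.trans (congrArg (· ≫ symAlgι F X (n + 1)) h3))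

/-- Multiplication by elements of `X` on its symmetric algebra. -/
def symAlgX : F.obj X ⊗ symAlg F X ⟶ symAlg F X := (exists_symAlgX F X).choose

theorem symAlgπ_symAlgX (n : ℕ) :
    F.obj X ◁ symAlgπ F X n ≫ symAlgX F X = (powSucc F X n).hom ≫ symAlgπ F X (n + 1) :=
  (exists_symAlgX F X).choose_spec n

theorem symAlgX_comm : (α_ _ _ _).inv ≫ (β_ (F.obj X) (F.obj X)).hom ▷ _ ≫ (α_ _ _ _).hom ≫
    F.obj X ◁ symAlgX F X ≫ symAlgX F X = F.obj X ◁ symAlgX F X ≫ symAlgX F X := by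
  refine symAlg_hom_ext F X (tensorLeft (F.obj X) ⋙ tensorLeft (F.obj X)) fun n => ?_
  change F.obj X ◁ F.obj X ◁ symAlgπ F X n ≫ _ = F.obj X ◁ F.obj X ◁ symAlgπ F X n ≫ _
  have h1 : F.obj X ◁ F.obj X ◁ symAlgπ F X n ≫ F.obj X ◁ symAlgX F X ≫ symAlgX F X =
      F.obj X ◁ (powSucc F X n).hom ≫ (powSucc F X (n + 1)).hom ≫ symAlgπ F X (n + 2) := by
    rw [← MonoidalCategory.whiskerLeft_comp_assoc, symAlgπ_symAlgX, MonoidalCategory.whiskerLeft_comp,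
      Category.assoc, symAlgπ_symAlgX]
  have h2 : F.map (headSwap X (n + 2)) ≫ symAlgπ F X (n + 2) = symAlgπ F X (n + 2) := by
    have h := map_permAction_symAlgπ F X (n + 2) (Equiv.swap ⟨0, by omega⟩ ⟨0 + 1, by omega⟩)
    rwa [asHom_permAction_swap] at h
  have h3 := (reassoc_of% (map_headSwap_powSucc F X n)) (F.obj X ◁ (powSucc F X n).hom ≫
    (powSucc F X (n + 1)).hom ≫ symAlgπ F X (n + 2))
  rw [associator_inv_naturality_right_assoc, whisker_exchange_assoc, associator_naturality_right_assoc,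
    h1, ← cancel_epi (F.obj X ◁ (powSucc F X n).inv), ← cancel_epi (powSucc F X (n + 1)).inv, ← h3]
  simp only [whiskerLeft_inv_hom_assoc, Iso.inv_hom_id_assoc, h2]

/-- The action of tensor powers of `X` on its symmetric algebra. -/
def symAlgAct : (n : ℕ) → (F.obj (tensorPow X n) ⊗ symAlg F X ⟶ symAlg F X)
  | 0 => (powZero F X).inv ▷ _ ≫ (λ_ _).hom
  | n + 1 => (powSucc F X n).inv ▷ _ ≫ (α_ _ _ _).hom ≫ F.obj X ◁ symAlgAct n ≫ symAlgX F X

theorem symAlgAct_zero : symAlgAct F X 0 = (powZero F X).inv ▷ _ ≫ (λ_ _).hom := rfl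

theorem symAlgAct_succ (n : ℕ) : symAlgAct F X (n + 1) =
    (powSucc F X n).inv ▷ _ ≫ (α_ _ _ _).hom ≫ F.obj X ◁ symAlgAct F X n ≫ symAlgX F X := rfl

/-- The two outermost generators act one after the other and commute by `hx`, so interchanging them
has no effect. -/
theorem whiskerRight_comp_act {V W P Q R : D} (d : P ⟶ V ⊗ Q) (d' : Q ⟶ V ⊗ W) (a : W ⊗ R ⟶ R)
    (x : V ⊗ R ⟶ R) (hx : (α_ _ _ _).inv ≫ (β_ V V).hom ▷ _ ≫ (α_ _ _ _).hom ≫ V ◁ x ≫ x = V ◁ x ≫ x)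
    (σ : P ⟶ P) (hσ : σ ≫ d ≫ V ◁ d' = d ≫ V ◁ d' ≫ (α_ _ _ _).inv ≫ (β_ V V).hom ▷ _ ≫ (α_ _ _ _).hom) :
    σ ▷ R ≫ d ▷ R ≫ (α_ _ _ _).hom ≫ V ◁ (d' ▷ R ≫ (α_ _ _ _).hom ≫ V ◁ a ≫ x) ≫ x =
      d ▷ R ≫ (α_ _ _ _).hom ≫ V ◁ (d' ▷ R ≫ (α_ _ _ _).hom ≫ V ◁ a ≫ x) ≫ x := by
  have h1 : d ▷ R ≫ (α_ _ _ _).hom ≫ V ◁ (d' ▷ R ≫ (α_ _ _ _).hom ≫ V ◁ a ≫ x) ≫ x =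
      (d ≫ V ◁ d') ▷ R ≫ (α_ _ _ _).hom ≫ V ◁ (α_ _ _ _).hom ≫ V ◁ V ◁ a ≫ V ◁ x ≫ x := by
    simp
  have h2 : (((α_ V V W).inv ≫ (β_ V V).hom ▷ _ ≫ (α_ _ _ _).hom) ▷ R) ≫ (α_ _ _ _).hom ≫
      V ◁ (α_ _ _ _).hom ≫ V ◁ V ◁ a ≫ V ◁ x ≫ x =
        (α_ _ _ _).hom ≫ V ◁ (α_ _ _ _).hom ≫ V ◁ V ◁ a ≫
          (α_ _ _ _).inv ≫ (β_ V V).hom ▷ _ ≫ (α_ _ _ _).hom ≫ V ◁ x ≫ x := by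
    rw [associator_inv_naturality_right_assoc, whisker_exchange_assoc,
      associator_naturality_right_assoc]
    simp
  rw [h1, ← comp_whiskerRight_assoc, hσ, ← Category.assoc d, comp_whiskerRight_assoc, h2, hx]

theorem adjSwap_symAlgAct : ∀ i n, F.map (adjSwap X i n) ▷ _ ≫ symAlgAct F X n = symAlgAct F X n
  | 0, 0 => by
    change F.map (𝟙 _) ▷ _ ≫ _ = _
    rw [CategoryTheory.Functor.map_id, MonoidalCategory.id_whiskerRight, Category.id_comp]
  | 0, 1 => by
    change F.map (𝟙 _) ▷ _ ≫ _ = _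
    rw [CategoryTheory.Functor.map_id, MonoidalCategory.id_whiskerRight, Category.id_comp]
  | 0, n + 2 => by
    rw [symAlgAct_succ, symAlgAct_succ]
    exact whiskerRight_comp_act _ _ _ _ (symAlgX_comm F X) _ (map_headSwap_powSucc F X n)
  | i + 1, 0 => by
    change F.map (𝟙 _) ▷ _ ≫ _ = _
    rw [CategoryTheory.Functor.map_id, MonoidalCategory.id_whiskerRight, Category.id_comp]
  | i + 1, n + 1 => by
    rw [symAlgAct_succ, ← comp_whiskerRight_assoc, map_adjSwap_succ_powSucc, comp_whiskerRight_assoc,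
      associator_naturality_middle_assoc, ← MonoidalCategory.whiskerLeft_comp_assoc,
      adjSwap_symAlgAct i n]

theorem permAction_symAlgAct (n : ℕ) (σ : Equiv.Perm (Fin n)) :
    F.map (End.asHom (permAction X n σ)) ▷ _ ≫ symAlgAct F X n = symAlgAct F X n := by
  induction σ using perm_induction with
  | h1 => rw [permAction_one, CategoryTheory.Functor.map_id, MonoidalCategory.id_whiskerRight,
      Category.id_comp]
  | hs i h => rw [asHom_permAction_swap, adjSwap_symAlgAct]
  | hm σ τ hσ hτ => rw [permAction_mul, Functor.map_comp, comp_whiskerRight_assoc, hσ, hτ]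

/-- Multiplications by generators commute, so the action of a tensor power is symmetric and descends
to the symmetric power; tensoring with the algebra preserves both the coinvariants and the
coproduct. -/
theorem exists_symAlgMul : ∃ m : symAlg F X ⊗ symAlg F X ⟶ symAlg F X, ∀ n,
    symAlgπ F X n ▷ _ ≫ m = symAlgAct F X n := by
  have : PreservesFiniteColimits (F ⋙ tensorRight (symAlg F X)) := comp_preservesFiniteColimits _ _
  choose t ht using fun n => exists_desc_symPow (F ⋙ tensorRight (symAlg F X)) (symAlgAct F X n)
    (permAction_symAlgAct F X n)
  obtain ⟨m, hm⟩ := exists_desc_symAlg F X (tensorRight (symAlg F X)) t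
  refine ⟨m, fun n => ?_⟩
  rw [symAlgπ, comp_whiskerRight_assoc]
  exact (congrArg _ (hm n)).trans (ht n)

/-- The multiplication of the symmetric algebra. -/
def symAlgMul : symAlg F X ⊗ symAlg F X ⟶ symAlg F X := (exists_symAlgMul F X).choose

theorem symAlgπ_symAlgMul (n : ℕ) : symAlgπ F X n ▷ _ ≫ symAlgMul F X = symAlgAct F X n :=
  (exists_symAlgMul F X).choose_spec n

/-- The presentation of the symmetric algebra. -/
def symAlgPresentation : SymPresentation (F.obj X) (symAlg F X) where
  x := symAlgX F X
  one := (powZero F X).hom ≫ symAlgπ F X 0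
  mul := symAlgMul F X
  x_comm := symAlgX_comm F X
  one_mul := by
    rw [comp_whiskerRight_assoc, symAlgπ_symAlgMul, symAlgAct_zero, hom_inv_whiskerRight_assoc]
  x_mul := by
    refine symAlg_hom_ext F X (tensorLeft (F.obj X) ⋙ tensorRight (symAlg F X)) fun n => ?_
    change (F.obj X ◁ symAlgπ F X n) ▷ _ ≫ _ = (F.obj X ◁ symAlgπ F X n) ▷ _ ≫ _
    rw [← comp_whiskerRight_assoc, symAlgπ_symAlgX, comp_whiskerRight_assoc, symAlgπ_symAlgMul,
      associator_naturality_middle_assoc, ← MonoidalCategory.whiskerLeft_comp_assoc, symAlgπ_symAlgMul,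
      symAlgAct_succ, hom_inv_whiskerRight_assoc]
  ext := by
    intro Z W y f g hf hg h
    refine symAlg_hom_ext F X (tensorRight Z) fun n => ?_
    change symAlgπ F X n ▷ Z ≫ f = symAlgπ F X n ▷ Z ≫ g
    induction n with
    | zero =>
      rw [comp_whiskerRight_assoc, comp_whiskerRight_assoc] at h
      exact (cancel_epi ((powZero F X).hom ▷ Z)).1 h
    | succ n ih =>
      have h1 : ∀ f : symAlg F X ⊗ Z ⟶ W, symAlgX F X ▷ Z ≫ f = (α_ _ _ _).hom ≫ F.obj X ◁ f ≫ y →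
          (powSucc F X n).hom ▷ Z ≫ symAlgπ F X (n + 1) ▷ Z ≫ f =
            (α_ _ _ _).hom ≫ F.obj X ◁ (symAlgπ F X n ▷ Z ≫ f) ≫ y := by
        intro f hf
        rw [← comp_whiskerRight_assoc, ← symAlgπ_symAlgX, comp_whiskerRight_assoc, hf,
          associator_naturality_middle_assoc, ← MonoidalCategory.whiskerLeft_comp_assoc]
      rw [← cancel_epi ((powSucc F X n).hom ▷ Z), h1 f hf, h1 g hg, ih]

instance : MonObj (symAlg F X) := (symAlgPresentation F X).monObj

instance : IsCommMonObj (symAlg F X) := (symAlgPresentation F X).isCommMonObj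

theorem starProd_symAlg : ∀ n, starProd (fun _ : Fin n => (symAlgPresentation F X).ι) = symAlgπ F X n
  | 0 => (powZero F X).inv_hom_id_assoc _
  | n + 1 => by
    change (powSucc F X n).inv ≫ ((symAlgPresentation F X).ι ⊗ₘ
      starProd (fun _ : Fin n => (symAlgPresentation F X).ι)) ≫ (symAlgPresentation F X).mul = _
    rw [starProd_symAlg n, MonoidalCategory.tensorHom_def', Category.assoc, SymPresentation.ι_mul]
    change (powSucc F X n).inv ≫ _ ≫ symAlgX F X = _
    rw [symAlgπ_symAlgX, Iso.inv_hom_id_assoc]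

/-- For the inclusion of `X` in its symmetric algebra, the `n`-th power of the functional is the
projection to degree `n`, which is a direct summand; so powers satisfy only the symmetric relations.
-/
theorem exists_generic : ∃ (R : D) (_ : MonObj R) (_ : IsCommMonObj R) (b : F.obj X ⟶ R),
    ∀ n, ∃ r : R ⟶ F.obj (symPow X n), starProd (fun _ : Fin n => b) ≫ r = F.map (symPowπ X n) := by
  refine ⟨symAlg F X, inferInstance, inferInstance, (symAlgPresentation F X).ι, fun n => ?_⟩
  obtain ⟨r, hr⟩ := exists_symAlg_retraction F X n
  refine ⟨r, ?_⟩
  rw [starProd_symAlg, symAlgπ, Category.assoc, hr, Category.comp_id]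

end SymmetricAlgebra

/-! ### Functionals with values in tensor products of algebras -/

section TensorAlgebras

open Functor.OplaxMonoidal Functor.LaxMonoidal

variable {C : Type u₂} [Category.{v₂} C] [MonoidalCategory C] [SymmetricCategory C]
  (R S : C) [MonObj R] [MonObj S]

instance isMonHom_one : IsMonHom (MonObj.one (X := R)) where
  one_hom := Category.id_comp _
  mul_hom := by
    change (λ_ (𝟙_ C)).hom ≫ MonObj.one = _
    rw [MonoidalCategory.tensorHom_def, Category.assoc, MonObj.mul_one, rightUnitor_naturality,
      unitors_equal]

/-- The inclusion of the first factor in a tensor product of algebras. -/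
def tensorInl : R ⟶ R ⊗ S := (ρ_ R).inv ≫ R ◁ MonObj.one

/-- The inclusion of the second factor in a tensor product of algebras. -/
def tensorInr : S ⟶ R ⊗ S := (λ_ S).inv ≫ MonObj.one ▷ S

instance : IsMonHom (tensorInl R S) := by unfold tensorInl; infer_instance

instance : IsMonHom (tensorInr R S) := by unfold tensorInr; infer_instance

theorem tensorInl_tensorInr_mul : (tensorInl R S ⊗ₘ tensorInr R S) ≫ MonObj.mul = 𝟙 (R ⊗ S) := by
  have h : (tensorInl R S ⊗ₘ tensorInr R S) = ((ρ_ R).inv ⊗ₘ (λ_ S).inv) ≫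
      ((𝟙 R ⊗ₘ MonObj.one) ⊗ₘ (MonObj.one ⊗ₘ 𝟙 S)) := by
    rw [tensorHom_comp_tensorHom, id_tensorHom, tensorHom_id]
    rfl
  rw [h, MonObj.tensorObj.mul_def, Category.assoc, tensorμ_natural_assoc, tensorHom_comp_tensorHom,
    id_tensorHom, tensorHom_id, MonObj.mul_one, MonObj.one_mul, tensorμ,
    braiding_tensorUnit_left]
  monoidal

variable {T : Type u} [Category.{v} T] [MonoidalCategory T] [SymmetricCategory T] {F : T ⥤ C} [F.Braided]
  {R S}

theorem star_tensorInl_tensorInr {A B : T} (f : F.obj A ⟶ R) (g : F.obj B ⟶ S) :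
    star (f ≫ tensorInl R S) (g ≫ tensorInr R S) = δ F A B ≫ (f ⊗ₘ g) := by
  rw [star, ← tensorHom_comp_tensorHom, Category.assoc, tensorInl_tensorInr_mul, Category.comp_id]

theorem star_tensor_retract {A B A' B' : T} (a : F.obj A ⟶ R) (b : F.obj B ⟶ S) (r : R ⟶ F.obj A')
    (s : S ⟶ F.obj B') (f : A ⟶ A') (g : B ⟶ B') (hf : a ≫ r = F.map f) (hg : b ≫ s = F.map g) :
    star (a ≫ tensorInl R S) (b ≫ tensorInr R S) ≫ (r ⊗ₘ s) ≫ μ F _ _ = F.map (f ⊗ₘ g) := by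
  rw [star_tensorInl_tensorInr, Category.assoc, tensorHom_comp_tensorHom_assoc, hf, hg]
  simp

end TensorAlgebras

/-! ### Generic families of functionals -/

section GenericFamilies

open Functor.OplaxMonoidal Functor.LaxMonoidal

variable {T : Type u} [Category.{v} T] [Abelian T] [MonoidalCategory T] [SymmetricCategory T]
  {C : Type u₂} [Category.{v₂} C] [MonoidalCategory C] [SymmetricCategory C] {F : T ⥤ C} [F.Braided]

/-- A family of morphisms `F X ⟶ S` is generic if the products of its powers are jointly as free as
symmetric powers are. -/
def IsGeneric {X : T} {S : C} [MonObj S] {m : ℕ} (b : Fin m → (F.obj X ⟶ S)) : Prop :=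
  ∀ n, ∃ r : S ⟶ F.obj (tensorPow (symPow X n) m),
    starProd (fun k => starProd (fun _ : Fin n => b k)) ≫ r = F.map (tensorPowMap (symPowπ X n) m)

/-- One tensor factor of the algebra is reserved for each functional, so the members are independent
and the maps back can be tensored together. -/
theorem exists_isGeneric {X : T} (h : ∃ (R : C) (_ : MonObj R) (_ : IsCommMonObj R) (b : F.obj X ⟶ R),
    ∀ n, ∃ r : R ⟶ F.obj (symPow X n), starProd (fun _ : Fin n => b) ≫ r = F.map (symPowπ X n)) (m : ℕ) :
    ∃ (S : C) (_ : MonObj S) (_ : IsCommMonObj S) (b : Fin m → (F.obj X ⟶ S)), IsGeneric b := by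
  induction m with
  | zero =>
    refine ⟨𝟙_ C, inferInstance, inferInstance, Fin.elim0, fun n => ⟨ε F, ?_⟩⟩
    change (η F ≫ 𝟙 _) ≫ ε F = F.map (𝟙 _)
    rw [Category.comp_id, Functor.Monoidal.η_ε, CategoryTheory.Functor.map_id]
  | succ m ih =>
    obtain ⟨R, _, _, b, hb⟩ := h
    obtain ⟨S, _, _, b', hb'⟩ := ih
    refine ⟨R ⊗ S, inferInstance, inferInstance,
      Fin.cons (b ≫ tensorInl R S) fun k => b' k ≫ tensorInr R S, fun n => ?_⟩
    obtain ⟨r, hr⟩ := hb n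
    obtain ⟨s, hs⟩ := hb' n
    refine ⟨(r ⊗ₘ s) ≫ μ F _ _, ?_⟩
    change star (starProd fun _ : Fin n => b ≫ tensorInl R S)
      (starProd fun k => starProd fun _ : Fin n => b' k ≫ tensorInr R S) ≫ _ =
        F.map (symPowπ X n ⊗ₘ tensorPowMap (symPowπ X n) m)
    have h1 : (starProd fun k => starProd fun _ : Fin n => b' k ≫ tensorInr R S) =
        (starProd fun k => starProd fun _ : Fin n => b' k) ≫ tensorInr R S := by
      rw [starProd_comp]
      simp only [starProd_comp]
    rw [← starProd_comp (tensorInl R S) fun _ : Fin n => b, h1]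
    exact star_tensor_retract _ _ r s _ _ hr hs

end GenericFamilies

/-! ### Generic Gram determinants detect Frobenius twists -/

section GenericDeterminant

open Functor.OplaxMonoidal Functor.LaxMonoidal

variable {T : Type u} [Category.{v} T] [Abelian T] [MonoidalCategory T] [SymmetricCategory T]
  {C : Type u₂} [Category.{v₂} C] [Preadditive C] [MonoidalCategory C] [SymmetricCategory C]
  [MonoidalPreadditive C] {F : T ⥤ C} [F.Braided] [F.Additive]

/-- In characteristic `p` the iterated Frobenius is a ring homomorphism, hence commutes with
determinants. -/
theorem det_pow_entries {S : C} [MonObj S] [IsCommMonObj S] (p : ℕ) [Fact p.Prime]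
    (hp : (p : F.obj (𝟙_ T) ⟶ S) = 0) (j : ℕ) {m : ℕ} (M : Matrix (Fin m) (Fin m) (F.obj (𝟙_ T) ⟶ S)) :
    (Matrix.of fun i k => M i k ^ p ^ j).det = M.det ^ p ^ j := by
  -- The zero ring does not have characteristic `p`, so it is treated apart.
  cases subsingleton_or_nontrivial (F.obj (𝟙_ T) ⟶ S) with
  | inl h => exact Subsingleton.elim _ _
  | inr h =>
    have : CharP (F.obj (𝟙_ T) ⟶ S) p := ringChar.of_eq (CharP.ringChar_of_prime_eq_zero Fact.out hp)
    exact ((iterateFrobenius (F.obj (𝟙_ T) ⟶ S) p j).map_det M).symm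

/-- The determinant of generic families detects exterior powers of Frobenius twists. -/
theorem isZero_extPow_frob_of_det [MonoidalPreadditive T] [HasDuals T] [F.Faithful] {X X' : T}
    {c : 𝟙_ T ⟶ X' ⊗ X} (hc : IsCoevaluation c) (p j : ℕ) [Fact p.Prime] {m : ℕ} {R S : C} [MonObj R]
    [IsCommMonObj R] [MonObj S] [IsCommMonObj S] {a : Fin m → (F.obj X' ⟶ R)}
    {b : Fin m → (F.obj X ⟶ S)} (ha : IsGeneric a) (hb : IsGeneric b)
    (hp : (p : F.obj (𝟙_ T) ⟶ R ⊗ S) = 0)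
    (h : (Matrix.of fun i k => contract c (a k ≫ tensorInl R S) (b i ≫ tensorInr R S)).det ^ p ^ j = 0) :
    IsZero (extPow (frob p j X) m) := by
  obtain ⟨r, hr⟩ := ha (p ^ j)
  obtain ⟨s, hs⟩ := hb (p ^ j)
  rw [isZero_extPow_frob_iff hc]
  apply F.map_injective
  have h1 : ∀ i k, contract c (a k ≫ tensorInl R S) (b i ≫ tensorInr R S) ^ p ^ j =
      contract (pairPow c (p ^ j)) (starProd (fun _ => a k) ≫ tensorInl R S)
        (starProd (fun _ => b i) ≫ tensorInr R S) := by
    intro i k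
    rw [starProd_comp, starProd_comp, contract_pairPow, Finset.prod_const, Finset.card_univ,
      Fintype.card_fin]
  rw [← det_pow_entries p hp] at h
  simp only [Matrix.of_apply, h1] at h
  rw [← contract_antisymmetrizer, ← starProd_comp, ← starProd_comp, ← Category.assoc] at h
  -- The maps `r` and `s` given by genericity carry the determinant back to the image under `F` of
  -- the morphism in `isZero_extPow_frob_iff`; the faithful `F` then detects its vanishing.
  have h2 := star_tensor_retract (starProd fun k => starProd fun _ : Fin (p ^ j) => a k)
    (F.map (antisymmetrizer (tensorPow X (p ^ j)) m) ≫ starProd fun i => starProd fun _ => b i)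
    r s _ _ hr (by rw [Category.assoc, hs, Functor.map_comp])
  rw [Functor.map_comp, ← h2, Functor.map_zero, ← Category.assoc]
  exact (congrArg (· ≫ _) h).trans zero_comp

end GenericDeterminant

/-! ### Sequential colimits of one endomorphism -/

section Telescope

variable {D : Type u} [Category.{v} D] [HasColimitsOfShape ℕ D] {S : D} (t : S ⟶ S)

/-- The colimit of the sequence `S ⟶ S ⟶ ⋯` with all maps equal to `t`. -/
def telescope : D := colimit (Functor.ofSequence (X := fun _ => S) fun _ => t)

/-- The structure maps of a telescope. -/
def telescopeι (n : ℕ) : S ⟶ telescope t := colimit.ι (Functor.ofSequence (X := fun _ => S) fun _ => t) n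

@[simp]
theorem comp_telescopeι (n : ℕ) : t ≫ telescopeι t (n + 1) = telescopeι t n := by
  have h := colimit.w (Functor.ofSequence (X := fun _ => S) fun _ => t) (homOfLE (Nat.le_add_right n 1))
  rwa [Functor.ofSequence_map_homOfLE_succ] at h

variable {D' : Type u₂} [Category.{v₂} D'] (G : D ⥤ D') [PreservesColimitsOfShape ℕ G] {W : D'}

theorem telescope_hom_ext {f g : G.obj (telescope t) ⟶ W}
    (h : ∀ n, G.map (telescopeι t n) ≫ f = G.map (telescopeι t n) ≫ g) : f = g :=
  (isColimitOfPreserves G (colimit.isColimit (Functor.ofSequence (X := fun _ => S) fun _ => t))).hom_ext h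

theorem exists_desc_telescope (h : ℕ → (G.obj S ⟶ W)) (hh : ∀ n, G.map t ≫ h (n + 1) = h n) :
    ∃ g : G.obj (telescope t) ⟶ W, ∀ n, G.map (telescopeι t n) ≫ g = h n := by
  let s : Functor.ofSequence (X := fun _ => S) (fun _ => t) ⋙ G ⟶ (Functor.const ℕ).obj W :=
    NatTrans.ofSequence h fun n => by
      change G.map ((Functor.ofSequence (X := fun _ => S) fun _ => t).map _) ≫ _ = _
      rw [Functor.ofSequence_map_homOfLE_succ]
      exact (hh n).trans (Category.comp_id _).symm
  let hc := isColimitOfPreserves G (colimit.isColimit (Functor.ofSequence (X := fun _ => S) fun _ => t))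
  exact ⟨hc.desc ⟨W, s⟩, fun n => hc.fac ⟨W, s⟩ n⟩

end Telescope

/-! ### The algebra structure on a telescope -/

section TelescopeAlgebra

variable {D : Type u} [Category.{v} D] [HasColimitsOfShape ℕ D] [MonoidalCategory D] [SymmetricCategory D]
  [∀ A : D, PreservesColimitsOfShape ℕ (tensorLeft A)]
  [∀ A : D, PreservesColimitsOfShape ℕ (tensorRight A)]
  {S : D} [MonObj S] [IsCommMonObj S]

theorem telescope_whisker_ext {t : S ⟶ S} {Z W : D} {f g : telescope t ⊗ Z ⟶ W}
    (h : ∀ n, telescopeι t n ▷ Z ≫ f = telescopeι t n ▷ Z ≫ g) : f = g :=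
  telescope_hom_ext t (tensorRight Z) h

theorem whisker_telescope_ext {t : S ⟶ S} {Z W : D} {f g : Z ⊗ telescope t ⟶ W}
    (h : ∀ n, Z ◁ telescopeι t n ≫ f = Z ◁ telescopeι t n ≫ g) : f = g :=
  telescope_hom_ext t (tensorLeft Z) h

theorem telescope_tensor_ext {t : S ⟶ S} {W : D} {f g : telescope t ⊗ telescope t ⟶ W}
    (h : ∀ i j, (telescopeι t i ⊗ₘ telescopeι t j) ≫ f = (telescopeι t i ⊗ₘ telescopeι t j) ≫ g) :
    f = g := by
  refine whisker_telescope_ext fun j => telescope_whisker_ext fun i => ?_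
  rw [← MonoidalCategory.tensorHom_def_assoc, ← MonoidalCategory.tensorHom_def_assoc, h]

theorem telescope_tensor_ext₃ {t : S ⟶ S} {W : D} {f g : (telescope t ⊗ telescope t) ⊗ telescope t ⟶ W}
    (h : ∀ i j k, ((telescopeι t i ⊗ₘ telescopeι t j) ⊗ₘ telescopeι t k) ≫ f =
      ((telescopeι t i ⊗ₘ telescopeι t j) ⊗ₘ telescopeι t k) ≫ g) : f = g := by
  refine whisker_telescope_ext fun k =>
    telescope_hom_ext t (tensorLeft (telescope t) ⋙ tensorRight S) fun j =>
      telescope_hom_ext t (tensorRight S ⋙ tensorRight S) fun i => ?_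
  have h' := h i j k
  rw [MonoidalCategory.tensorHom_def, MonoidalCategory.tensorHom_def, comp_whiskerRight] at h'
  simp only [Category.assoc] at h'
  exact h'

/-- If `t` is multiplication by `d`, stage `i` holds the fractions with denominator `d ^ i`, so
stages `i` and `j` multiply into stage `i + j`. -/
theorem exists_telescopeMul (t : S ⟶ S) (ht : MonObj.mul ≫ t = t ▷ S ≫ MonObj.mul) :
    ∃ m : telescope t ⊗ telescope t ⟶ telescope t, ∀ i j,
      (telescopeι t i ⊗ₘ telescopeι t j) ≫ m = MonObj.mul ≫ telescopeι t (i + j) := by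
  have ht' : MonObj.mul ≫ t = S ◁ t ≫ MonObj.mul := by
    rw [← IsCommMonObj.mul_comm S, BraidedCategory.braiding_naturality_right_assoc, ← ht, Category.assoc]
  have h1 : ∀ j, ∃ g : telescope t ⊗ S ⟶ telescope t, ∀ i,
      telescopeι t i ▷ S ≫ g = MonObj.mul ≫ telescopeι t (i + j) := fun j =>
    exists_desc_telescope t (tensorRight S) (fun i => MonObj.mul ≫ telescopeι t (i + j)) fun i => by
      change t ▷ S ≫ _ = _
      rw [← Category.assoc, ← ht, Category.assoc, Nat.add_right_comm, comp_telescopeι]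
  choose g hg using h1
  obtain ⟨m, hm⟩ := exists_desc_telescope t (tensorLeft (telescope t)) g fun j => by
    change telescope t ◁ t ≫ _ = _
    refine telescope_whisker_ext fun i => ?_
    rw [← whisker_exchange_assoc, hg, hg, ← Category.assoc, ← ht', Category.assoc, ← Nat.add_assoc,
      comp_telescopeι]
  refine ⟨m, fun i j => ?_⟩
  rw [MonoidalCategory.tensorHom_def, Category.assoc]
  exact (congrArg _ (hm j)).trans (hg j i)

/-- If `t` is multiplication by an element of a commutative algebra, its telescope is the localization
of the algebra at this element. -/
theorem exists_telescope_algebra (t : S ⟶ S) (ht : MonObj.mul ≫ t = t ▷ S ≫ MonObj.mul) :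
    ∃ (_ : MonObj (telescope t)) (_ : IsCommMonObj (telescope t)),
      MonObj.one (X := telescope t) = MonObj.one (X := S) ≫ telescopeι t 0 ∧
      ∀ i j, (telescopeι t i ⊗ₘ telescopeι t j) ≫ MonObj.mul = MonObj.mul ≫ telescopeι t (i + j) := by
  obtain ⟨m, hm⟩ := exists_telescopeMul t ht
  have hm' : ∀ i j, telescopeι t i ▷ S ≫ telescope t ◁ telescopeι t j ≫ m =
      MonObj.mul ≫ telescopeι t (i + j) := fun i j => by
    rw [← hm, MonoidalCategory.tensorHom_def, Category.assoc]
  refine ⟨{ one := MonObj.one ≫ telescopeι t 0, mul := m, one_mul := ?_, mul_one := ?_, mul_assoc := ?_ },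
    @IsCommMonObj.mk _ _ _ _ _ (_) ?_, rfl, hm⟩
  · refine whisker_telescope_ext fun n => ?_
    rw [whisker_exchange_assoc, comp_whiskerRight_assoc, hm', Nat.zero_add, MonObj.one_mul_assoc]
    exact (leftUnitor_naturality _).symm
  · refine telescope_whisker_ext fun n => ?_
    have h : telescopeι t n ▷ 𝟙_ D ≫ telescope t ◁ (MonObj.one ≫ telescopeι t 0) =
        S ◁ MonObj.one ≫ (telescopeι t n ⊗ₘ telescopeι t 0) := by
      rw [← MonoidalCategory.tensorHom_def, ← id_tensorHom, tensorHom_comp_tensorHom, Category.id_comp]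
    rw [reassoc_of% h, hm, Nat.add_zero, MonObj.mul_one_assoc]
    exact (rightUnitor_naturality _).symm
  · refine telescope_tensor_ext₃ fun i j k => ?_
    have h1 : ((telescopeι t i ⊗ₘ telescopeι t j) ⊗ₘ telescopeι t k) ≫ m ▷ telescope t =
        MonObj.mul ▷ S ≫ (telescopeι t (i + j) ⊗ₘ telescopeι t k) := by
      rw [← tensorHom_id, tensorHom_comp_tensorHom, hm, ← tensorHom_id, tensorHom_comp_tensorHom,
        Category.id_comp, Category.comp_id]
    have h2 : (telescopeι t i ⊗ₘ telescopeι t j ⊗ₘ telescopeι t k) ≫ telescope t ◁ m =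
        S ◁ MonObj.mul ≫ (telescopeι t i ⊗ₘ telescopeι t (j + k)) := by
      rw [← id_tensorHom, tensorHom_comp_tensorHom, hm, ← id_tensorHom, tensorHom_comp_tensorHom,
        Category.id_comp, Category.comp_id]
    rw [reassoc_of% h1, hm, associator_naturality_assoc, reassoc_of% h2, hm, MonObj.mul_assoc_assoc,
      Nat.add_assoc]
  · refine telescope_tensor_ext fun i j => ?_
    change _ ≫ _ ≫ m = _ ≫ m
    rw [BraidedCategory.braiding_naturality_assoc, hm, hm, IsCommMonObj.mul_comm_assoc, Nat.add_comm]

end TelescopeAlgebra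

/-! ### Localisation at an element -/

section Localization

open Functor.OplaxMonoidal Functor.LaxMonoidal

variable {T : Type u} [Category.{v} T] [MonoidalCategory T] [SymmetricCategory T] [EssentiallySmall.{v} T]
  [Abelian T] [∀ X : T, PreservesFiniteColimits (tensorLeft X)] {S : Ind T} [MonObj S] [IsCommMonObj S]

/-- Multiplication by an element of an algebra. -/
def mulBy (d : Ind.yoneda.obj (𝟙_ T) ⟶ S) : S ⟶ S :=
  (λ_ S).inv ≫ (ε Ind.yoneda ≫ d) ▷ S ≫ MonObj.mul

theorem mul_mulBy (d : Ind.yoneda.obj (𝟙_ T) ⟶ S) :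
    MonObj.mul ≫ mulBy d = mulBy d ▷ S ≫ MonObj.mul := by
  rw [mulBy]
  generalize ε Ind.yoneda ≫ d = e
  simp only [comp_whiskerRight, Category.assoc, MonObj.mul_assoc]
  rw [leftUnitor_inv_naturality_assoc, whisker_exchange_assoc]
  simp

theorem comp_mulBy (d x : Ind.yoneda.obj (𝟙_ T) ⟶ S) : x ≫ mulBy d = d * x := by
  have h : (λ_ (Ind.yoneda.obj (𝟙_ T))).inv ≫ ε Ind.yoneda ▷ _ =
      Ind.yoneda.map (λ_ (𝟙_ T)).inv ≫ δ Ind.yoneda (𝟙_ T) (𝟙_ T) := by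
    rw [Functor.OplaxMonoidal.left_unitality Ind.yoneda (𝟙_ T), Category.assoc, Category.assoc,
      ← comp_whiskerRight, Functor.Monoidal.η_ε, MonoidalCategory.id_whiskerRight, Category.comp_id]
  rw [sections_mul_def, star, mulBy, leftUnitor_inv_naturality_assoc, MonoidalCategory.tensorHom_def',
    comp_whiskerRight_assoc, Category.assoc, whisker_exchange_assoc, reassoc_of% h]

theorem comp_ofSequence_mulBy (d x : Ind.yoneda.obj (𝟙_ T) ⟶ S) : ∀ (m : ℕ) (i : 0 ⟶ m),
    x ≫ (Functor.ofSequence (X := fun _ => S) fun _ => mulBy d).map i = d ^ m * x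
  | 0, i => by
    rw [Subsingleton.elim i (𝟙 0), CategoryTheory.Functor.map_id, pow_zero, one_mul]
    exact Category.comp_id _
  | m + 1, i => by
    rw [Subsingleton.elim i (homOfLE (Nat.zero_le m) ≫ homOfLE (Nat.le_add_right m 1)), Functor.map_comp,
      Functor.ofSequence_map_homOfLE_succ, pow_succ', _root_.mul_assoc, ← comp_mulBy,
      ← comp_ofSequence_mulBy d x m (homOfLE (Nat.zero_le m))]
    exact (Category.assoc _ _ _).symm

/-- The localization of a commutative algebra at an element that is not nilpotent. -/
theorem exists_localization (d : Ind.yoneda.obj (𝟙_ T) ⟶ S) (hd : ∀ n, d ^ n ≠ 0) :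
    ∃ (B : Ind T) (_ : MonObj B) (_ : IsCommMonObj B) (φ : S ⟶ B) (_ : IsMonHom φ),
      ¬ IsZero B ∧ IsUnit (d ≫ φ) := by
  obtain ⟨_, _, h1, h2⟩ := exists_telescope_algebra (mulBy d) (mul_mulBy d)
  have : IsMonHom (telescopeι (mulBy d) 0) := ⟨h1.symm, (h2 0 0).symm⟩
  refine ⟨telescope (mulBy d), inferInstance, inferInstance, telescopeι (mulBy d) 0, inferInstance, ?_, ?_⟩
  -- If the telescope is zero, the section `1` dies in the colimit, hence at a finite stage `m` by
  -- compactness of the unit; there it is `d ^ m`.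
  · intro h
    obtain ⟨m, i, hm⟩ := Ind.eq_of_comp_colimit_eq
      (colimit.isColimit (Functor.ofSequence (X := fun _ => S) fun _ => mulBy d)) (n := 0)
      (f := (1 : Ind.yoneda.obj (𝟙_ T) ⟶ S)) (g := 0) (h.eq_of_tgt _ _)
    refine hd m ?_
    have h3 := (comp_ofSequence_mulBy d 1 m i).symm.trans (hm.trans zero_comp)
    rwa [_root_.mul_one] at h3
  -- The inverse of `d` is the section `1` placed at stage `1`.
  · refine IsUnit.of_mul_eq_one ((1 : Ind.yoneda.obj (𝟙_ T) ⟶ S) ≫ telescopeι (mulBy d) 1) ?_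
    have h3 : d ≫ telescopeι (mulBy d) 0 * (1 : Ind.yoneda.obj (𝟙_ T) ⟶ S) ≫ telescopeι (mulBy d) 1 =
        (d * 1) ≫ telescopeι (mulBy d) 1 := by
      rw [sections_mul_def, sections_mul_def, star, ← tensorHom_comp_tensorHom, Category.assoc, h2, star]
      simp only [Category.assoc]
    rw [h3, ← comp_mulBy, Category.assoc, comp_telescopeι]
    exact starOne_comp (telescopeι (mulBy d) 0)

end Localization

/-! ### Square-zero extensions, turning vector-valued maps into algebra-valued ones -/

section SquareZero

open Limits

variable {D : Type u} [Category.{v} D] [Preadditive D] [MonoidalCategory D] [SymmetricCategory D]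
  [MonoidalPreadditive D] [HasBinaryBiproducts D] (V : D)

/-- The square-zero extension of the unit by an object. -/
abbrev SquareZero : D := 𝟙_ D ⊞ V

namespace SquareZero

/-- The multiplication of a square-zero extension. -/
def mul : SquareZero V ⊗ SquareZero V ⟶ SquareZero V :=
  biprod.lift ((biprod.fst ⊗ₘ biprod.fst) ≫ (λ_ _).hom)
    ((biprod.fst ⊗ₘ biprod.snd) ≫ (λ_ V).hom + (biprod.snd ⊗ₘ biprod.fst) ≫ (ρ_ V).hom)

theorem mul_fst : mul V ≫ biprod.fst = (biprod.fst ⊗ₘ biprod.fst) ≫ (λ_ _).hom := biprod.lift_fst _ _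

theorem mul_snd : mul V ≫ biprod.snd =
    (biprod.fst ⊗ₘ biprod.snd) ≫ (λ_ V).hom + (biprod.snd ⊗ₘ biprod.fst) ≫ (ρ_ V).hom :=
  biprod.lift_snd _ _

theorem assoc_left {A Z : D} (f g : A ⟶ 𝟙_ D) (h : A ⟶ Z) :
    (((f ⊗ₘ g) ≫ (λ_ _).hom) ⊗ₘ h) ≫ (λ_ Z).hom =
      (α_ _ _ _).hom ≫ (f ⊗ₘ ((g ⊗ₘ h) ≫ (λ_ Z).hom)) ≫ (λ_ Z).hom := by
  have h1 := associator_naturality f g h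
  calc _ = ((f ⊗ₘ g) ⊗ₘ h) ≫ (λ_ _).hom ▷ Z ≫ (λ_ Z).hom := by
        rw [← tensorHom_id, tensorHom_comp_tensorHom_assoc, Category.comp_id]
    _ = ((f ⊗ₘ g) ⊗ₘ h) ≫ (α_ _ _ _).hom ≫ (𝟙_ D ◁ (λ_ Z).hom) ≫ (λ_ Z).hom := by simp
    _ = _ := by rw [reassoc_of% h1, ← id_tensorHom, tensorHom_comp_tensorHom_assoc, Category.comp_id]

theorem assoc_middle {A Z : D} (f g : A ⟶ 𝟙_ D) (h : A ⟶ Z) :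
    (((f ⊗ₘ h) ≫ (λ_ _).hom) ⊗ₘ g) ≫ (ρ_ Z).hom =
      (α_ _ _ _).hom ≫ (f ⊗ₘ ((h ⊗ₘ g) ≫ (ρ_ Z).hom)) ≫ (λ_ Z).hom := by
  have h1 := associator_naturality f h g
  calc _ = ((f ⊗ₘ h) ⊗ₘ g) ≫ (λ_ _).hom ▷ _ ≫ (ρ_ Z).hom := by
        rw [← tensorHom_id, tensorHom_comp_tensorHom_assoc, Category.comp_id]
    _ = ((f ⊗ₘ h) ⊗ₘ g) ≫ (α_ _ _ _).hom ≫ (𝟙_ D ◁ (ρ_ Z).hom) ≫ (λ_ Z).hom := by simp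
    _ = _ := by rw [reassoc_of% h1, ← id_tensorHom, tensorHom_comp_tensorHom_assoc, Category.comp_id]

theorem assoc_right {A Z : D} (f g : A ⟶ 𝟙_ D) (h : A ⟶ Z) :
    (((h ⊗ₘ f) ≫ (ρ_ _).hom) ⊗ₘ g) ≫ (ρ_ Z).hom =
      (α_ _ _ _).hom ≫ (h ⊗ₘ ((f ⊗ₘ g) ≫ (λ_ _).hom)) ≫ (ρ_ Z).hom := by
  have h1 := associator_naturality h f g
  calc _ = ((h ⊗ₘ f) ⊗ₘ g) ≫ (ρ_ _).hom ▷ _ ≫ (ρ_ Z).hom := by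
        rw [← tensorHom_id, tensorHom_comp_tensorHom_assoc, Category.comp_id]
    _ = ((h ⊗ₘ f) ⊗ₘ g) ≫ (α_ _ _ _).hom ≫ (Z ◁ (λ_ _).hom) ≫ (ρ_ Z).hom := by simp
    _ = _ := by rw [reassoc_of% h1, ← id_tensorHom, tensorHom_comp_tensorHom_assoc, Category.comp_id]

theorem whiskerRight_tensorHom {A B B' Z Z' : D} (f : A ⟶ B) (g : B ⟶ B') (h : Z ⟶ Z') :
    f ▷ Z ≫ (g ⊗ₘ h) = (f ≫ g) ⊗ₘ h := by
  rw [← tensorHom_id, tensorHom_comp_tensorHom, Category.id_comp]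

theorem whiskerLeft_tensorHom {A B B' Z Z' : D} (f : A ⟶ B) (g : B ⟶ B') (h : Z ⟶ Z') :
    Z ◁ f ≫ (h ⊗ₘ g) = h ⊗ₘ (f ≫ g) := by
  rw [← id_tensorHom, tensorHom_comp_tensorHom, Category.id_comp]

theorem mul_comm' : (β_ (SquareZero V) (SquareZero V)).hom ≫ mul V = mul V := by
  refine biprod.hom_ext _ _ ?_ ?_
  · rw [Category.assoc, mul_fst, ← BraidedCategory.braiding_naturality_assoc,
      braiding_leftUnitor, unitors_equal]
  · rw [Category.assoc, mul_snd, Preadditive.comp_add, ← BraidedCategory.braiding_naturality_assoc,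
      ← BraidedCategory.braiding_naturality_assoc, braiding_leftUnitor, braiding_rightUnitor, add_comm]

theorem one_mul' : biprod.inl ▷ SquareZero V ≫ mul V = (λ_ _).hom := by
  refine biprod.hom_ext _ _ ?_ ?_
  · rw [Category.assoc, mul_fst, ← Category.assoc, whiskerRight_tensorHom, biprod.inl_fst, id_tensorHom,
      leftUnitor_naturality]
  · rw [Category.assoc, mul_snd, Preadditive.comp_add, ← Category.assoc, ← Category.assoc,
      whiskerRight_tensorHom, whiskerRight_tensorHom, biprod.inl_fst, biprod.inl_snd, id_tensorHom,
      leftUnitor_naturality, MonoidalPreadditive.zero_tensor, zero_comp, add_zero]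

instance : MonObj (SquareZero V) where
  one := biprod.inl
  mul := mul V
  one_mul := one_mul' V
  mul_one := by
    rw [← mul_comm', BraidedCategory.braiding_naturality_right_assoc, one_mul', braiding_leftUnitor]
  mul_assoc := by
    refine biprod.hom_ext _ _ ?_ ?_
    · simp only [Category.assoc, mul_fst]
      rw [← Category.assoc, whiskerRight_tensorHom, reassoc_of% whiskerLeft_tensorHom, mul_fst, assoc_left]
    · simp only [Category.assoc, mul_snd, Preadditive.comp_add]
      rw [reassoc_of% whiskerRight_tensorHom, reassoc_of% whiskerRight_tensorHom,
        reassoc_of% whiskerLeft_tensorHom, reassoc_of% whiskerLeft_tensorHom, mul_fst, mul_snd,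
        MonoidalPreadditive.add_tensor, MonoidalPreadditive.tensor_add, Preadditive.add_comp,
        Preadditive.add_comp, Preadditive.comp_add, assoc_left, assoc_middle, assoc_right, add_assoc]

instance : IsCommMonObj (SquareZero V) := ⟨mul_comm' V⟩

end SquareZero

end SquareZero

/-! ### Evaluating products of functionals on tensors of elements -/

section DualFamilies

open Functor.OplaxMonoidal Functor.LaxMonoidal

attribute [local instance] Abelian.hasFiniteBiproducts

variable {T : Type u} [Category.{v} T] [MonoidalCategory T] [SymmetricCategory T]
  {C : Type u₂} [Category.{v₂} C] [MonoidalCategory C] [SymmetricCategory C] {F : T ⥤ C} [F.Braided]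

/-- The tensor product of elements of `F X`. -/
def tensorElts {X : T} : {n : ℕ} → (Fin n → (𝟙_ C ⟶ F.obj X)) → (𝟙_ C ⟶ F.obj (tensorPow X n))
  | 0, _ => ε F
  | n + 1, e => (λ_ _).inv ≫ (e 0 ⊗ₘ tensorElts fun i => e i.succ) ≫ μ F X (tensorPow X n)

theorem μ_star {A B : T} {S : C} [MonObj S] (f : F.obj A ⟶ S) (g : F.obj B ⟶ S) :
    μ F A B ≫ star f g = (f ⊗ₘ g) ≫ MonObj.mul := by
  rw [star, Functor.Monoidal.μ_δ_assoc]

theorem tensorElts_starProd_eq_one {X : T} {S : C} [MonObj S] : ∀ {n : ℕ} (e : Fin n → (𝟙_ C ⟶ F.obj X))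
    (f : Fin n → (F.obj X ⟶ S)) (_ : ∀ i, e i ≫ f i = MonObj.one), tensorElts e ≫ starProd f = MonObj.one
  | 0, e, f, h => Functor.Monoidal.ε_η_assoc F _
  | n + 1, e, f, h => by
    change ((λ_ _).inv ≫ (e 0 ⊗ₘ tensorElts fun i => e i.succ) ≫ μ F X (tensorPow X n)) ≫
      star (f 0) (starProd fun i => f i.succ) = _
    rw [Category.assoc, Category.assoc, μ_star, tensorHom_comp_tensorHom_assoc, h,
      tensorElts_starProd_eq_one _ _ fun i => h i.succ, MonoidalCategory.tensorHom_def', Category.assoc,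
      MonObj.one_mul]
    simp

variable [Preadditive C] [MonoidalPreadditive C]

theorem tensorElts_starProd_eq_zero {X : T} {S : C} [MonObj S] : ∀ {n : ℕ} (e : Fin n → (𝟙_ C ⟶ F.obj X))
    (f : Fin n → (F.obj X ⟶ S)) (i : Fin n) (_ : e i ≫ f i = 0), tensorElts e ≫ starProd f = 0
  | 0, _, _, i, _ => i.elim0
  | n + 1, e, f, i, h => by
    change ((λ_ _).inv ≫ (e 0 ⊗ₘ tensorElts fun i => e i.succ) ≫ μ F X (tensorPow X n)) ≫
      star (f 0) (starProd fun i => f i.succ) = _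
    rw [Category.assoc, Category.assoc, μ_star, tensorHom_comp_tensorHom_assoc]
    cases i using Fin.cases with
    | zero => rw [h, MonoidalPreadditive.zero_tensor, zero_comp, comp_zero]
    | succ i => rw [tensorElts_starProd_eq_zero _ _ i h, MonoidalPreadditive.tensor_zero, zero_comp, comp_zero]

end DualFamilies

/-! ### Dual families of maximal size are bases -/

section Splitting

open Functor.OplaxMonoidal Functor.LaxMonoidal

variable {T : Type u} [Category.{v} T] [Abelian T] [MonoidalCategory T] [SymmetricCategory T]
  {C : Type u₂} [Category.{v₂} C] [Abelian C] [MonoidalCategory C] [SymmetricCategory C]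
  [MonoidalPreadditive C] {F : T ⥤ C} [F.Braided] [F.Additive]

/-- If `Λᵐ⁺¹ X = 0`, then dual families of `m` elements and `m` functionals are bases. -/
theorem sum_dualFamilies {X : T} {m : ℕ} (hX : antisymmetrizer X (m + 1) = 0)
    (b : Fin m → (F.obj X ⟶ 𝟙_ C)) (e : Fin m → (𝟙_ C ⟶ F.obj X))
    (h : ∀ i k, e k ≫ b i = if i = k then 𝟙 _ else 0) : ∑ i, b i ≫ e i = 𝟙 _ := by
  -- The projection to the common kernel of the functionals `b i`; it has to vanish.
  set φ : F.obj X ⟶ F.obj X := 𝟙 _ - ∑ i, b i ≫ e i with hφ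
  have hφb : ∀ i, φ ≫ b i = 0 := fun i => by
    rw [hφ, Preadditive.sub_comp, Preadditive.sum_comp, Finset.sum_eq_single i]
    · simp [h]
    · intro j _ hj
      rw [Category.assoc, h, if_neg (Ne.symm hj), comp_zero]
    · simp
  -- Besides the `m` scalar functionals, the identity of `F.obj X` serves as a functional with
  -- values in the square-zero part. Their antisymmetrised product has `m + 1` factors, hence
  -- vanishes.
  let f : Fin (m + 1) → (F.obj X ⟶ SquareZero (F.obj X)) :=
    Fin.cons biprod.inr fun i => b i ≫ MonObj.one
  have h0 : (φ ⊗ₘ tensorElts e) ≫ (powSucc F X m).hom ≫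
      F.map (antisymmetrizer X (m + 1)) ≫ starProd f = 0 := by
    rw [hX, Functor.map_zero, zero_comp, comp_zero, comp_zero]
  -- Tested on `φ` and the `e k`, a permutation moving `0` applies some `b i` to `φ`, and any other
  -- nontrivial one applies some `b i` to an `e k` with `i ≠ k`. Only the identity survives, and it
  -- returns `φ`.
  have h1 : ∀ σ : Equiv.Perm (Fin (m + 1)), (φ ⊗ₘ tensorElts e) ≫ (powSucc F X m).hom ≫ starProd (f ∘ σ) =
      if σ = 1 then (ρ_ _).hom ≫ φ ≫ biprod.inr else 0 := by
    intro σ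
    change (φ ⊗ₘ tensorElts e) ≫ μ F X (tensorPow X m) ≫
      star (f (σ 0)) (starProd fun i : Fin m => f (σ i.succ)) = _
    rw [μ_star, tensorHom_comp_tensorHom_assoc]
    split_ifs with hσ
    · subst hσ
      rw [tensorElts_starProd_eq_one]
      · change ((φ ≫ biprod.inr) ⊗ₘ _) ≫ _ = _
        rw [MonoidalCategory.tensorHom_def, Category.assoc, MonObj.mul_one, rightUnitor_naturality]
      · intro i
        change e i ≫ b i ≫ MonObj.one = _
        rw [← Category.assoc, h, if_pos rfl, Category.id_comp]
    · by_cases hσ0 : σ 0 = 0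
      · obtain ⟨k, hk⟩ : ∃ k : Fin m, σ k.succ ≠ k.succ := by
          by_contra! hk
          exact hσ (Equiv.ext fun x => Fin.cases hσ0 hk x)
        have hk0 : σ k.succ ≠ 0 := fun h => Fin.succ_ne_zero k (σ.injective (h.trans hσ0.symm))
        obtain ⟨i, hi⟩ := Fin.exists_succ_eq.2 hk0
        rw [tensorElts_starProd_eq_zero _ _ k, MonoidalPreadditive.tensor_zero, zero_comp]
        rw [← hi]
        change e k ≫ b i ≫ MonObj.one = _
        rw [← Category.assoc, h, if_neg, zero_comp]
        rintro rfl
        exact hk hi.symm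
      · obtain ⟨i, hi⟩ := Fin.exists_succ_eq.2 hσ0
        rw [← hi]
        change ((φ ≫ b i ≫ MonObj.one) ⊗ₘ _) ≫ _ = _
        rw [← Category.assoc φ, hφb, zero_comp, MonoidalPreadditive.zero_tensor, zero_comp]
  rw [map_antisymmetrizer_starProd, Preadditive.comp_sum, Preadditive.comp_sum,
    Finset.sum_eq_single 1] at h0
  · rw [Preadditive.comp_zsmul, Preadditive.comp_zsmul, h1, if_pos rfl, Equiv.Perm.sign_one, Units.val_one,
      one_smul] at h0
    have h2 : φ = (ρ_ _).inv ≫ ((ρ_ _).hom ≫ φ ≫ biprod.inr) ≫ (biprod.snd : SquareZero (F.obj X) ⟶ _) := by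
      simp
    rw [h0, zero_comp, comp_zero] at h2
    exact (sub_eq_zero.1 h2).symm
  · intro σ _ hσ
    rw [Preadditive.comp_zsmul, Preadditive.comp_zsmul, h1, if_neg hσ, smul_zero]
  · intro h
    exact absurd (Finset.mem_univ _) h

attribute [local instance] Abelian.hasFiniteBiproducts

theorem nonempty_iso_of_dualFamilies {X : T} {m : ℕ} (hX : antisymmetrizer X (m + 1) = 0)
    (b : Fin m → (F.obj X ⟶ 𝟙_ C)) (e : Fin m → (𝟙_ C ⟶ F.obj X))
    (h : ∀ i k, e k ≫ b i = if i = k then 𝟙 _ else 0) :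
    Nonempty (F.obj X ≅ ⨁ fun _ : Fin m => 𝟙_ C) := by
  refine ⟨⟨biproduct.lift b, biproduct.desc e, ?_, ?_⟩⟩
  · rw [biproduct.lift_desc, sum_dualFamilies hX b e h]
  · refine biproduct.hom_ext _ _ fun i => biproduct.hom_ext' _ _ fun k => ?_
    rw [Category.assoc, biproduct.lift_π, biproduct.ι_desc_assoc, Category.id_comp, h]
    split_ifs with hik
    · subst hik
      rw [biproduct.ι_π_self]
    · rw [biproduct.ι_π_ne _ (Ne.symm hik)]

end Splitting

/-! ### Dual families from an invertible Gram matrix -/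

section GramMatrix

open Functor.OplaxMonoidal Functor.LaxMonoidal

variable {T : Type u} [Category.{v} T] [MonoidalCategory T] [SymmetricCategory T]
  {C : Type u₂} [Category.{v₂} C] [Preadditive C] [MonoidalCategory C] [SymmetricCategory C]
  [MonoidalPreadditive C] {F : T ⥤ C} [F.Braided]

theorem sections_unit_mul (r s : F.obj (𝟙_ T) ⟶ 𝟙_ C) : r * s = r ≫ ε F ≫ s := by
  have h1 : s = starOne F (𝟙_ C) ≫ ε F ≫ s := by
    change s = (η F ≫ 𝟙 _) ≫ ε F ≫ s
    simp
  have h2 : ∀ (r t : F.obj (𝟙_ T) ⟶ 𝟙_ C) (x : 𝟙_ C ⟶ 𝟙_ C), r * (t ≫ x) = (r * t) ≫ x := by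
    intro r t x
    rw [sections_mul_def, sections_mul_def, star, star]
    change _ ≫ _ ≫ _ ≫ (λ_ _).hom = (_ ≫ _ ≫ _ ≫ (λ_ _).hom) ≫ x
    simp only [Category.assoc]
    rw [← leftUnitor_naturality, ← id_tensorHom, tensorHom_comp_tensorHom_assoc, Category.comp_id]
  conv_lhs => rw [h1]
  rw [h2, ← sections_one_def, mul_one]

/-- Families with an invertible Gram matrix can be modified to become dual. -/
theorem exists_dualFamilies_of_gram {X X' : T} (c : 𝟙_ T ⟶ X' ⊗ X) {m : ℕ} (a : Fin m → (F.obj X' ⟶ 𝟙_ C))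
    (b : Fin m → (F.obj X ⟶ 𝟙_ C)) (q : Fin m → Fin m → (F.obj (𝟙_ T) ⟶ 𝟙_ C))
    (hq : ∀ i k, ∑ j, contract c (a k) (b j) * q j i = if i = k then 1 else 0) :
    ∃ (b : Fin m → (F.obj X ⟶ 𝟙_ C)) (e : Fin m → (𝟙_ C ⟶ F.obj X)),
      ∀ i k, e k ≫ b i = if i = k then 𝟙 _ else 0 := by
  -- The new functionals are the old ones multiplied by the inverse Gram matrix; the vector `e k` is
  -- the coevaluation contracted with `a k`.
  refine ⟨fun i => ∑ j, b j ≫ ε F ≫ q j i,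
    fun k => ε F ≫ F.map c ≫ δ F X' X ≫ a k ▷ _ ≫ (λ_ _).hom, fun i k => ?_⟩
  have h1 : ∀ j, (ε F ≫ F.map c ≫ δ F X' X ≫ a k ▷ _ ≫ (λ_ _).hom) ≫ b j ≫ ε F ≫ q j i =
      ε F ≫ (contract c (a k) (b j) * q j i) := by
    intro j
    rw [sections_unit_mul, contract, star, MonoidalCategory.tensorHom_def]
    change _ = ε F ≫ (F.map c ≫ δ F X' X ≫ (a k ▷ F.obj X ≫ 𝟙_ C ◁ b j) ≫ (λ_ _).hom) ≫ ε F ≫ q j i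
    simp only [Category.assoc]
    rw [leftUnitor_naturality_assoc]
  rw [Preadditive.comp_sum, Finset.sum_congr rfl fun j _ => h1 j, ← Preadditive.comp_sum, hq]
  split_ifs
  · rw [sections_one_def]
    change ε F ≫ η F ≫ 𝟙 _ = _
    simp
  · exact comp_zero

end GramMatrix

/-! ### Functionals on free modules as algebra-valued functionals -/

section Transpose

open Functor.OplaxMonoidal Functor.LaxMonoidal AMod

variable {T : Type u} [Category.{v} T] [MonoidalCategory T] [SymmetricCategory T]
  {D : Type u₂} [Category.{v₂} D] [MonoidalCategory D] [Abelian D] [MonoidalPreadditive D]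
  [hD : ∀ A : D, PreservesFiniteColimits (tensorLeft A)] [SymmetricCategory D]
  {F : T ⥤ D} [F.Braided] {A : D} [MonObj A] [IsCommMonObj A]

/-- Morphisms to the unit from a free module, as morphisms to the algebra. -/
def transpose {Y : T} (f : (F ⋙ free A).obj Y ⟶ 𝟙_ (AMod A)) : F.obj Y ⟶ A :=
  freeι A (F.obj Y) ≫ f.f

theorem transpose_injective {Y : T} {f g : (F ⋙ free A).obj Y ⟶ 𝟙_ (AMod A)}
    (h : transpose f = transpose g) : f = g := free_hom_ext h

theorem exists_transpose_eq {Y : T} (f : F.obj Y ⟶ A) :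
    ∃ g : (F ⋙ free A).obj Y ⟶ 𝟙_ (AMod A), transpose g = f :=
  ⟨freeDesc (M := unit A) f, freeι_freeDesc (M := unit A) f⟩

theorem transpose_zero {Y : T} : transpose (0 : (F ⋙ free A).obj Y ⟶ 𝟙_ (AMod A)) = 0 :=
  comp_zero

theorem transpose_sum {Y : T} {ι : Type*} (s : Finset ι) (f : ι → ((F ⋙ free A).obj Y ⟶ 𝟙_ (AMod A))) :
    transpose (∑ i ∈ s, f i) = ∑ i ∈ s, transpose (f i) := by
  have h : (∑ i ∈ s, f i).f = ∑ i ∈ s, (f i).f := (algMonad A).forget.map_sum f s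
  rw [transpose, h]
  exact Preadditive.comp_sum _ _ _

theorem transpose_map {Y Z : T} (u : Y ⟶ Z) (f : (F ⋙ free A).obj Z ⟶ 𝟙_ (AMod A)) :
    transpose ((F ⋙ free A).map u ≫ f) = F.map u ≫ transpose f :=
  ((reassoc_of% (freeι_natural (A := A) (F.map u))) _).symm

theorem tensorπ_tensorHom_unit {M N : AMod A} (f : M ⟶ unit A) (g : N ⟶ unit A) :
    (tensorπ M N).f ≫ Monad.Algebra.Hom.f (f ⊗ₘ g) ≫ Monad.Algebra.Hom.f (λ_ (unit A)).hom =
      (f.f ⊗ₘ g.f) ≫ MonObj.mul := by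
  have h1 : (tensorπ M N).f ≫ Monad.Algebra.Hom.f (f ⊗ₘ g) =
      (f.f ⊗ₘ g.f) ≫ (tensorπ (unit A) (unit A)).f := (epiLax A).tensorHom f g
  rw [reassoc_of% h1, lunit_f]

/-- On generators, the comparison `δ` is the projection to the tensor product over `A`, and the
unitor of `A` as a module is its multiplication. -/
theorem transpose_star {Y Z : T} (f : (F ⋙ free A).obj Y ⟶ 𝟙_ (AMod A))
    (g : (F ⋙ free A).obj Z ⟶ 𝟙_ (AMod A)) : transpose (star f g) = star (transpose f) (transpose g) := by
  change freeι A (F.obj (Y ⊗ Z)) ≫ (A ◁ δ F Y Z ≫ (δ (free A) (F.obj Y) (F.obj Z)).f) ≫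
    Monad.Algebra.Hom.f (f ⊗ₘ g) ≫ Monad.Algebra.Hom.f (λ_ (unit A)).hom = _
  rw [Category.assoc, ← reassoc_of% freeι_natural]
  refine (congrArg (δ F Y Z ≫ ·) ((reassoc_of% (free_δ (A := A) (F.obj Y) (F.obj Z))) _)).trans ?_
  refine (congrArg (fun x => δ F Y Z ≫ (freeι A (F.obj Y) ⊗ₘ freeι A (F.obj Z)) ≫ x)
    (tensorπ_tensorHom_unit f g)).trans ?_
  rw [star]
  exact congrArg (δ F Y Z ≫ ·) (tensorHom_comp_tensorHom_assoc _ _ _ _ _)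

theorem transpose_starOne : transpose (starOne (F ⋙ free A) (𝟙_ (AMod A))) = starOne F A := by
  change freeι A (F.obj (𝟙_ T)) ≫ Monad.Algebra.Hom.f (((free A).map (η F) ≫ η (free A)) ≫ 𝟙 _) = η F ≫ _
  rw [Category.comp_id, ← free_η, reassoc_of% freeι_natural]
  rfl

/-- A Gram matrix over an algebra that is invertible yields dual families over the algebra. -/
theorem exists_dualFamilies_of_isUnit_det {X X' : T} (c : 𝟙_ T ⟶ X' ⊗ X) {m : ℕ}
    (a : Fin m → (F.obj X' ⟶ A)) (b : Fin m → (F.obj X ⟶ A))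
    (h : IsUnit (Matrix.of fun i k => contract c (a k) (b i)).det) :
    ∃ (b : Fin m → ((F ⋙ free A).obj X ⟶ 𝟙_ (AMod A))) (e : Fin m → (𝟙_ (AMod A) ⟶ (F ⋙ free A).obj X)),
      ∀ i k, e k ≫ b i = if i = k then 𝟙 _ else 0 := by
  set M := Matrix.of fun i k => contract c (a k) (b i) with hM
  choose a' ha' using fun k => exists_transpose_eq (a k)
  choose b' hb' using fun k => exists_transpose_eq (b k)
  -- The indices are interchanged because the rows of `M` belong to the `b i`, so that duality is
  -- the identity `M⁻¹ * M = 1`.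
  choose q hq using fun j i => exists_transpose_eq (M⁻¹ i j)
  refine exists_dualFamilies_of_gram c a' b' q fun i k => transpose_injective ?_
  have h1 : ∀ j, transpose (contract c (a' k) (b' j) * q j i) = M⁻¹ i j * M j k := by
    intro j
    rw [sections_mul_def, transpose_map, transpose_star, contract, transpose_map, transpose_star,
      ha', hb', hq, mul_comm]
    rfl
  have h2 := congrFun (congrFun (Matrix.nonsing_inv_mul M h) i) k
  rw [Matrix.mul_apply, Matrix.one_apply] at h2
  rw [transpose_sum, Finset.sum_congr rfl fun j _ => h1 j, h2]
  split_ifs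
  · exact transpose_starOne.symm
  · exact transpose_zero.symm

end Transpose

/-! ### Comparison of the two notions of module -/

section FreeModuleIsomorphisms

variable {D : Type u} [Category.{v} D] [MonoidalCategory D] {A : D} [MonObj A]

/-- Local freeness is stated with `Mod`, the symmetric monoidal category is built on `AMod`; both
record the same underlying maps and the same linearity condition. -/
theorem nonempty_freeMod_iso_iff (Y Z : D) :
    Nonempty (freeMod A Y ≅ freeMod A Z) ↔ Nonempty ((AMod.free A).obj Y ≅ (AMod.free A).obj Z) := by
  constructor
  · rintro ⟨e⟩
    exact ⟨⟨AMod.homMk e.hom.hom e.hom.isModHom.smul_hom.symm,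
      AMod.homMk e.inv.hom e.inv.isModHom.smul_hom.symm,
      AMod.hom_ext (congrArg Mod.Hom.hom e.hom_inv_id), AMod.hom_ext (congrArg Mod.Hom.hom e.inv_hom_id)⟩⟩
  · rintro ⟨e⟩
    exact ⟨⟨Mod.Hom.mk' (M := freeMod A Y) (N := freeMod A Z) e.hom.f (AMod.hom_act e.hom).symm,
      Mod.Hom.mk' (M := freeMod A Z) (N := freeMod A Y) e.inv.f (AMod.hom_act e.inv).symm,
      Mod.hom_ext _ _ (congrArg Monad.Algebra.Hom.f e.hom_inv_id),
      Mod.hom_ext _ _ (congrArg Monad.Algebra.Hom.f e.inv_hom_id)⟩⟩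

end FreeModuleIsomorphisms

/-! ### The multiplicity of the unit and the numerical condition -/

section Multiplicity

variable {T : Type u} [Category.{v} T] [Abelian T] [MonoidalCategory T] [SymmetricCategory T]
  [MonoidalPreadditive T] [HasDuals T] (p : ℕ) (X : T)

theorem not_isZero_extPow_zero (h : ¬ IsZero (𝟙_ T)) : ¬ IsZero (extPow X 0) := by
  rw [isZero_extPow_iff]
  have h1 : antisymmetrizer X 0 = 𝟙 (𝟙_ T) := by
    rw [antisymmetrizer, Fintype.sum_unique, Subsingleton.elim (default : Equiv.Perm (Fin 0)) 1,
      Equiv.Perm.sign_one, Units.val_one, one_smul, permAction_one]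
    rfl
  rw [h1]
  exact fun h2 => h ((IsZero.iff_id_eq_zero _).2 h2)

/-- Since `p ^ 0` reduces to `1` and `tensorPow X 1` to `X ⊗ 𝟙_ T`, the zeroth twist is the image of
a map through an object isomorphic to `X`. -/
theorem isZero_extPow_frob_zero {n : ℕ} (h : IsZero (extPow X n)) : IsZero (extPow (frob p 0 X) n) := by
  rw [isZero_extPow_iff] at h
  have h1 : antisymmetrizer (X ⊗ 𝟙_ T) n = 0 := by
    rw [← Category.comp_id (antisymmetrizer (X ⊗ 𝟙_ T) n), ← tensorPowMap_id, ← (ρ_ X).hom_inv_id,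
      tensorPowMap_comp, reassoc_of% antisymmetrizer_natural, h, zero_comp, comp_zero]
  have h2 : antisymmetrizer (tensorPow X (p ^ 0)) n = 0 := h1
  rw [frob, isZero_extPow_image_iff, h2, zero_comp, comp_zero]

theorem unitMult_condition_iff (hT : ¬ IsZero (𝟙_ T)) :
    (unitMult p X ≠ ⊤ ∧ ∀ r : ℕ, unitMult p X < r → IsZero (extPow X r)) ↔
      (∃ n : ℕ, IsZero (extPow X n)) ∧
        ∀ j n : ℕ, IsZero (extPow (frob p j X) n) → IsZero (extPow X n) := by
  constructor
  · rintro ⟨h1, h2⟩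
    have h3 : ∃ n : ℕ, IsZero (extPow X n) := by
      obtain ⟨m, hm⟩ := ENat.ne_top_iff_exists.1 h1
      exact ⟨m + 1, h2 _ (by rw [← hm]; exact_mod_cast Nat.lt_succ_self m)⟩
    refine ⟨h3, fun j n hn => h2 n ?_⟩
    -- A strict bound by `n` is needed. The truncated subtraction is harmless, as `n ≠ 0`: the
    -- zeroth exterior power is the nonzero unit.
    have hle : unitMult p X ≤ (n - 1 : ℕ) := sSup_le fun a ha => by
      obtain ⟨r, rfl, hr⟩ := ha
      have : r < n := by
        by_contra! h
        exact hr j (isZero_extPow_mono _ h hn)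
      exact_mod_cast Nat.le_sub_one_of_lt this
    have hn0 : n ≠ 0 := by
      rintro rfl
      exact not_isZero_extPow_zero _ hT hn
    refine hle.trans_lt ?_
    exact_mod_cast Nat.sub_one_lt hn0
  · rintro ⟨⟨n, hn⟩, h⟩
    -- For finiteness the index `j = 0` suffices.
    have hle : unitMult p X ≤ n := sSup_le fun a ha => by
      obtain ⟨r, rfl, hr⟩ := ha
      have hrn : r ≤ n := by
        by_contra! hrn
        exact hr 0 (isZero_extPow_frob_zero p X (isZero_extPow_mono X hrn.le hn))
      exact_mod_cast hrn
    refine ⟨(hle.trans_lt (ENat.natCast_lt_top n)).ne, fun r hr => ?_⟩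
    by_contra hXr
    refine hr.not_ge (le_sSup ⟨r, rfl, fun j hj => hXr (h j r hj)⟩)

end Multiplicity

/-! ### Local freeness and the equivalence of the conditions -/

section LocallyFreeObjects

open Functor.OplaxMonoidal Functor.LaxMonoidal

attribute [local instance] Abelian.hasFiniteBiproducts

section

variable {T : Type u} [Category.{v} T] [Abelian T] [MonoidalCategory T] [SymmetricCategory T]

theorem natCast_sections_eq_zero {p : ℕ} (hp : p • 𝟙 (𝟙_ T) = 0) {C : Type u₂} [Category.{v₂} C] [Preadditive C] [MonoidalCategory C]
    [SymmetricCategory C] [MonoidalPreadditive C] (F : T ⥤ C) [F.Braided] [F.Additive] (S : C) [MonObj S]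
    [IsCommMonObj S] : (p : F.obj (𝟙_ T) ⟶ S) = 0 := by
  have h2 : p • (1 : F.obj (𝟙_ T) ⟶ S) = F.map (p • 𝟙 (𝟙_ T)) ≫ 1 := by
    rw [Functor.map_nsmul, CategoryTheory.Functor.map_id, Preadditive.nsmul_comp, Category.id_comp]
  rw [← nsmul_one, h2, hp, Functor.map_zero, zero_comp]

theorem contract_hom {C : Type u₂} [Category.{v₂} C] [Preadditive C] [MonoidalCategory C]
    [SymmetricCategory C] [MonoidalPreadditive C] {F : T ⥤ C} [F.Braided] {R S : C} [MonObj R] [MonObj S]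
    (φ : R ⟶ S) [IsMonHom φ] {A A' : T} (c : 𝟙_ T ⟶ A' ⊗ A) (a : F.obj A' ⟶ R) (b : F.obj A ⟶ R) :
    contract c (a ≫ φ) (b ≫ φ) = contract c a b ≫ φ := by
  rw [contract, contract, Category.assoc, star_comp]

theorem det_contract_hom {C : Type u₂} [Category.{v₂} C] [Preadditive C] [MonoidalCategory C]
    [SymmetricCategory C] [MonoidalPreadditive C] {F : T ⥤ C} [F.Braided] [F.Additive] {R S : C} [MonObj R]
    [IsCommMonObj R] [MonObj S] [IsCommMonObj S] (φ : R ⟶ S) [IsMonHom φ] {X X' : T} (c : 𝟙_ T ⟶ X' ⊗ X)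
    {n : ℕ} (a : Fin n → (F.obj X' ⟶ R)) (b : Fin n → (F.obj X ⟶ R)) :
    (Matrix.of fun i k => contract c (a k ≫ φ) (b i ≫ φ)).det =
      (Matrix.of fun i k => contract c (a k) (b i)).det ≫ φ := by
  rw [← contract_antisymmetrizer, ← contract_antisymmetrizer, ← contract_hom, Category.assoc, starProd_comp,
    starProd_comp]

/-- There is a non-zero algebra with families of functionals whose Gram matrix is invertible. -/
theorem exists_algebra_isUnit_det [MonoidalPreadditive T] [HasDuals T] [EssentiallySmall.{v} T]
    {p : ℕ} [Fact p.Prime] (hp : p • 𝟙 (𝟙_ T) = 0) {X X' : T} {c : 𝟙_ T ⟶ X' ⊗ X} (hc : IsCoevaluation c) {m : ℕ}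
    (h : ∀ j, ¬ IsZero (extPow (frob p j X) m)) :
    ∃ (B : Ind T) (_ : MonObj B) (_ : IsCommMonObj B) (a : Fin m → (Ind.yoneda.obj X' ⟶ B))
      (b : Fin m → (Ind.yoneda.obj X ⟶ B)), ¬ IsZero B ∧
        IsUnit (Matrix.of fun i k => contract c (a k) (b i)).det := by
  obtain ⟨R, _, _, a, ha⟩ := exists_isGeneric (exists_generic (D := Ind T) Ind.yoneda X') m
  obtain ⟨S, _, _, b, hb⟩ := exists_isGeneric (exists_generic (D := Ind T) Ind.yoneda X) m
  -- Were the `n`-th power of the determinant zero, so would be its `p ^ n`-th power, since `n < p ^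
  -- n`; this contradicts the hypothesis at `j = n`.
  obtain ⟨B, _, _, φ, _, hB, hd⟩ := exists_localization
    (Matrix.of fun i k => contract c (a k ≫ tensorInl R S) (b i ≫ tensorInr R S)).det fun n hn => h n
      (isZero_extPow_frob_of_det hc p n ha hb (natCast_sections_eq_zero hp _ _)
        (pow_eq_zero_of_le (Nat.lt_pow_self (Fact.out : p.Prime).one_lt).le hn))
  refine ⟨B, inferInstance, inferInstance, fun k => (a k ≫ tensorInl R S) ≫ φ,
    fun i => (b i ≫ tensorInr R S) ≫ φ, hB, ?_⟩
  rwa [det_contract_hom]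

end

variable (k : Type w) [Field k] {T : Type u} [Category.{v} T] [Abelian T]
  [Linear k T] [MonoidalCategory T] [SymmetricCategory T] [IsTensorCategory k T]

theorem locallyFree_of_numerics (p : ℕ) [Fact p.Prime] [CharP k p] (X : T) (h : (∃ n : ℕ, IsZero (extPow X n)) ∧
    ∀ j n : ℕ, IsZero (extPow (frob p j X) n) → IsZero (extPow X n)) : LocallyFree X := by
  have h1 : ∀ X : T, PreservesFiniteColimits (tensorLeft X) := preservesFiniteColimits_tensorLeft k T
  have := hasDuals k T
  classical
  have hp : p • 𝟙 (𝟙_ T) = 0 := by rw [← Nat.cast_smul_eq_nsmul k, CharP.cast_eq_zero, zero_smul]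
  obtain ⟨hn, hfr⟩ := h
  -- The future rank `m` is one less than the first degree in which the exterior power vanishes;
  -- that degree is not `0`, as the zeroth exterior power is the unit.
  obtain ⟨m, hm, hm'⟩ : ∃ m, IsZero (extPow X (m + 1)) ∧ ¬ IsZero (extPow X m) := by
    have h0 : Nat.find hn ≠ 0 := fun h0 => not_isZero_extPow_zero X (RightExactSymMonoidal.unit_ne_zero k)
      (h0 ▸ Nat.find_spec hn)
    obtain ⟨m, hm⟩ := Nat.exists_eq_succ_of_ne_zero h0
    exact ⟨m, by rw [← Nat.succ_eq_add_one, ← hm]; exact Nat.find_spec hn,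
      Nat.find_min hn (hm ▸ Nat.lt_succ_self m)⟩
  obtain ⟨X', ⟨P⟩⟩ := HasDuals.exists_exactPairing X
  obtain ⟨c, hc⟩ := exists_isCoevaluation P
  obtain ⟨B, _, _, a, b, hB, hdet⟩ := exists_algebra_isUnit_det hp hc fun j hj => hm' (hfr j m hj)
  have h2 : ∀ A : Ind T, PreservesFiniteColimits (tensorLeft A) := fun A => inferInstance
  have : PreservesFiniteColimits (AMod.free B) := ⟨fun J _ _ =>
    (AMod.freeAdj B).leftAdjoint_preservesColimits.preservesColimitsOfShape⟩
  have : PreservesFiniteColimits (Ind.yoneda (C := T) ⋙ AMod.free B) := comp_preservesFiniteColimits _ _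
  have : (Ind.yoneda (C := T) ⋙ AMod.free B).Additive := additive_of_preservesFiniteColimits _
  obtain ⟨b', e', he⟩ := exists_dualFamilies_of_isUnit_det c a b hdet
  obtain ⟨e⟩ := nonempty_iso_of_dualFamilies ((isZero_extPow_iff _ _).1 hm) b' e' he
  refine ⟨B, inferInstance, inferInstance, m, hB, (nonempty_freeMod_iso_iff _ _).2 ⟨?_⟩⟩
  exact e ≪≫ (biproduct.mapIso fun _ => Functor.Monoidal.εIso (Ind.yoneda (C := T) ⋙ AMod.free B)) ≪≫
    ((Ind.yoneda (C := T) ⋙ AMod.free B).mapBiproduct _).symm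

theorem trivialized_of_locallyFree (X : T) (h : LocallyFree X) :
    TrivializedByTensorFunctor.{w, v, u, v, max u (v + 1)} k X := by
  obtain ⟨A, _, _, m, hA, e⟩ := h
  obtain ⟨e⟩ := (nonempty_freeMod_iso_iff _ _).1 e
  exact trivialized_of_algebra k X hA m e

end LocallyFreeObjects

end

end TensorCat

theorem theorem4p2 (k : Type w) [Field k] (p : ℕ) [Fact p.Prime] [CharP k p]
    (T : Type u) [Category.{v} T] [Abelian T] [Linear k T] [MonoidalCategory T]
    [SymmetricCategory T] [IsTensorCategory k T] (X : T) :
    List.TFAE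
      [unitMult p X ≠ ⊤ ∧ ∀ r : ℕ, unitMult p X < r → IsZero (extPow X r),
        (∃ n : ℕ, IsZero (extPow X n)) ∧
          ∀ j n : ℕ, IsZero (extPow (frob p j X) n) → IsZero (extPow X n),
        LocallyFree X,
        TrivializedByTensorFunctor.{w, v, u, v, max u (v + 1)} k X] ∧
      (TrivializedByTensorFunctor.{w, v, u, v₂, u₂} k X → LocallyFree X) := by
  have := hasDuals k T
  have h12 := unitMult_condition_iff p X (RightExactSymMonoidal.unit_ne_zero k (C := T))
  -- The universes of condition 4 in the list are those of the category of modules in `Ind T`. A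
  -- trivialising functor to a category in any other universes gives local freeness by the same
  -- argument.
  refine ⟨?_, fun h => locallyFree_of_numerics k p X (numerics_of_trivialized k p X h)⟩
  tfae_have 1 ↔ 2 := h12
  tfae_have 2 → 3 := locallyFree_of_numerics k p X
  tfae_have 3 → 4 := trivialized_of_locallyFree k X
  tfae_have 4 → 2 := numerics_of_trivialized k p X
  tfae_finish
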